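/- Let $\mathcal R=(X,R_0,Y,R_0^\vee,F_0)$ be a based root datum: $X,Y$ are lattices of finite rank in perfect duality, $R_0\subset X$ is a finite reduced root system with coroots $R_0^\vee\subset Y$, and $F_0=\{\alpha_1,\dots,\alpha_r\}$ is a base. Let $W_0$ be the Weyl group, $W=X\rtimes W_0$ (acting on affine functions and, through the projection $X\otimes\mathbb R\to E$ along $Z(W)\otimes\mathbb R$, on $E=\mathbb R R_0$), with centre $Z(W)$. Affine roots are the functions $(\alpha^\vee,k):x\mapsto\langle x,\alpha^\vee\rangle+k$, $\alpha^\vee\in R_0^\vee$, $k\in\mathbb Z$; such a root is positive if $k>0$, or $k=0$ and $\alpha^\vee>0$, and negative otherwise. Let $\ell(w)$ be the number of positive affine roots made negative by $w\in W$, and $\Omega=\{\omega\in W:\ell(\omega)=0\}$. For an affine root $a=(\alpha^\vee,k)$ let $s_a(x)=x-\langle x,\alpha^\vee\rangle\alpha-k\alpha$. The simple affine roots $F^{\mathrm{aff}}$ are the $(\alpha_i^\vee,0)$ with $\alpha_i\in F_0$, and the $(-\alpha^\vee,1)$ with $\alpha^\vee$ a maximal coroot for the dominance order; $S^{\mathrm{aff}}=\{s_a:a\in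 F^{\mathrm{aff}}\}$. Let $q:W\to(0,\infty)$ satisfy $q(\omega)=1$ for $\omega\in\Omega$ and $q(wv)=q(w)q(v)$ whenever $\ell(wv)=\ell(w)+\ell(v)$. The affine Hecke algebra $\mathcal H=\mathcal H(\mathcal R,q)$ is the complex unital algebra with generators $T_w$ $(w\in W)$ and relations $T_e=1$, $T_wT_v=T_{wv}$ if $\ell(wv)=\ell(w)+\ell(v)$, and $T_sT_s=(q(s)-1)T_s+q(s)T_e$ for $s\in S^{\mathrm{aff}}$. The facets of the fundamental alcove are the nonempty sets $A_J=\{x\in E: a(x)=0\ \forall a\in J,\ a(x)>0\ \forall a\in F^{\mathrm{aff}}\setminus J\}$, $J\subset F^{\mathrm{aff}}$. For $f=A_J$ let $W_f=\langle s_a:a\in J\rangle$, let $\mathcal H(W_f,q)\subset\mathcal H$ be the subalgebra generated by the $T_w$, $w\in W_f$, and identify $\mathcal H(W_f,q)\otimes\mathbb C[Z(W)]$ with the subalgebra of $\mathcal H$ generated by $\mathcal H(W_f,q)$ and the $T_z$, $z\in Z(W)$. Fix an arbitrary orientation of every facet (vertices being positively oriented), and let $[f:f']$ be the resulting incidence numbers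 of the cellular boundary map, $\partial\bar f=\sum_{f'}[f:f']\,\bar f'$. For $n\ge 0$ let $$P_n(\mathcal H)=\bigoplus_{f:\dim f=n}\mathcal H\otimes_{\mathcal H(W_f,q)\otimes\mathbb C[Z(W)]}\mathcal H\otimes_{\mathbb C}\mathbb C\{f\},$$ with the bimodule maps $d_n(h\otimes h'\otimes f)=\sum_{f'}h\otimes h'\otimes[f:f']f'$ for $n\ge1$ and $d_0(h\otimes h'\otimes x)=hh'$ for vertices $x$. The group $\Omega$ acts by $\omega(h\otimes h'\otimes f)=hT_\omega^{-1}\otimes T_\omega h'\otimes\omega(f)$, where $\omega(f)$ carries the transported orientation; let $P_n(\mathcal H)^\Omega$ be the invariants. **Theorem.** The maps $d_n$ restrict to $$0\longleftarrow\mathcal H\xleftarrow{d_0}P_0(\mathcal H)^\Omega\xleftarrow{d_1}P_1(\mathcal H)^\Omega\longleftarrow\cdots\xleftarrow{d_r}P_r(\mathcal H)^\Omega\longleftarrow0,$$ and this is a resolution (an exact complex) of $\mathcal H$ by $\mathcal H\otimes\mathcal H^{op}$-modules; $P_n(\mathcal H)=0$ for $n>r$. Every $P_n(\mathcal H)^\Omega$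 is projective as a left and as a right $\mathcal H$-module. If $\mathcal R$ is semisimple (no nonzero element of $Y$ vanishes on $R_0$), then every $P_n(\mathcal H)^\Omega$ is projective as an $\mathcal H\otimes\mathcal H^{op}$-module. -/

import Mathlib

open scoped TensorProduct
open MulOpposite

namespace AffineHecke

noncomputable section

/-! ### The extended affine Weyl group and its length function -/

section Weyl

variable {ι X Y : Type*} [AddCommGroup X] [AddCommGroup Y]

/-- The action of `W₀` on the lattice `X`, as automorphisms of `X` written multiplicatively. -/
def latticeAction (P : RootDatum ι X Y) : P.weylGroup →* MulAut (Multiplicative X) :=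
  (MulAutMultiplicative X).symm.toMonoidHom.comp (DistribMulAction.toAddAut P.weylGroup X)

/-- The extended affine Weyl group `W = X ⋊ W₀`. The pair `(x, v)` stands for the affine
transformation `y ↦ x + v y`. -/
abbrev ExtWeyl (P : RootDatum ι X Y) : Type _ :=
  Multiplicative X ⋊[latticeAction P] P.weylGroup

/-- The affine root system is `R₀^∨ × ℤ`. The pair `(i, k)` stands for the affine function
`x ↦ ⟨x, α_i^∨⟩ + k`, and `w` in `W` sends an affine root `a` to the affine function `a ∘ w⁻¹`;
for `w = (x, v)` this is `(α^∨, k) ↦ (v α^∨, k - ⟨x, v α^∨⟩)`. -/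
def affAct {P : RootDatum ι X Y} (w : ExtWeyl P) (a : ι × ℤ) : ι × ℤ :=
  (w.right • a.1, a.2 - P.toLinearMap w.left.toAdd (P.coroot (w.right • a.1)))

/-- The positive affine roots. -/
def posAff {P : RootDatum ι X Y} (b : P.Base) : Set (ι × ℤ) :=
  {a | 0 < a.2 ∨ (a.2 = 0 ∧ b.IsPos a.1)}

/-- The negative affine roots. -/
def negAff {P : RootDatum ι X Y} (b : P.Base) : Set (ι × ℤ) :=
  {a | a.2 < 0 ∨ (a.2 = 0 ∧ ¬ b.IsPos a.1)}

/-- The length `ℓ(w)`: the number of positive affine roots that `w` makes negative. -/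
def length {P : RootDatum ι X Y} (b : P.Base) (w : ExtWeyl P) : ℕ :=
  {a | a ∈ posAff b ∧ affAct w a ∈ negAff b}.ncard

/-- `Ω`, the elements of length zero in `W`. -/
def Omega {P : RootDatum ι X Y} (b : P.Base) : Set (ExtWeyl P) :=
  {w | length b w = 0}

/-- The reflection `s_a (x) = x - ⟨x, α^∨⟩ α - k α` for the affine root `a = (α^∨, k)`. -/
def affRefl (P : RootDatum ι X Y) (a : ι × ℤ) : ExtWeyl P :=
  ⟨Multiplicative.ofAdd (-a.2 • P.root a.1), RootPairing.weylGroup.ofIdx P a.1⟩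

/-- The `i`-th coroot is maximal for the dominance ordering on the set of coroots. -/
def IsMaxCoroot {P : RootDatum ι X Y} (b : P.Base) (i : ι) : Prop :=
  ∀ j, P.coroot j - P.coroot i ∈ AddSubmonoid.closure (P.coroot '' b.support) → j = i

/-- The simple affine roots `F^aff`: the `(α^∨, 0)` with `α` simple and the `(-α^∨, 1)` with
`α^∨` a maximal coroot. -/
def simpleAff {P : RootDatum ι X Y} (b : P.Base) : Set (ι × ℤ) :=
  {a | (a.1 ∈ b.support ∧ a.2 = 0) ∨
    (a.2 = 1 ∧ ∃ i, IsMaxCoroot b i ∧ P.coroot a.1 = -P.coroot i)}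

/-- `q : W → (0, ∞)` is a parameter function. -/
structure IsParameter {P : RootDatum ι X Y} (b : P.Base) (q : ExtWeyl P → ℝ) : Prop where
  pos : ∀ w, 0 < q w
  omega : ∀ w ∈ Omega b, q w = 1
  mul : ∀ w v, length b (w * v) = length b w + length b v → q (w * v) = q w * q v

/-- The root datum is semisimple: `R₀^⊥ = 0` in `Y`. -/
def IsSemisimpleDatum (P : RootDatum ι X Y) : Prop :=
  ∀ y : Y, (∀ i, P.toLinearMap (P.root i) y = 0) → y = 0

/-! #### Facts on lengths -/

@[simp] lemma latticeAction_apply (P : RootDatum ι X Y) (v : P.weylGroup)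
    (x : Multiplicative X) :
    latticeAction P v x = Multiplicative.ofAdd (v • x.toAdd) := rfl

lemma pairing_smul {P : RootDatum ι X Y} (v : P.weylGroup) (x : X) (i : ι) :
    P.toLinearMap (v • x) (P.coroot (v • i)) = P.toLinearMap x (P.coroot i) := by
  have h1 := LinearMap.congr_fun (LinearMap.congr_fun
    v.1.toHom.weight_coweight_transpose (P.coroot (v • i))) x
  have h2 := congrFun v.1.toHom.coroot_coweightMap (v • i)
  simp only [Function.comp] at h2
  have h3 : v.1.toHom.indexEquiv.symm (v • i) = i :=
    v.1.toHom.indexEquiv.symm_apply_apply i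
  rw [h3] at h2
  have h4 : P.toLinearMap (v.1.toHom.weightMap x) (P.coroot (v • i)) =
      P.toLinearMap x (v.1.toHom.coweightMap (P.coroot (v • i))) := by
    simpa using h1
  rw [h2] at h4
  exact h4

lemma affAct_one (P : RootDatum ι X Y) (a : ι × ℤ) : affAct (1 : ExtWeyl P) a = a := by
  simp [affAct]

lemma affAct_mul {P : RootDatum ι X Y} (w v : ExtWeyl P) (a : ι × ℤ) :
    affAct (w * v) a = affAct w (affAct v a) := by
  ext
  · simp [affAct, mul_smul]
  · simp only [affAct, SemidirectProduct.mul_left, SemidirectProduct.mul_right,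
      latticeAction_apply, toAdd_mul, toAdd_ofAdd, map_add, LinearMap.add_apply, mul_smul,
      pairing_smul]
    ring

lemma negAff_eq_compl {P : RootDatum ι X Y} (b : P.Base) : negAff b = (posAff b)ᶜ := by
  ext a
  simp only [negAff, posAff, Set.mem_ofPred_eq, Set.mem_compl_iff]
  rcases lt_trichotomy a.2 0 with h | h | h
  · simp [h, h.ne, h.le]
  · simp [h]
  · simp [h, h.ne', h.le]

lemma length_set_finite [Finite ι] {P : RootDatum ι X Y} (b : P.Base) (w : ExtWeyl P) :
    {a | a ∈ posAff b ∧ affAct w a ∈ negAff b}.Finite := by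
  have h : (⋃ i : ι, ({i} : Set ι) ×ˢ Set.Icc (0 : ℤ)
      (P.toLinearMap w.left.toAdd (P.coroot (w.right • i)))).Finite :=
    Set.finite_iUnion fun i => (Set.finite_singleton i).prod (Set.finite_Icc _ _)
  refine h.subset ?_
  rintro ⟨i, k⟩ ⟨h1, h2⟩
  simp only [posAff, negAff, affAct, Set.mem_ofPred_eq] at h1 h2
  simp only [Set.mem_iUnion, Set.mem_prod, Set.mem_singleton_iff, Set.mem_Icc]
  refine ⟨i, rfl, ?_, ?_⟩ <;> omega

lemma mem_Omega_iff [Finite ι] {P : RootDatum ι X Y} (b : P.Base) (w : ExtWeyl P) :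
    w ∈ Omega b ↔ ∀ a ∈ posAff b, affAct w a ∈ posAff b := by
  rw [Omega, Set.mem_ofPred_eq, length, Set.ncard_eq_zero (length_set_finite b w),
    Set.eq_empty_iff_forall_notMem, negAff_eq_compl]
  simp

lemma smul_reflectionPerm_self {P : RootDatum ι X Y} (v : P.weylGroup) (i : ι) :
    v • P.reflectionPerm i i = P.reflectionPerm (v • i) (v • i) := by
  apply P.root.injective
  have h (j : ι) : P.root (v • j) = v • P.root j := (P.weylGroup_apply_root v j).symm
  rw [h, P.root_reflectionPerm, P.root_reflectionPerm, P.reflection_apply_self,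
    P.reflection_apply_self, h, smul_neg]

/-- The negative of an affine root. -/
def negRoot (P : RootDatum ι X Y) (a : ι × ℤ) : ι × ℤ := (P.reflectionPerm a.1 a.1, -a.2)

lemma affAct_negRoot {P : RootDatum ι X Y} (w : ExtWeyl P) (a : ι × ℤ) :
    affAct w (negRoot P a) = negRoot P (affAct w a) := by
  ext
  · simp [affAct, negRoot, smul_reflectionPerm_self]
  · simp only [affAct, negRoot, smul_reflectionPerm_self, P.coroot_reflectionPerm,
      P.coreflection_apply_self, map_neg]
    ring

lemma negRoot_mem_iff {P : RootDatum ι X Y} (b : P.Base) (a : ι × ℤ) :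
    negRoot P a ∈ posAff b ↔ a ∉ posAff b := by
  let := P.indexNeg
  have h : b.IsPos (P.reflectionPerm a.1 a.1) ↔ ¬ b.IsPos a.1 :=
    RootPairing.Base.IsPos.neg_iff_not b a.1
  simp only [posAff, negRoot, Set.mem_ofPred_eq, h]
  rcases lt_trichotomy a.2 0 with h | h | h
  · simp [h, h.ne, h.le]
  · simp [h]
  · simp [h, h.ne', h.le]

lemma affAct_inv_affAct {P : RootDatum ι X Y} (w : ExtWeyl P) (a : ι × ℤ) :
    affAct w⁻¹ (affAct w a) = a := by
  rw [← affAct_mul, inv_mul_cancel, affAct_one]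

lemma affAct_affAct_inv {P : RootDatum ι X Y} (w : ExtWeyl P) (a : ι × ℤ) :
    affAct w (affAct w⁻¹ a) = a := by
  rw [← affAct_mul, mul_inv_cancel, affAct_one]

lemma affAct_mem_iff [Finite ι] {P : RootDatum ι X Y} {b : P.Base} {w : ExtWeyl P}
    (hw : w ∈ Omega b) (a : ι × ℤ) : affAct w a ∈ posAff b ↔ a ∈ posAff b := by
  rw [mem_Omega_iff] at hw
  refine ⟨fun h => ?_, hw a⟩
  by_contra h'
  rw [← negRoot_mem_iff] at h'
  have := hw _ h'
  rw [affAct_negRoot, negRoot_mem_iff] at this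
  exact this h

lemma inv_mem_Omega [Finite ι] {P : RootDatum ι X Y} {b : P.Base} {w : ExtWeyl P}
    (hw : w ∈ Omega b) : w⁻¹ ∈ Omega b := by
  rw [mem_Omega_iff]
  intro a ha
  rwa [← affAct_mem_iff hw, affAct_affAct_inv]

lemma length_Omega_mul [Finite ι] {P : RootDatum ι X Y} {b : P.Base} {w : ExtWeyl P}
    (hw : w ∈ Omega b) (v : ExtWeyl P) : length b (w * v) = length b v := by
  simp only [length, negAff_eq_compl, Set.mem_compl_iff, affAct_mul, affAct_mem_iff hw]

lemma length_mul_Omega [Finite ι] {P : RootDatum ι X Y} {b : P.Base} {w : ExtWeyl P}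
    (hw : w ∈ Omega b) (v : ExtWeyl P) : length b (v * w) = length b v := by
  have h : {a | a ∈ posAff b ∧ affAct v a ∈ negAff b} =
      affAct w '' {a | a ∈ posAff b ∧ affAct (v * w) a ∈ negAff b} := by
    ext a
    constructor
    · rintro ⟨h1, h2⟩
      refine ⟨affAct w⁻¹ a, ⟨?_, ?_⟩, affAct_affAct_inv w a⟩
      · rwa [affAct_mem_iff (inv_mem_Omega hw)]
      · rwa [affAct_mul, affAct_affAct_inv]
    · rintro ⟨c, ⟨h1, h2⟩, rfl⟩
      exact ⟨(affAct_mem_iff hw c).2 h1, by rwa [← affAct_mul]⟩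
  rw [length, length, h, Set.ncard_image_of_injective]
  exact Function.LeftInverse.injective (affAct_inv_affAct w)

lemma length_Omega {P : RootDatum ι X Y} {b : P.Base} {w : ExtWeyl P}
    (hw : w ∈ Omega b) : length b w = 0 := hw

lemma one_mem_Omega [Finite ι] {P : RootDatum ι X Y} (b : P.Base) :
    (1 : ExtWeyl P) ∈ Omega b := by
  rw [mem_Omega_iff]
  simp [affAct_one]

lemma conj_affRefl {P : RootDatum ι X Y} (w : ExtWeyl P) (a : ι × ℤ) :
    w * affRefl P a * w⁻¹ = affRefl P (affAct w a) := by
  have h (j : ι) : P.root (w.right • j) = w.right • P.root j :=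
    (P.weylGroup_apply_root w.right j).symm
  have hr (x : X) : w.right • (RootPairing.weylGroup.ofIdx P a.1 • (w.right⁻¹ • x)) =
      RootPairing.weylGroup.ofIdx P (w.right • a.1) • x := by
    obtain ⟨y, rfl⟩ : ∃ y, x = w.right • y := ⟨w.right⁻¹ • x, by simp⟩
    rw [inv_smul_smul]
    change w.right • P.reflection a.1 y = P.reflection (w.right • a.1) (w.right • y)
    simp only [P.reflection_apply, smul_sub, h, RootPairing.coroot', LinearMap.flip_apply,
      pairing_smul, smul_comm w.right (P.toLinearMap y (P.coroot a.1))]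
  rw [mul_inv_eq_iff_eq_mul]
  refine SemidirectProduct.ext ?_ ?_
  · apply Multiplicative.toAdd.injective
    have hx : RootPairing.weylGroup.ofIdx P (w.right • a.1) • w.left.toAdd =
        w.left.toAdd - P.toLinearMap w.left.toAdd (P.coroot (w.right • a.1)) •
          w.right • P.root a.1 := by
      change P.reflection (w.right • a.1) w.left.toAdd = _
      simp only [P.reflection_apply, h, RootPairing.coroot', LinearMap.flip_apply]
    simp only [affRefl, affAct, SemidirectProduct.mul_left, latticeAction_apply, toAdd_mul,
      toAdd_ofAdd, hx, h, smul_comm w.right (-a.2)]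
    generalize w.right • P.root a.1 = r
    module
  · simp only [affRefl, affAct, SemidirectProduct.mul_right]
    apply Subtype.ext
    apply RootPairing.Equiv.weightHom_injective P
    apply LinearEquiv.ext
    intro x
    have := hr (w.right • x)
    rw [inv_smul_smul] at this
    exact this

end Weyl
/-! ### Facets of the fundamental alcove and their orientations -/

section Facets

variable {ι X Y : Type*} [AddCommGroup X] [AddCommGroup Y]

/-- The pairing of a vector of `X ⊗ ℝ` with the `i`-th coroot. -/
def corootR (P : RootDatum ι X Y) (i : ι) : ℝ ⊗[ℤ] X →ₗ[ℝ] ℝ :=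
  Module.Dual.baseChange ℝ (P.coroot' i)

/-- The space `E ⊆ X ⊗ ℝ` spanned by the roots. -/
def euclid (P : RootDatum ι X Y) : Submodule ℝ (ℝ ⊗[ℤ] X) :=
  Submodule.span ℝ (Set.range fun i => (1 : ℝ) ⊗ₜ[ℤ] P.root i)

/-- The value at a point of the affine root `(i, k)`, that is `⟨x, α_i^∨⟩ + k`. -/
def affEval (P : RootDatum ι X Y) (a : ι × ℤ) (x : ℝ ⊗[ℤ] X) : ℝ :=
  corootR P a.1 x + a.2

/-- For a set `J` of simple affine roots, the set `A_J` of the points of `E` where the members of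
`J` vanish and the other simple affine roots are positive. `A_∅` is the fundamental alcove. -/
def alcoveFace {P : RootDatum ι X Y} (b : P.Base) (J : Set (ι × ℤ)) : Set (ℝ ⊗[ℤ] X) :=
  {x | x ∈ euclid P ∧ (∀ a ∈ J, affEval P a x = 0) ∧ ∀ a ∈ simpleAff b \ J, 0 < affEval P a x}

/-- The subspace of `E` where the linear parts of the members of `J` vanish. If `A_J` is not empty,
it is the direction of the affine hull of `A_J`. -/
def faceDir (P : RootDatum ι X Y) (J : Set (ι × ℤ)) : Submodule ℝ (ℝ ⊗[ℤ] X) :=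
  euclid P ⊓ ⨅ a ∈ J, LinearMap.ker (corootR P a.1)

/-- The `n`-dimensional facets of the fundamental alcove: the nonempty `A_J` of dimension `n`
(`A_J` determines `J`). -/
structure Facet {P : RootDatum ι X Y} (b : P.Base) (n : ℕ) where
  J : Set (ι × ℤ)
  subset : J ⊆ simpleAff b
  nonempty : (alcoveFace b J).Nonempty
  dim : Module.finrank ℝ (faceDir P J) = n

/-- An orientation of every facet of the fundamental alcove, each given by an ordered basis of the
direction of the facet. Vertices have only the positive orientation. -/
abbrev Orientations {P : RootDatum ι X Y} (b : P.Base) : Type _ :=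
  ∀ (n : ℕ) (f : Facet b n), Module.Basis (Fin n) ℝ (faceDir P f.J)

/-- The stabilizer `W_J`, generated by the reflections in the members of `J`; for a facet
`f = A_J` this is `W_f`. -/
def stabJ (P : RootDatum ι X Y) (J : Set (ι × ℤ)) : Subgroup (ExtWeyl P) :=
  Subgroup.closure (affRefl P '' J)

/-- The linear part on `X ⊗ ℝ` of an element of `W`. -/
def linPart {P : RootDatum ι X Y} (w : ExtWeyl P) : ℝ ⊗[ℤ] X →ₗ[ℝ] ℝ ⊗[ℤ] X :=
  (P.weylGroupRootRep w.right).baseChange ℝ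

lemma mem_faceDir {P : RootDatum ι X Y} {J : Set (ι × ℤ)} {x : ℝ ⊗[ℤ] X} :
    x ∈ faceDir P J ↔ x ∈ euclid P ∧ ∀ a ∈ J, corootR P a.1 x = 0 := by
  simp [faceDir]

lemma faceDir_anti {P : RootDatum ι X Y} {J J' : Set (ι × ℤ)} (h : J ⊆ J') :
    faceDir P J' ≤ faceDir P J := fun x hx => by
  rw [mem_faceDir] at hx ⊢
  exact ⟨hx.1, fun a ha => hx.2 a (h ha)⟩

lemma sub_mem_faceDir {P : RootDatum ι X Y} {b : P.Base} {J J' : Set (ι × ℤ)} (h : J ⊆ J')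
    {x y : ℝ ⊗[ℤ] X} (hx : x ∈ alcoveFace b J) (hy : y ∈ alcoveFace b J') :
    y - x ∈ faceDir P J := by
  rw [mem_faceDir]
  refine ⟨sub_mem hy.1 hx.1, fun a ha => ?_⟩
  have h1 := hx.2.1 a ha
  have h2 := hy.2.1 a (h ha)
  simp only [affEval] at h1 h2
  rw [map_sub]
  linarith

@[simp] lemma corootR_tmul (P : RootDatum ι X Y) (i : ι) (r : ℝ) (x : X) :
    corootR P i (r ⊗ₜ x) = r * (P.toLinearMap x (P.coroot i) : ℤ) := by
  simp [corootR, mul_comm]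

lemma corootR_linPart {P : RootDatum ι X Y} (w : ExtWeyl P) (i : ι) (x : ℝ ⊗[ℤ] X) :
    corootR P (w.right • i) (linPart w x) = corootR P i x := by
  induction x using TensorProduct.induction_on with
  | zero => simp
  | add x y hx hy => simp [hx, hy]
  | tmul r x =>
    simp only [linPart, LinearMap.baseChange_tmul, corootR_tmul]
    congr 2
    exact pairing_smul w.right x i

lemma linPart_mem_euclid {P : RootDatum ι X Y} (w : ExtWeyl P) {x : ℝ ⊗[ℤ] X}
    (hx : x ∈ euclid P) : linPart w x ∈ euclid P := by
  suffices h : euclid P ≤ (euclid P).comap (linPart w) from h hx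
  rw [euclid, Submodule.span_le]
  rintro _ ⟨i, rfl⟩
  refine Submodule.subset_span ⟨w.right • i, ?_⟩
  simp only [linPart, LinearMap.baseChange_tmul]
  congr 1
  exact (P.weylGroup_apply_root w.right i).symm

lemma linPart_mem_faceDir {P : RootDatum ι X Y} (w : ExtWeyl P) {J : Set (ι × ℤ)}
    {x : ℝ ⊗[ℤ] X} (hx : x ∈ faceDir P J) : linPart w x ∈ faceDir P (affAct w '' J) := by
  rw [mem_faceDir] at hx ⊢
  refine ⟨linPart_mem_euclid w hx.1, ?_⟩
  rintro _ ⟨a, ha, rfl⟩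
  rw [← hx.2 a ha]
  exact corootR_linPart w a.1 x

open Classical in
/-- The incidence number `[f : f']`. It is zero unless `f'` is a face of `f`. In that case it is the
sign with which the orientation of `f'`, preceded by a vector pointing from `f` to `f'`, gives the
orientation of `f`. For products of simplices this is the usual boundary map: the face of
`[x_0, …, x_d]` opposite to `x_i` has the sign `(-1)^i`, with the Leibniz rule for products. -/
def incidence {P : RootDatum ι X Y} {b : P.Base} (o : Orientations b) {n : ℕ}
    (f : Facet b (n + 1)) (f' : Facet b n) : ℤ :=
  if h : f.J ⊆ f'.J then
    SignType.sign ((o (n + 1) f).det (Fin.cons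
      (⟨f'.nonempty.some - f.nonempty.some,
        sub_mem_faceDir h f.nonempty.some_mem f'.nonempty.some_mem⟩ : faceDir P f.J)
      fun k => Submodule.inclusion (faceDir_anti h) (o n f' k)))
  else 0

open Classical in
/-- The sign with which `w` maps the orientation of `f` to the orientation of `f' = w f`
(zero if `f'` is not `w f`). -/
def orientSign {P : RootDatum ι X Y} {b : P.Base} (o : Orientations b) (w : ExtWeyl P) {n : ℕ}
    (f f' : Facet b n) : ℤ :=
  if h : affAct w '' f.J = f'.J then
    SignType.sign ((o n f').det fun k =>
      (⟨linPart w (o n f k), h ▸ linPart_mem_faceDir w (o n f k).2⟩ : faceDir P f'.J))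
  else 0

lemma simpleAff_finite [Finite ι] {P : RootDatum ι X Y} (b : P.Base) : (simpleAff b).Finite := by
  refine ((Set.finite_univ (α := ι)).prod (Set.finite_Icc (0 : ℤ) 1)).subset ?_
  rintro ⟨i, k⟩ (⟨-, h⟩ | ⟨h, -⟩) <;> simp_all

instance [Finite ι] {P : RootDatum ι X Y} (b : P.Base) (n : ℕ) : Finite (Facet b n) := by
  have : Finite (Set.powerset (simpleAff b)) := (simpleAff_finite b).finite_subsets
  refine Finite.of_injective (fun f : Facet b n => (⟨f.J, f.subset⟩ : Set.powerset (simpleAff b)))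
    ?_
  rintro ⟨J, _⟩ ⟨J', _⟩ h
  have h' : J = J' := congrArg Subtype.val h
  subst h'
  rfl

end Facets

/-! ### The affine Hecke algebra -/

section Hecke

variable {ι X Y : Type*} [AddCommGroup X] [AddCommGroup Y]

/-- The defining relations of the affine Hecke algebra between the generators `T_w`, `w ∈ W`. -/
inductive HeckeRel {P : RootDatum ι X Y} (b : P.Base) (q : ExtWeyl P → ℝ) :
    FreeAlgebra ℂ (ExtWeyl P) → FreeAlgebra ℂ (ExtWeyl P) → Prop
  | one : HeckeRel b q (FreeAlgebra.ι ℂ 1) 1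
  | mul (w v : ExtWeyl P) (h : length b (w * v) = length b w + length b v) :
      HeckeRel b q (FreeAlgebra.ι ℂ w * FreeAlgebra.ι ℂ v) (FreeAlgebra.ι ℂ (w * v))
  | sq (a : ι × ℤ) (h : a ∈ simpleAff b) :
      HeckeRel b q (FreeAlgebra.ι ℂ (affRefl P a) * FreeAlgebra.ι ℂ (affRefl P a))
        (((q (affRefl P a) : ℂ) - 1) • FreeAlgebra.ι ℂ (affRefl P a) +
          (q (affRefl P a) : ℂ) • FreeAlgebra.ι ℂ 1)

/-- The affine Hecke algebra `H(R, q)`: the complex unital algebra generated by the `T_w`, `w ∈ W`,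
with `T_e = 1` and the relations `T_w T_v = T_{wv}` if `ℓ(wv) = ℓ(w) + ℓ(v)`, and
`T_s T_s = (q(s) - 1) T_s + q(s) T_e` for `s ∈ S^aff`. -/
def Hecke {P : RootDatum ι X Y} (b : P.Base) (q : ExtWeyl P → ℝ) : Type _ :=
  RingQuot (HeckeRel b q)

instance {P : RootDatum ι X Y} (b : P.Base) (q : ExtWeyl P → ℝ) : Ring (Hecke b q) :=
  inferInstanceAs (Ring (RingQuot (HeckeRel b q)))

instance {P : RootDatum ι X Y} (b : P.Base) (q : ExtWeyl P → ℝ) : Algebra ℂ (Hecke b q) :=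
  inferInstanceAs (Algebra ℂ (RingQuot (HeckeRel b q)))

/-- The element `T_w` of the affine Hecke algebra. -/
def T {P : RootDatum ι X Y} (b : P.Base) (q : ExtWeyl P → ℝ) (w : ExtWeyl P) : Hecke b q :=
  RingQuot.mkAlgHom ℂ (HeckeRel b q) (FreeAlgebra.ι ℂ w)

/-- The enveloping algebra `H ⊗ H^op`. A left module over it is an `H`-bimodule, with
`h ⊗ h'` acting as `m ↦ h m h'`. -/
abbrev Env {P : RootDatum ι X Y} (b : P.Base) (q : ExtWeyl P → ℝ) : Type _ :=
  Hecke b q ⊗[ℂ] (Hecke b q)ᵐᵒᵖ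

/-- `H` as a bimodule over itself. -/
instance {P : RootDatum ι X Y} (b : P.Base) (q : ExtWeyl P → ℝ) :
    Module (Env b q) (Hecke b q) :=
  TensorProduct.Algebra.module

/-- The subalgebra `H(W_J, q) ⊗ ℂ[Z(W)]` of `H`. -/
def subJ {P : RootDatum ι X Y} (b : P.Base) (q : ExtWeyl P → ℝ) (J : Set (ι × ℤ)) :
    Subalgebra ℂ (Hecke b q) :=
  Algebra.adjoin ℂ (T b q '' stabJ P J) ⊔
    Algebra.adjoin ℂ (T b q '' Subgroup.center (ExtWeyl P))

/-- The left ideal of `H ⊗ H^op` generated by the `c ⊗ 1 - 1 ⊗ c` with `c ∈ H(W_J, q) ⊗ ℂ[Z(W)]`. -/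
def balanced {P : RootDatum ι X Y} (b : P.Base) (q : ExtWeyl P → ℝ) (J : Set (ι × ℤ)) :
    Submodule (Env b q) (Env b q) :=
  Submodule.span (Env b q)
    {x | ∃ c ∈ subJ b q J, x = c ⊗ₜ[ℂ] (1 : (Hecke b q)ᵐᵒᵖ) - (1 : Hecke b q) ⊗ₜ[ℂ] op c}

/-- The bimodule `H ⊗_{H(W_J, q) ⊗ ℂ[Z(W)]} H`: the quotient of `H ⊗ H` (where `h ⊗ h'` is written
`h ⊗ op h'`) by the subspace spanned by all `h c ⊗ h' - h ⊗ c h'`. -/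
def BalTensor {P : RootDatum ι X Y} (b : P.Base) (q : ExtWeyl P → ℝ) (J : Set (ι × ℤ)) :
    Type _ :=
  Env b q ⧸ balanced b q J

instance {P : RootDatum ι X Y} (b : P.Base) (q : ExtWeyl P → ℝ) (J : Set (ι × ℤ)) :
    AddCommGroup (BalTensor b q J) :=
  inferInstanceAs (AddCommGroup (Env b q ⧸ balanced b q J))

instance {P : RootDatum ι X Y} (b : P.Base) (q : ExtWeyl P → ℝ) (J : Set (ι × ℤ)) :
    Module (Env b q) (BalTensor b q J) :=
  inferInstanceAs (Module (Env b q) (Env b q ⧸ balanced b q J))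

/-- `P_n(H)`, the (finite) direct sum over the `n`-dimensional facets `f` of the fundamental alcove
of the bimodules `H ⊗_{H(W_f, q) ⊗ ℂ[Z(W)]} H`. -/
abbrev PMod {P : RootDatum ι X Y} (b : P.Base) (q : ExtWeyl P → ℝ) (n : ℕ) : Type _ :=
  ∀ f : Facet b n, BalTensor b q f.J

lemma T_one {P : RootDatum ι X Y} (b : P.Base) (q : ExtWeyl P → ℝ) : T b q 1 = 1 := by
  rw [T, RingQuot.mkAlgHom_rel ℂ (HeckeRel.one (b := b) (q := q)), map_one]
  rfl

lemma T_mul {P : RootDatum ι X Y} (b : P.Base) (q : ExtWeyl P → ℝ) {w v : ExtWeyl P}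
    (h : length b (w * v) = length b w + length b v) : T b q w * T b q v = T b q (w * v) := by
  have := RingQuot.mkAlgHom_rel ℂ (HeckeRel.mul (q := q) w v h)
  rw [map_mul] at this
  exact this

lemma T_mul_T_inv [Finite ι] {P : RootDatum ι X Y} (b : P.Base) (q : ExtWeyl P → ℝ)
    {w : ExtWeyl P} (hw : w ∈ Omega b) : T b q w * T b q w⁻¹ = 1 := by
  rw [T_mul, mul_inv_cancel, T_one]
  rw [length_Omega_mul hw, length_Omega hw, zero_add]

lemma T_inv_mul_T [Finite ι] {P : RootDatum ι X Y} (b : P.Base) (q : ExtWeyl P → ℝ)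
    {w : ExtWeyl P} (hw : w ∈ Omega b) : T b q w⁻¹ * T b q w = 1 := by
  simpa using T_mul_T_inv b q (inv_mem_Omega hw)

lemma T_conj [Finite ι] {P : RootDatum ι X Y} (b : P.Base) (q : ExtWeyl P → ℝ)
    {w : ExtWeyl P} (hw : w ∈ Omega b) (v : ExtWeyl P) :
    T b q w * T b q v * T b q w⁻¹ = T b q (w * v * w⁻¹) := by
  rw [T_mul b q (w := w) (v := v), T_mul]
  · rw [length_mul_Omega (inv_mem_Omega hw), length_Omega (inv_mem_Omega hw), add_zero]
  · rw [length_Omega_mul hw, length_Omega hw, zero_add]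

lemma conj_mem_stabJ {P : RootDatum ι X Y} (w : ExtWeyl P) {J : Set (ι × ℤ)} {v : ExtWeyl P}
    (hv : v ∈ stabJ P J) : w * v * w⁻¹ ∈ stabJ P (affAct w '' J) := by
  suffices h : stabJ P J ≤ (stabJ P (affAct w '' J)).comap (MulAut.conj w).toMonoidHom from h hv
  rw [stabJ, Subgroup.closure_le]
  rintro _ ⟨a, ha, rfl⟩
  refine Subgroup.subset_closure ⟨affAct w a, ⟨a, ha, rfl⟩, ?_⟩
  exact (conj_affRefl w a).symm

lemma conj_mem_subJ [Finite ι] {P : RootDatum ι X Y} (b : P.Base) (q : ExtWeyl P → ℝ)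
    {w : ExtWeyl P} (hw : w ∈ Omega b) {J : Set (ι × ℤ)} {c : Hecke b q} (hc : c ∈ subJ b q J) :
    T b q w * c * T b q w⁻¹ ∈ subJ b q (affAct w '' J) := by
  rw [subJ, ← Algebra.adjoin_union] at hc
  induction hc using Algebra.adjoin_induction with
  | mem x hx =>
    rcases hx with ⟨v, hv, rfl⟩ | ⟨v, hv, rfl⟩
    · rw [T_conj b q hw]
      exact (le_sup_left : _ ≤ subJ b q (affAct w '' J))
        (Algebra.subset_adjoin ⟨_, conj_mem_stabJ w hv, rfl⟩)
    · rw [T_conj b q hw]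
      refine (le_sup_right : _ ≤ subJ b q (affAct w '' J)) (Algebra.subset_adjoin ⟨_, ?_, rfl⟩)
      exact Subgroup.Normal.conj_mem inferInstance v hv w
  | algebraMap r =>
    rw [← Algebra.commutes, mul_assoc, T_mul_T_inv b q hw, mul_one]
    exact Subalgebra.algebraMap_mem _ r
  | add x y _ _ hx hy =>
    rw [mul_add, add_mul]
    exact add_mem hx hy
  | mul x y _ _ hx hy =>
    have h : T b q w * (x * y) * T b q w⁻¹ =
        (T b q w * x * T b q w⁻¹) * (T b q w * y * T b q w⁻¹) := by
      calc _ = T b q w * x * 1 * y * T b q w⁻¹ := by noncomm_ring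
        _ = _ := by rw [← T_inv_mul_T b q hw]; noncomm_ring
    rw [h]
    exact mul_mem hx hy

lemma balanced_mono {P : RootDatum ι X Y} (b : P.Base) (q : ExtWeyl P → ℝ) {J J' : Set (ι × ℤ)}
    (h : J ⊆ J') : balanced b q J ≤ balanced b q J' := by
  refine Submodule.span_mono ?_
  rintro x ⟨c, hc, rfl⟩
  refine ⟨c, ?_, rfl⟩
  have h1 : stabJ P J ≤ stabJ P J' := Subgroup.closure_mono (Set.image_mono h)
  exact (sup_le_sup_right (Algebra.adjoin_mono (Set.image_mono h1)) _ :
    subJ b q J ≤ subJ b q J') hc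

lemma balanced_le_comap [Finite ι] {P : RootDatum ι X Y} (b : P.Base) (q : ExtWeyl P → ℝ)
    {w : ExtWeyl P} (hw : w ∈ Omega b) {J J' : Set (ι × ℤ)} (h : affAct w '' J = J') :
    balanced b q J ≤ (balanced b q J').comap
      (LinearMap.toSpanSingleton (Env b q) (Env b q) (T b q w⁻¹ ⊗ₜ[ℂ] op (T b q w))) := by
  subst h
  rw [balanced, Submodule.span_le]
  rintro _ ⟨c, hc, rfl⟩
  have hc' := conj_mem_subJ b q hw hc
  have key : (c ⊗ₜ[ℂ] (1 : (Hecke b q)ᵐᵒᵖ) - (1 : Hecke b q) ⊗ₜ[ℂ] op c) *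
      (T b q w⁻¹ ⊗ₜ[ℂ] op (T b q w)) =
      (T b q w⁻¹ ⊗ₜ[ℂ] op (T b q w)) *
        ((T b q w * c * T b q w⁻¹) ⊗ₜ[ℂ] (1 : (Hecke b q)ᵐᵒᵖ) -
          (1 : Hecke b q) ⊗ₜ[ℂ] op (T b q w * c * T b q w⁻¹)) := by
    have h1 : T b q w⁻¹ * (T b q w * c * T b q w⁻¹) = c * T b q w⁻¹ := by
      rw [← mul_assoc, ← mul_assoc, T_inv_mul_T b q hw, one_mul]
    have h2 : T b q w * c * T b q w⁻¹ * T b q w = T b q w * c := by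
      rw [mul_assoc, T_inv_mul_T b q hw, mul_one]
    simp only [sub_mul, mul_sub, Algebra.TensorProduct.tmul_mul_tmul, one_mul, mul_one, ← op_mul,
      h1, h2]
  change (c ⊗ₜ[ℂ] (1 : (Hecke b q)ᵐᵒᵖ) - (1 : Hecke b q) ⊗ₜ[ℂ] op c) *
    (T b q w⁻¹ ⊗ₜ[ℂ] op (T b q w)) ∈ balanced b q _
  rw [key]
  exact Submodule.smul_mem _ _ (Submodule.subset_span ⟨_, hc', rfl⟩)

/-- For `J ⊆ J'`, the map `h ⊗ h' ↦ h ⊗ h'` from the tensor product over `H(W_J, q) ⊗ ℂ[Z(W)]` to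
the one over `H(W_J', q) ⊗ ℂ[Z(W)]`. -/
def BalTensor.factor {P : RootDatum ι X Y} (b : P.Base) (q : ExtWeyl P → ℝ) {J J' : Set (ι × ℤ)}
    (h : J ⊆ J') : BalTensor b q J →ₗ[Env b q] BalTensor b q J' :=
  Submodule.factor (balanced_mono b q h)

/-- For `ω ∈ Ω` and `J' = ω J`, the map `h ⊗ h' ↦ h T_ω⁻¹ ⊗ T_ω h'` from the tensor product over
`H(W_J, q) ⊗ ℂ[Z(W)]` to the one over `H(W_J', q) ⊗ ℂ[Z(W)]`; here `T_ω⁻¹ = T_{ω⁻¹}`. -/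
def BalTensor.twist [Finite ι] {P : RootDatum ι X Y} (b : P.Base) (q : ExtWeyl P → ℝ)
    {w : ExtWeyl P} (hw : w ∈ Omega b) {J J' : Set (ι × ℤ)} (h : affAct w '' J = J') :
    BalTensor b q J →ₗ[Env b q] BalTensor b q J' :=
  Submodule.mapQ (balanced b q J) (balanced b q J') _ (balanced_le_comap b q hw h)

open Classical in
/-- The differential `d_{n+1} : P_{n+1}(H) → P_n(H)`, which sends `h ⊗ h' ⊗ f` to the sum over
`f'` of `[f : f'] h ⊗ h' ⊗ f'`. -/
def diff [Finite ι] {P : RootDatum ι X Y} {b : P.Base} (q : ExtWeyl P → ℝ) (o : Orientations b)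
    (n : ℕ) : PMod b q (n + 1) →ₗ[Env b q] PMod b q n :=
  letI := Fintype.ofFinite (Facet b (n + 1))
  LinearMap.pi fun f' => ∑ f : Facet b (n + 1),
    if h : f.J ⊆ f'.J then
      incidence o f f' • (BalTensor.factor b q h ∘ₗ LinearMap.proj f)
    else 0

/-- The multiplication map `H ⊗_{H(W_J, q) ⊗ ℂ[Z(W)]} H → H`, `h ⊗ h' ↦ h h'`. -/
def mulMap {P : RootDatum ι X Y} (b : P.Base) (q : ExtWeyl P → ℝ) (J : Set (ι × ℤ)) :
    BalTensor b q J →ₗ[Env b q] Hecke b q :=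
  (balanced b q J).liftQ (LinearMap.toSpanSingleton (Env b q) (Hecke b q) 1) <| by
    rw [balanced, Submodule.span_le]
    rintro _ ⟨c, _, rfl⟩
    simp [sub_smul, TensorProduct.Algebra.smul_def]

/-- The augmentation `d_0 : P_0(H) → H`, which sends `h ⊗ h' ⊗ x` to `h h'`. -/
def augmentation [Finite ι] {P : RootDatum ι X Y} (b : P.Base) (q : ExtWeyl P → ℝ) :
    PMod b q 0 →ₗ[Env b q] Hecke b q :=
  letI := Fintype.ofFinite (Facet b 0)
  ∑ f : Facet b 0, mulMap b q f.J ∘ₗ LinearMap.proj f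

open Classical in
/-- The action of `ω ∈ Ω` on `P_n(H)`, which sends `h ⊗ h' ⊗ f` to
`h T_ω⁻¹ ⊗ T_ω h' ⊗ ω(f)`, where `ω(f)` is oriented by transport. -/
def omegaAct [Finite ι] {P : RootDatum ι X Y} {b : P.Base} (q : ExtWeyl P → ℝ)
    (o : Orientations b) (w : Omega b) (n : ℕ) : PMod b q n →ₗ[Env b q] PMod b q n :=
  letI := Fintype.ofFinite (Facet b n)
  LinearMap.pi fun f' => ∑ f : Facet b n,
    if h : affAct w.1 '' f.J = f'.J then
      orientSign o w.1 f f' • (BalTensor.twist b q w.2 h ∘ₗ LinearMap.proj f)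
    else 0

/-- The sub-bimodule `P_n(H)^Ω` of `Ω`-invariants. -/
def PInv [Finite ι] {P : RootDatum ι X Y} {b : P.Base} (q : ExtWeyl P → ℝ) (o : Orientations b)
    (n : ℕ) : Submodule (Env b q) (PMod b q n) :=
  ⨅ w : Omega b, LinearMap.eqLocus (omegaAct q o w n) LinearMap.id

/-- The bimodule `M` is projective as a left `H`-module. -/
def ProjectiveLeft {P : RootDatum ι X Y} (b : P.Base) (q : ExtWeyl P → ℝ)
    (M : Type*) [AddCommGroup M] [Module (Env b q) M] : Prop :=
  letI : Module (Hecke b q) M := Module.compHom M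
    (Algebra.TensorProduct.includeLeft : Hecke b q →ₐ[ℂ] Env b q).toRingHom
  Module.Projective (Hecke b q) M

/-- The bimodule `M` is projective as a right `H`-module, that is as an `H^op`-module. -/
def ProjectiveRight {P : RootDatum ι X Y} (b : P.Base) (q : ExtWeyl P → ℝ)
    (M : Type*) [AddCommGroup M] [Module (Env b q) M] : Prop :=
  letI : Module (Hecke b q)ᵐᵒᵖ M := Module.compHom M
    (Algebra.TensorProduct.includeRight : (Hecke b q)ᵐᵒᵖ →ₐ[ℂ] Env b q).toRingHom
  Module.Projective (Hecke b q)ᵐᵒᵖ M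

end Hecke

end
end AffineHecke

/-! Over a facet f = A_J the bimodule H ⊗ H, balanced over H(W_J, q) ⊗ ℂ[Z(W)], is free as a left
H-module. A basis is given by the elements `epsL`, one for every coset w W_J Z(W). In the
corresponding coordinates `coordL` the maps between facets merely send a coset to the larger coset
containing it (`coordL_factor`). So, before invariants are taken, the complex does not see q. It is
the cellular chain complex, with coefficients in H, of copies of the closed alcove, one for every
element of W/Z(W), glued along their walls: a union of copies of the tessellated space E, indexed by
Ω/Z(W).

Contractibility of each copy becomes an algebraic statement by filtering with the minimal length of
a coset. At the top level ℓ(w) of a chain, only the facets A_J with J disjoint from the right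
descents of w matter, and there the boundary is the cellular one (`coord_diff_apply`). This is the
complex of the alcove relative to the walls that are descents of w. The alcove is a product of
simplices, one for every maximal coroot, and no factor has only descents as walls, because the
affine roots of a component satisfy a relation with positive coefficients and sum 1
(`sum_weight_mul_affEval`, `exists_notMem_descents`). The homotopies `toggle` therefore contract the
relative complex in positive degrees (`exists_cellDiff_eq`), and induction on the level gives
`exists_diff_eq`.

In degree zero a chain at w can be moved to a vertex lying on all descent walls of w. There w and w
s_a define the same coset, so the length drops until an element of Ω is reached, and the action of Ω
carries everything to a single copy of H, on which the augmentation is the identity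
(`exists_average_chainAt`).

The group Ω/Z(W) is finite because it acts faithfully on the simple affine roots, and Z(W) acts
trivially on the complex. Averaging over it commutes with the differentials, so exactness passes to
the invariants, which are direct summands. Freeness on the left and on the right then gives
one-sided projectivity.

If the datum is semisimple, Z(W) is trivial, and H(W_J, q) is a finite-dimensional separable
algebra. Its Casimir element Σ q(w)⁻¹ T_w ⊗ T_{w⁻¹} commutes with the algebra, and its image under
multiplication is invertible because q > 0 makes the form with orthogonal basis T_w positive
definite. Dividing by this image yields a separability idempotent, that is, a bimodule section of H
⊗ H onto the balanced tensor product (`projective_balTensor`).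

Two foundations are needed: positivity of affine roots is positivity on the open alcove
(`affEval_pos_iff`), which makes the length arguments geometric, and the T_w form a basis of H
(`linearIndependent_T`, `span_T`). -/

namespace AffineHecke

noncomputable section

set_option linter.unusedSectionVars false

/-! ### Coroot cones, the space E and the Cartan matrix -/

section Geometry

variable {ι X Y : Type*} [AddCommGroup X] [AddCommGroup Y] {P : RootDatum ι X Y}

/-- The real linear functional on `X ⊗ ℝ` given by an element of `Y`. -/
def coweight (P : RootDatum ι X Y) : Y →+ (ℝ ⊗[ℤ] X →ₗ[ℝ] ℝ) where
  toFun y := Module.Dual.baseChange ℝ (P.toLinearMap.flip y)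
  map_zero' := by ext; simp
  map_add' y z := by ext; simp

lemma coweight_coroot (i : ι) : coweight P (P.coroot i) = corootR P i := rfl

@[simp] lemma coweight_tmul (y : Y) (r : ℝ) (x : X) :
    coweight P y (r ⊗ₜ x) = r * (P.toLinearMap x y : ℤ) := by
  simp [coweight, mul_comm]

/-- The cone of nonnegative integral combinations of simple coroots. -/
abbrev corootCone (b : P.Base) : AddSubmonoid Y := AddSubmonoid.closure (P.coroot '' b.support)

lemma exists_eq_sum_of_mem_corootCone {b : P.Base} {y : Y} (hy : y ∈ corootCone b) :
    ∃ m : ι → ℕ, y = ∑ j ∈ b.support, m j • P.coroot j := by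
  classical
  induction hy using AddSubmonoid.closure_induction with
  | mem x hx =>
    obtain ⟨j, hj, rfl⟩ := hx
    refine ⟨Pi.single j 1, ?_⟩
    rw [Finset.sum_eq_single_of_mem j hj (by simp +contextual)]
    simp
  | zero => exact ⟨0, by simp⟩
  | add x y _ _ hx hy =>
    obtain ⟨f, rfl⟩ := hx
    obtain ⟨g, rfl⟩ := hy
    exact ⟨f + g, by simp [add_smul, Finset.sum_add_distrib]⟩

lemma coweight_sum (s : Finset ι) (m : ι → ℕ) (x : ℝ ⊗[ℤ] X) :
    coweight P (∑ j ∈ s, m j • P.coroot j) x = ∑ j ∈ s, m j * corootR P j x := by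
  simp [map_sum, coweight_coroot, LinearMap.sum_apply]

lemma sum_coroot_injective {b : P.Base} {m n : ι → ℤ}
    (h : ∑ j ∈ b.support, m j • P.coroot j = ∑ j ∈ b.support, n j • P.coroot j) {j : ι}
    (hj : j ∈ b.support) : m j = n j :=
  linearIndepOn_finset_iffₛ.mp b.linearIndepOn_coroot m n h j hj

lemma sum_coroot_injective_nat {b : P.Base} {m n : ι → ℕ}
    (h : ∑ j ∈ b.support, m j • P.coroot j = ∑ j ∈ b.support, n j • P.coroot j) {j : ι}
    (hj : j ∈ b.support) : m j = n j := by
  have := sum_coroot_injective (b := b) (m := fun j => (m j : ℤ)) (n := fun j => (n j : ℤ))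
    (by simpa using h) hj
  exact_mod_cast this

lemma coroot_neg (P : RootDatum ι X Y) (i : ι) :
    P.coroot (P.reflectionPerm i i) = -P.coroot i := by
  rw [P.coroot_reflectionPerm, P.coreflection_apply_self]

lemma neg_neg_index (P : RootDatum ι X Y) (i : ι) :
    P.reflectionPerm (P.reflectionPerm i i) (P.reflectionPerm i i) = i :=
  P.coroot.injective (by rw [coroot_neg, coroot_neg, neg_neg])

lemma coroot_ne_zero (i : ι) : P.coroot i ≠ 0 := P.flip.ne_zero i

section Finite

variable [Finite ι]

/-- The Cartan matrix of a base is nonsingular. -/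
lemma cartan_det_ne_zero (b : P.Base) [DecidableEq ι] :
    (Matrix.of fun i j : b.support => P.pairing i j).det ≠ 0 := by
  have := Fintype.ofFinite ι
  intro h
  obtain ⟨c, hc, h0⟩ := Matrix.exists_vecMul_eq_zero_iff.mpr h
  apply hc
  -- A left null vector of the Cartan matrix gives a combination of simple roots orthogonal to all
  -- coroots. Definiteness of the root form on the root span makes it zero, against linear
  -- independence of the base.
  set x : X := ∑ i : b.support, c i • P.root i with hx
  have hx1 (j : b.support) : P.toLinearMap x (P.coroot j) = 0 := by
    have := congrFun h0 j
    simp only [Matrix.vecMul, dotProduct, Matrix.of_apply, Pi.zero_apply] at this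
    simpa [hx, map_sum, LinearMap.sum_apply] using this
  have hx2 (k : ι) : P.toLinearMap x (P.coroot k) = 0 := by
    have hk := b.coroot_mem_span_int k
    generalize P.coroot k = y at hk
    induction hk using Submodule.span_induction with
    | mem y hy => obtain ⟨j, hj, rfl⟩ := hy; exact hx1 ⟨j, hj⟩
    | zero => simp
    | add y z _ _ hy hz => simp [hy, hz]
    | smul a y _ hy => simp [hy]
  have hx3 : x ∈ P.rootSpan ℤ := sum_mem fun i _ =>
    Submodule.smul_mem _ _ (Submodule.subset_span ⟨i, rfl⟩)
  have hx4 : x = 0 := by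
    apply P.eq_zero_of_mem_rootSpan_of_rootForm_self_eq_zero hx3
    rw [P.rootForm_apply_apply]
    simp [RootPairing.coroot', hx2]
  have := Fintype.linearIndependent_iff.mp b.linearIndepOn_root c (by simpa [hx] using hx4)
  exact funext this

lemma euclid_eq_span_support (b : P.Base) :
    euclid P = Submodule.span ℝ (Set.range fun i : b.support => (1 : ℝ) ⊗ₜ[ℤ] P.root i) := by
  apply le_antisymm
  · rw [euclid, Submodule.span_le]
    rintro _ ⟨k, rfl⟩
    have hk := b.root_mem_span_int k
    simp only [SetLike.mem_coe]
    generalize P.root k = y at hk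
    induction hk using Submodule.span_induction with
    | mem y hy => obtain ⟨j, hj, rfl⟩ := hy; exact Submodule.subset_span ⟨⟨j, hj⟩, rfl⟩
    | zero => simp
    | add y z _ _ hy hz => simpa [TensorProduct.tmul_add] using add_mem hy hz
    | smul a y _ hy =>
      rw [TensorProduct.tmul_smul]
      exact zsmul_mem hy a
  · exact Submodule.span_mono (by rintro _ ⟨k, rfl⟩; exact ⟨k, rfl⟩)

/-- A point of `E` with prescribed values of the simple coroots. -/
lemma exists_mem_euclid (b : P.Base) (y : ι → ℝ) :
    ∃ x ∈ euclid P, ∀ i ∈ b.support, corootR P i x = y i := by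
  classical
  set C := (Matrix.of fun i j : b.support => P.pairing i j) with hC
  have hdet : IsUnit (C.map (Int.cast : ℤ → ℝ)).det := by
    rw [isUnit_iff_ne_zero, show (C.map (Int.cast : ℤ → ℝ)) = (Int.castRingHom ℝ).mapMatrix C from
      rfl, ← RingHom.map_det]
    simpa using cartan_det_ne_zero b
  set c : b.support → ℝ := Matrix.vecMul (fun j : b.support => y j) (C.map (Int.cast : ℤ → ℝ))⁻¹ with hc
  have h1 : Matrix.vecMul c (C.map (Int.cast : ℤ → ℝ)) = fun j : b.support => y j := by
    rw [hc, Matrix.vecMul_vecMul, Matrix.nonsing_inv_mul _ hdet, Matrix.vecMul_one]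
  refine ⟨∑ i : b.support, c i • ((1 : ℝ) ⊗ₜ[ℤ] P.root i), ?_, fun j hj => ?_⟩
  · exact sum_mem fun i _ => Submodule.smul_mem _ _ (Submodule.subset_span (Set.mem_range_self (i : ι)))
  · have := congrFun h1 ⟨j, hj⟩
    simpa [Matrix.vecMul, dotProduct, map_sum, hC] using this

lemma eq_zero_of_mem_euclid (b : P.Base) {x : ℝ ⊗[ℤ] X} (hx : x ∈ euclid P)
    (h : ∀ i ∈ b.support, corootR P i x = 0) : x = 0 := by
  classical
  rw [euclid_eq_span_support b, Submodule.mem_span_range_iff_exists_fun] at hx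
  obtain ⟨c, rfl⟩ := hx
  have hc : c = 0 := by
    by_contra hc
    refine cartan_det_ne_zero b ?_
    have : ((Int.castRingHom ℝ).mapMatrix (Matrix.of fun i j : b.support =>
        P.pairing i j)).det = 0 := by
      rw [← Matrix.exists_vecMul_eq_zero_iff]
      refine ⟨c, hc, funext fun j => ?_⟩
      simpa [Matrix.vecMul, dotProduct, map_sum] using h j j.2
    rw [← RingHom.map_det] at this
    simpa using this
  simp [hc]

lemma coweight_pos {b : P.Base} {x : ℝ ⊗[ℤ] X} (hx : ∀ i ∈ b.support, 0 < corootR P i x) {y : Y}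
    (hy : y ∈ corootCone b) (h0 : y ≠ 0) : 0 < coweight P y x := by
  obtain ⟨m, rfl⟩ := exists_eq_sum_of_mem_corootCone hy
  rw [coweight_sum]
  refine Finset.sum_pos' (fun i hi => mul_nonneg (by positivity) (hx i hi).le) ?_
  by_contra! hcon
  refine h0 (Finset.sum_eq_zero fun i hi => ?_)
  have : (m i : ℝ) ≤ 0 := by
    have := hcon i hi
    by_contra! h
    exact (mul_pos h (hx i hi)).not_ge this
  have : m i = 0 := by
    have : m i ≤ 0 := by exact_mod_cast this
    omega
  simp [this]

lemma coweight_nonneg {b : P.Base} {x : ℝ ⊗[ℤ] X} (hx : ∀ i ∈ b.support, 0 ≤ corootR P i x)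
    {y : Y} (hy : y ∈ corootCone b) : 0 ≤ coweight P y x := by
  obtain ⟨m, rfl⟩ := exists_eq_sum_of_mem_corootCone hy
  rw [coweight_sum]
  exact Finset.sum_nonneg fun i hi => mul_nonneg (by positivity) (hx i hi)

lemma exists_pos_point (b : P.Base) : ∃ x : ℝ ⊗[ℤ] X, ∀ i ∈ b.support, 0 < corootR P i x := by
  obtain ⟨x, -, hx⟩ := exists_mem_euclid b fun _ => 1
  exact ⟨x, fun i hi => by simp [hx i hi]⟩

/-- The cone is pointed: a nonzero element of it is strictly positive at a point where all simple
coroots are positive. -/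
lemma eq_zero_of_mem_neg_mem {b : P.Base} {y : Y} (hy : y ∈ corootCone b)
    (hy' : -y ∈ corootCone b) : y = 0 := by
  obtain ⟨x, hx⟩ := exists_pos_point b
  by_contra h
  have h1 := coweight_pos hx hy h
  have h2 := coweight_pos hx hy' (neg_ne_zero.mpr h)
  rw [map_neg, LinearMap.neg_apply] at h2
  linarith

/-! ### Positivity, dominance and maximal coroots -/

lemma corootForm_coroot_pos [Fintype ι] (i : ι) :
    0 < P.CorootForm (P.coroot i) (P.coroot i) := by
  rw [P.corootForm_apply_apply]
  refine Finset.sum_pos' (fun j _ => mul_self_nonneg _) ⟨i, Finset.mem_univ _, ?_⟩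
  have : P.root' i (P.coroot i) = 2 := by simp [RootPairing.root']
  rw [this]; norm_num

/-- The invariant form on coroots and the pairing differ by a positive factor. So signs of pairings
can be read off a symmetric definite form. -/
lemma two_mul_corootForm [Fintype ι] (i : ι) (y : Y) :
    2 * P.CorootForm (P.coroot i) y =
      P.CorootForm (P.coroot i) (P.coroot i) * P.toLinearMap (P.root i) y := by
  have h := congrArg (fun x => P.toLinearMap x y) (P.corootForm_self_smul_root i)
  simp only [map_smul, LinearMap.smul_apply, map_nsmul, P.toLinearMap_apply_CoPolarization] at h
  simpa [eq_comm] using h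

lemma isPos_iff_root_mem {b : P.Base} {i : ι} :
    b.IsPos i ↔ P.root i ∈ AddSubmonoid.closure (P.root '' b.support) := by
  have key {x : X} (h : x ∈ AddSubmonoid.closure (P.root '' b.support)) :
      ∃ n : ι → ℕ, x = ∑ j ∈ b.support, n j • P.root j :=
    exists_eq_sum_of_mem_corootCone (P := P.flip) (b := b.flip) h
  refine ⟨fun hi => (b.root_mem_or_neg_mem i).resolve_right fun h => ?_, fun h => ?_⟩
  · obtain ⟨n, hn⟩ := key h
    have := b.height_eq_sum (i := i) (f := fun j => -(n j : ℤ)) (by simp [← hn])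
    rw [b.isPos_iff, this, Finset.sum_neg_distrib] at hi
    have h0 : (0 : ℤ) ≤ ∑ j ∈ b.support, (n j : ℤ) := by positivity
    linarith
  · obtain ⟨n, hn⟩ := key h
    rw [b.isPos_iff', b.height_eq_sum (i := i) (f := fun j => (n j : ℤ)) (by simp [← hn])]
    positivity

/-- Positivity of roots and of coroots agree. -/
lemma isPos_iff_coroot_mem {b : P.Base} {i : ι} : b.IsPos i ↔ P.coroot i ∈ corootCone b := by
  have := Fintype.ofFinite ι
  have key (i : ι) (h : P.root i ∈ AddSubmonoid.closure (P.root '' b.support)) :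
      P.coroot i ∈ corootCone b := by
    refine (b.coroot_mem_or_neg_mem i).resolve_right fun hneg => ?_
    obtain ⟨m, hm⟩ := exists_eq_sum_of_mem_corootCone hneg
    obtain ⟨n, hn⟩ : ∃ n : ι → ℕ, P.root i = ∑ j ∈ b.support, n j • P.root j :=
      exists_eq_sum_of_mem_corootCone (P := P.flip) (b := b.flip) h
    -- The copolarization turns twice a coroot into its norm times the root. Hence passing between
    -- roots and coroots rescales the coefficients at the base by positive numbers and keeps their
    -- signs.
    set N : ι → ℤ := fun k => P.CorootForm (P.coroot k) (P.coroot k) with hN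
    have hNpos (k : ι) : 0 < N k := corootForm_coroot_pos k
    have h2 (k : ι) : N k • P.root k = 2 • P.CoPolarization (P.coroot k) :=
      P.corootForm_self_smul_root k
    have h3 : ∑ j ∈ b.support, (N i * n j) • P.root j =
        ∑ j ∈ b.support, (-(m j : ℤ) * N j) • P.root j := by
      simp only [mul_smul, h2, ← Finset.smul_sum]
      have h4 : N i • P.root i = 2 • P.CoPolarization (-∑ j ∈ b.support, m j • P.coroot j) := by
        rw [h2, ← hm, neg_neg]
      rw [hn] at h4
      simp only [natCast_zsmul, h4, map_neg, map_sum, map_nsmul, neg_smul, smul_neg,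
        Finset.sum_neg_distrib, Finset.smul_sum, smul_comm 2]
    refine P.ne_zero i ?_
    rw [hn]
    refine Finset.sum_eq_zero fun j hj => ?_
    have h5 := sum_coroot_injective (P := P.flip) (b := b.flip) h3 hj
    have h6 : (n j : ℤ) = 0 := by
      have h7 : (0 : ℤ) ≤ N i * n j := mul_nonneg (hNpos i).le (by positivity)
      have h8 : (0 : ℤ) ≤ m j * N j := mul_nonneg (by positivity) (hNpos j).le
      have : N i * n j = 0 := by linarith
      exact (mul_eq_zero.mp this).resolve_left (hNpos i).ne'
    have : n j = 0 := by exact_mod_cast h6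
    simp [this]
  refine isPos_iff_root_mem.trans ⟨key i, fun h => ?_⟩
  refine (b.root_mem_or_neg_mem i).resolve_right fun hneg => ?_
  have h1 := key (P.reflectionPerm i i) (by simpa using hneg)
  refine coroot_ne_zero (P := P) i (eq_zero_of_mem_neg_mem h ?_)
  simpa using h1

/-- A real form of domination: every coroot is dominated by a maximal one. -/
lemma exists_isMaxCoroot (b : P.Base) (i : ι) :
    ∃ t, IsMaxCoroot b t ∧ P.coroot t - P.coroot i ∈ corootCone b := by
  obtain ⟨x, hx⟩ := exists_pos_point b
  -- Among the finitely many coroots above the given one, take one with the largest value at a point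
  -- where the simple coroots are positive. A coroot strictly above it would have a larger value.
  obtain ⟨t, ht, hmax⟩ := Set.exists_max_image {t | P.coroot t - P.coroot i ∈ corootCone b}
    (fun t => corootR P t x) (Set.toFinite _) ⟨i, by simp⟩
  refine ⟨t, fun j hj => ?_, ht⟩
  have h1 := hmax j (by simpa using add_mem hj ht)
  by_contra hne
  have h2 := coweight_pos hx hj (sub_ne_zero.mpr fun h => hne (P.coroot.injective h))
  rw [map_sub, LinearMap.sub_apply, coweight_coroot, coweight_coroot] at h2
  linarith

/-- If the opposite coroot were in the cone, so would be twice it. The opposite would then dominate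
the maximal coroot, hence be equal to it. -/
lemma IsMaxCoroot.isPos {b : P.Base} {t : ι} (ht : IsMaxCoroot b t) : b.IsPos t := by
  rw [isPos_iff_coroot_mem]
  refine (b.coroot_mem_or_neg_mem t).resolve_right fun h => ?_
  have h1 := ht (P.reflectionPerm t t) (by
    simpa [sub_eq_add_neg] using add_mem h h)
  have h2 := congrArg P.coroot h1
  simp only [P.coroot_reflectionPerm, P.coreflection_apply_self] at h2
  obtain ⟨x, hx⟩ := exists_pos_point b
  have h3 := coweight_pos hx h (neg_ne_zero.mpr (coroot_ne_zero t))
  have h4 := h3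
  rw [h2] at h4
  rw [map_neg, LinearMap.neg_apply] at h3
  linarith

/-- A maximal coroot is dominant. -/
lemma IsMaxCoroot.pairing_nonneg {b : P.Base} {t : ι} (ht : IsMaxCoroot b t) {j : ι}
    (hj : j ∈ b.support) : 0 ≤ P.pairing j t := by
  by_contra! h
  -- If the pairing were negative, the simple reflection would add a positive multiple of a simple
  -- coroot and so produce a larger coroot.
  have h0 : P.coroot (P.reflectionPerm j t) - P.coroot t = (-P.pairing j t) • P.coroot j := by
    rw [P.coroot_reflectionPerm, P.coreflection_apply_coroot]; simp
  have h1 := ht (P.reflectionPerm j t) (by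
    rw [h0]
    obtain ⟨n, hn⟩ := Int.eq_ofNat_of_zero_le (a := -P.pairing j t) (by omega)
    rw [hn, natCast_zsmul]
    exact nsmul_mem (AddSubmonoid.subset_closure (Set.mem_image_of_mem _ hj)) _)
  rw [h1, sub_self] at h0
  have h2 := congrArg (P.toLinearMap (P.root j)) h0
  simp at h2
  omega

lemma corootForm_nonneg_of_isMaxCoroot [Fintype ι] {b : P.Base} {t : ι} (ht : IsMaxCoroot b t)
    {j : ι} (hj : j ∈ b.support) : 0 ≤ P.CorootForm (P.coroot j) (P.coroot t) := by
  have h1 := two_mul_corootForm (P := P) j (P.coroot t)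
  have h2 : 0 ≤ P.CorootForm (P.coroot j) (P.coroot j) * P.pairing j t :=
    mul_nonneg (corootForm_coroot_pos j).le (ht.pairing_nonneg hj)
  have h3 : P.toLinearMap (P.root j) (P.coroot t) = P.pairing j t := rfl
  rw [h3] at h1
  linarith

lemma corootForm_nonpos_of_ne [Fintype ι] {b : P.Base} {i j : ι} (hi : i ∈ b.support)
    (hj : j ∈ b.support) (hij : i ≠ j) : P.CorootForm (P.coroot i) (P.coroot j) ≤ 0 := by
  have h1 := two_mul_corootForm (P := P) i (P.coroot j)
  have h2 : P.pairing i j ≤ 0 := by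
    have := b.pairingIn_le_zero_of_ne hij hi hj
    rwa [← P.algebraMap_pairingIn ℤ, eq_intCast, Int.cast_id]
  have h3 := mul_nonpos_of_nonneg_of_nonpos (corootForm_coroot_pos (P := P) i).le h2
  have h4 : P.toLinearMap (P.root i) (P.coroot j) = P.pairing i j := rfl
  rw [h4] at h1
  linarith

lemma corootForm_symm [Fintype ι] (x y : Y) : P.CorootForm x y = P.CorootForm y x := by
  simp only [P.corootForm_apply_apply, mul_comm]

/-- The form of two distinct maximal coroots is not positive. -/
lemma corootForm_nonpos_of_isMaxCoroot [Fintype ι] {b : P.Base} {t u : ι} (ht : IsMaxCoroot b t)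
    (hu : IsMaxCoroot b u) (htu : t ≠ u) : P.CorootForm (P.coroot t) (P.coroot u) ≤ 0 := by
  by_contra! h
  have h1 := two_mul_corootForm (P := P) t (P.coroot u)
  have h2 : 0 < P.pairing t u := by
    have : P.toLinearMap (P.root t) (P.coroot u) = P.pairing t u := rfl
    rw [this] at h1
    by_contra! h3
    have h4 := mul_nonpos_of_nonneg_of_nonpos (corootForm_coroot_pos (P := P) t).le h3
    linarith
  have h3 : 0 < P.flip.pairingIn ℤ u t := by
    have := P.flip.algebraMap_pairingIn ℤ u t
    rw [eq_intCast, Int.cast_id] at this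
    rw [this]
    exact h2
  -- A positive pairing makes the difference of the two coroots a coroot. It is positive or
  -- negative, so one of the two maximal coroots dominates the other.
  obtain ⟨k, hk⟩ := P.flip.root_sub_root_mem_of_pairingIn_pos h3 htu.symm
  have hk' : P.coroot k = P.coroot u - P.coroot t := hk
  rcases b.coroot_mem_or_neg_mem k with h4 | h4
  · exact htu (ht u (hk' ▸ h4)).symm
  · exact htu (hu t (by rw [hk', neg_sub] at h4; exact h4))

/-- The supports of different maximal coroots are disjoint. -/
lemma IsMaxCoroot.eq_of_support {b : P.Base} {t u : ι} (ht : IsMaxCoroot b t)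
    (hu : IsMaxCoroot b u) {m n : ι → ℕ} (hm : P.coroot t = ∑ j ∈ b.support, m j • P.coroot j)
    (hn : P.coroot u = ∑ j ∈ b.support, n j • P.coroot j) {i : ι} (hi : i ∈ b.support)
    (hmi : m i ≠ 0) (hni : n i ≠ 0) : t = u := by
  classical
  have := Fintype.ofFinite ι
  by_contra htu
  set B := P.CorootForm with hB
  -- The form of the two maximal coroots is at most zero. Expanded in simple coroots it is a sum of
  -- nonnegative terms, since maximal coroots are dominant. So every term vanishes, which is what
  -- drives the next two claims.
  have h0 := corootForm_nonpos_of_isMaxCoroot ht hu htu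
  -- the support of `u` is orthogonal to `t`
  have h1 (j : ι) (hj : j ∈ b.support) (hnj : n j ≠ 0) : B (P.coroot j) (P.coroot t) = 0 := by
    have h2 : B (P.coroot u) (P.coroot t) = ∑ j ∈ b.support, n j * B (P.coroot j) (P.coroot t) := by
      rw [hn]; simp [map_sum, LinearMap.sum_apply]
    have h3 : ∀ j ∈ b.support, 0 ≤ (n j : ℤ) * B (P.coroot j) (P.coroot t) := fun j hj =>
      mul_nonneg (by positivity) (corootForm_nonneg_of_isMaxCoroot ht hj)
    have h4 : ∑ j ∈ b.support, (n j : ℤ) * B (P.coroot j) (P.coroot t) = 0 := by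
      refine le_antisymm ?_ (Finset.sum_nonneg h3)
      rw [← h2, corootForm_symm]; exact h0
    have h5 := (Finset.sum_eq_zero_iff_of_nonneg h3).mp h4 j hj
    exact (mul_eq_zero.mp h5).resolve_left (by exact_mod_cast hnj)
  -- the support of `u` is closed under neighbours
  have h2 (k : ι) (hk : k ∈ b.support) (hnk : n k = 0) (j : ι) (hj : j ∈ b.support)
      (hnj : n j ≠ 0) : B (P.coroot k) (P.coroot j) = 0 := by
    have h3 : B (P.coroot k) (P.coroot u) = ∑ j ∈ b.support, n j * B (P.coroot k) (P.coroot j) := by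
      rw [hn]; simp [map_sum]
    have h4 : ∀ j ∈ b.support, (n j : ℤ) * B (P.coroot k) (P.coroot j) ≤ 0 := fun j hj => by
      by_cases hjk : k = j
      · subst hjk; simp [hnk]
      · exact mul_nonpos_of_nonneg_of_nonpos (by positivity) (corootForm_nonpos_of_ne hk hj hjk)
    have h5 : ∑ j ∈ b.support, (n j : ℤ) * B (P.coroot k) (P.coroot j) = 0 := by
      refine le_antisymm (Finset.sum_nonpos h4) ?_
      rw [← h3]; exact corootForm_nonneg_of_isMaxCoroot hu hk
    have h6 := (Finset.sum_eq_zero_iff_of_nonpos h4).mp h5 j hj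
    exact (mul_eq_zero.mp h6).resolve_left (by exact_mod_cast hnj)
  -- the part of `t` in the support of `u` is isotropic
  set y : Y := ∑ j ∈ b.support with n j ≠ 0, m j • P.coroot j with hy
  have hty : P.coroot t = y + ∑ j ∈ b.support with ¬ n j ≠ 0, m j • P.coroot j := by
    rw [hm, hy, Finset.sum_filter_add_sum_filter_not]
  have h3 : B y y = 0 := by
    have h4 : B y (P.coroot t) = 0 := by
      rw [hy]
      simp only [map_sum, LinearMap.sum_apply, map_nsmul, LinearMap.smul_apply]
      refine Finset.sum_eq_zero fun j hj => ?_
      rw [Finset.mem_filter] at hj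
      rw [h1 j hj.1 hj.2, smul_zero]
    have h5 : B y (∑ j ∈ b.support with ¬ n j ≠ 0, m j • P.coroot j) = 0 := by
      rw [hy]
      simp only [map_sum, LinearMap.sum_apply, map_nsmul, LinearMap.smul_apply]
      refine Finset.sum_eq_zero fun j hj => ?_
      rw [Finset.mem_filter] at hj
      rw [Finset.sum_eq_zero fun k hk => ?_, smul_zero]
      rw [Finset.mem_filter] at hk
      rw [corootForm_symm, h2 j hj.1 (by simpa using hj.2) k hk.1 hk.2, smul_zero]
    rw [hty, map_add, h5, add_zero] at h4
    exact h4
  have h4 : y = 0 := by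
    refine P.flip.eq_zero_of_mem_rootSpan_of_rootForm_self_eq_zero (x := y) ?_ h3
    exact sum_mem fun j _ => Submodule.smul_of_tower_mem _ _ (Submodule.subset_span ⟨j, rfl⟩)
  have h5 := sum_coroot_injective_nat (b := b) (m := fun j => if n j ≠ 0 then m j else 0)
    (n := fun _ => 0) (by simpa [hy, Finset.sum_filter, ite_smul] using h4) hi
  simp [hni, hmi] at h5

/-- The coefficients of a maximal coroot with respect to the simple coroots. -/
def maxCoeff (b : P.Base) (t : ι) : ι → ℕ :=
  open Classical in if h : P.coroot t ∈ corootCone b then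
    (exists_eq_sum_of_mem_corootCone h).choose else 0

lemma IsMaxCoroot.eq_sum {b : P.Base} {t : ι} (ht : IsMaxCoroot b t) :
    P.coroot t = ∑ j ∈ b.support, maxCoeff b t j • P.coroot j := by
  have h : P.coroot t ∈ corootCone b := isPos_iff_coroot_mem.mp ht.isPos
  rw [maxCoeff, dif_pos h]
  exact (exists_eq_sum_of_mem_corootCone h).choose_spec

/-- A maximal coroot that dominates the simple coroot has coefficient at least 1 there. -/
lemma exists_maxCoeff_ne_zero (b : P.Base) {i : ι} (hi : i ∈ b.support) :
    ∃ t, IsMaxCoroot b t ∧ maxCoeff b t i ≠ 0 := by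
  classical
  obtain ⟨t, ht, h⟩ := exists_isMaxCoroot b i
  refine ⟨t, ht, fun h0 => ?_⟩
  obtain ⟨m, hm⟩ := exists_eq_sum_of_mem_corootCone h
  rw [sub_eq_iff_eq_add, ht.eq_sum] at hm
  have h1 : P.coroot i = ∑ j ∈ b.support, (Pi.single i 1 : ι → ℕ) j • P.coroot j := by
    rw [Finset.sum_eq_single_of_mem i hi (by simp +contextual)]
    simp
  rw [h1, ← Finset.sum_add_distrib] at hm
  simp only [← add_smul] at hm
  have h2 := sum_coroot_injective_nat hm hi
  simp [h0] at h2

lemma IsMaxCoroot.eq_of_maxCoeff {b : P.Base} {t u : ι} (ht : IsMaxCoroot b t)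
    (hu : IsMaxCoroot b u) {i : ι} (hi : i ∈ b.support) (h : maxCoeff b t i ≠ 0)
    (h' : maxCoeff b u i ≠ 0) : t = u :=
  ht.eq_of_support hu ht.eq_sum hu.eq_sum hi h h'

/-! ### Components of the simple affine roots: the alcove as a product of simplices -/

open Classical in
/-- The simple affine roots as a finite set. -/
def simpleFinset (b : P.Base) : Finset (ι × ℤ) := (simpleAff_finite b).toFinset

@[simp] lemma mem_simpleFinset {b : P.Base} {a : ι × ℤ} : a ∈ simpleFinset b ↔ a ∈ simpleAff b := by
  simp [simpleFinset]

open Classical in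
/-- The component of a simple affine root, labelled by its maximal coroot. -/
def comp (b : P.Base) (a : ι × ℤ) : ι :=
  if h : a.1 ∈ b.support ∧ a.2 = 0 then (exists_maxCoeff_ne_zero b h.1).choose
  else P.reflectionPerm a.1 a.1

open Classical in
/-- The coefficient of a simple affine root in the relation of its component. -/
def weight (b : P.Base) (a : ι × ℤ) : ℝ :=
  if a.2 = 0 then maxCoeff b (comp b a) a.1 else 1

lemma comp_of_mem_support {b : P.Base} {i : ι} (hi : i ∈ b.support) :
    IsMaxCoroot b (comp b (i, 0)) ∧ maxCoeff b (comp b (i, 0)) i ≠ 0 := by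
  rw [comp, dif_pos ⟨hi, rfl⟩]
  exact (exists_maxCoeff_ne_zero b hi).choose_spec

lemma isMaxCoroot_comp {b : P.Base} {a : ι × ℤ} (ha : a ∈ simpleAff b) :
    IsMaxCoroot b (comp b a) := by
  obtain ⟨i, k⟩ := a
  rcases ha with ⟨h1, rfl : k = 0⟩ | ⟨rfl : k = 1, t, ht, h⟩
  · exact (comp_of_mem_support h1).1
  · have : comp b (i, 1) = t := by
      rw [comp, dif_neg (by simp)]
      apply P.coroot.injective
      rw [coroot_neg, h, neg_neg]
    rwa [this]

lemma weight_pos {b : P.Base} {a : ι × ℤ} (ha : a ∈ simpleAff b) : 0 < weight b a := by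
  obtain ⟨i, k⟩ := a
  rcases ha with ⟨h1, rfl : k = 0⟩ | ⟨rfl : k = 1, t, ht, h⟩
  · rw [weight, if_pos rfl]
    have := (comp_of_mem_support h1).2
    positivity
  · simp [weight]

lemma neg_mem_simpleAff {b : P.Base} {t : ι} (ht : IsMaxCoroot b t) :
    (P.reflectionPerm t t, (1 : ℤ)) ∈ simpleAff b := Or.inr ⟨rfl, t, ht, by simp⟩

lemma comp_neg {t : ι} (b : P.Base) : comp b (P.reflectionPerm t t, (1 : ℤ)) = t := by
  rw [comp, dif_neg (by simp), neg_neg_index]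

lemma zero_mem_simpleAff {b : P.Base} {i : ι} (hi : i ∈ b.support) : (i, (0 : ℤ)) ∈ simpleAff b :=
  Or.inl ⟨hi, rfl⟩

open Classical in
-- The component of θ consists of the roots (i, 0) with i in the support of θ and of the affine root
-- (-θ, 1). The sum on the right may run over the whole base because the coefficients off the
-- support vanish.
lemma sum_comp {b : P.Base} {t : ι} (ht : IsMaxCoroot b t) (f : ι × ℤ → ℝ) :
    ∑ a ∈ simpleFinset b with comp b a = t, weight b a * f a =
      ∑ i ∈ b.support, maxCoeff b t i * f (i, 0) + f (P.reflectionPerm t t, 1) := by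
  have h1 : (simpleFinset b).filter (fun a => comp b a = t) =
      insert (P.reflectionPerm t t, 1)
        ((b.support.filter fun i => maxCoeff b t i ≠ 0).image fun i => (i, 0)) := by
    ext ⟨i, k⟩
    simp only [Finset.mem_filter, mem_simpleFinset, Finset.mem_insert, Prod.mk.injEq,
      Finset.mem_image]
    constructor
    · rintro ⟨h1, h2⟩
      rcases h1 with ⟨h1, rfl : k = 0⟩ | ⟨rfl : k = 1, u, hu, h⟩
      · exact Or.inr ⟨i, ⟨h1, h2 ▸ (comp_of_mem_support h1).2⟩, rfl, rfl⟩
      · left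
        rw [comp, dif_neg (by simp)] at h2
        exact ⟨by rw [← h2, neg_neg_index], rfl⟩
    · rintro (⟨rfl, rfl⟩ | ⟨j, ⟨hj, hj'⟩, rfl, rfl⟩)
      · exact ⟨neg_mem_simpleAff ht, comp_neg b⟩
      · exact ⟨zero_mem_simpleAff hj, (comp_of_mem_support hj).1.eq_of_maxCoeff ht hj
          (comp_of_mem_support hj).2 hj'⟩
  rw [h1, Finset.sum_insert (by simp), Finset.sum_image (by simp), add_comm, Finset.sum_filter]
  congr 1
  · refine Finset.sum_congr rfl fun i hi => ?_
    split_ifs with h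
    · rw [weight, if_pos rfl, (comp_of_mem_support hi).1.eq_of_maxCoeff ht hi
          (comp_of_mem_support hi).2 h]
    · push Not at h
      simp [h]
  · simp [weight]

open Classical in
/-- The relation satisfied by the simple affine roots of a component. -/
lemma sum_weight_mul_affEval {b : P.Base} {t : ι} (ht : IsMaxCoroot b t) (x : ℝ ⊗[ℤ] X) :
    ∑ a ∈ simpleFinset b with comp b a = t, weight b a * affEval P a x = 1 := by
  rw [sum_comp ht]
  have h1 : corootR P (P.reflectionPerm t t) x = - corootR P t x := by
    rw [← coweight_coroot, ← coweight_coroot, P.coroot_reflectionPerm,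
      P.coreflection_apply_self, map_neg, LinearMap.neg_apply]
  have h2 : corootR P t x = ∑ i ∈ b.support, maxCoeff b t i * corootR P i x := by
    rw [← coweight_sum, ← ht.eq_sum, coweight_coroot]
  simp [affEval, h1, h2]

open Classical in
/-- Points of `E` with prescribed values of the simple affine roots. -/
lemma exists_affEval_eq (b : P.Base) (y : ι × ℤ → ℝ)
    (hy : ∀ t, IsMaxCoroot b t → ∑ a ∈ simpleFinset b with comp b a = t, weight b a * y a = 1) :
    ∃ x ∈ euclid P, ∀ a ∈ simpleAff b, affEval P a x = y a := by
  obtain ⟨x, hx, h⟩ := exists_mem_euclid b fun i => y (i, 0)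
  have h0 (i : ι) (hi : i ∈ b.support) : affEval P (i, 0) x = y (i, 0) := by simp [affEval, h i hi]
  refine ⟨x, hx, ?_⟩
  rintro ⟨i, k⟩ (⟨hi, rfl : k = 0⟩ | ⟨rfl : k = 1, t, ht, hit⟩)
  · exact h0 i hi
  · have h1 := sum_weight_mul_affEval ht x
    have h2 := hy t ht
    rw [sum_comp ht] at h1 h2
    have h3 : i = P.reflectionPerm t t := P.coroot.injective (by simp [hit])
    rw [h3]
    have h4 : ∑ i ∈ b.support, (maxCoeff b t i : ℝ) * affEval P (i, 0) x =
        ∑ i ∈ b.support, maxCoeff b t i * y (i, 0) :=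
      Finset.sum_congr rfl fun i hi => by rw [h0 i hi]
    linarith

end Finite

end Geometry

end

end AffineHecke

namespace AffineHecke

noncomputable section

set_option linter.unusedSectionVars false

/-! ### The affine action of W and its effect on affine roots -/

section AffineAction

variable {ι X Y : Type*} [AddCommGroup X] [AddCommGroup Y] {P : RootDatum ι X Y}

/-- The action of `W` on `X ⊗ ℝ` by affine transformations. -/
def affPt (w : ExtWeyl P) (x : ℝ ⊗[ℤ] X) : ℝ ⊗[ℤ] X := (1 : ℝ) ⊗ₜ[ℤ] w.left.toAdd + linPart w x

lemma linPart_mul (w v : ExtWeyl P) (x : ℝ ⊗[ℤ] X) :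
    linPart (w * v) x = linPart w (linPart v x) := by
  induction x using TensorProduct.induction_on with
  | zero => simp
  | add x y hx hy => simp [hx, hy]
  | tmul r x => simp [linPart]

lemma linPart_of_right_eq_one {w : ExtWeyl P} (hw : w.right = 1) (x : ℝ ⊗[ℤ] X) :
    linPart w x = x := by
  simp [linPart, hw, Module.End.one_eq_id]

lemma linPart_one (x : ℝ ⊗[ℤ] X) : linPart (1 : ExtWeyl P) x = x :=
  linPart_of_right_eq_one rfl x

lemma affPt_mul (w v : ExtWeyl P) (x : ℝ ⊗[ℤ] X) : affPt (w * v) x = affPt w (affPt v x) := by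
  simp only [affPt, linPart_mul, map_add, SemidirectProduct.mul_left, latticeAction_apply,
    toAdd_mul, toAdd_ofAdd, TensorProduct.tmul_add, add_assoc]
  congr 1

lemma affPt_one (x : ℝ ⊗[ℤ] X) : affPt (1 : ExtWeyl P) x = x := by
  simp [affPt, linPart_one]

lemma affPt_affPt_inv (w : ExtWeyl P) (x : ℝ ⊗[ℤ] X) : affPt w (affPt w⁻¹ x) = x := by
  rw [← affPt_mul, mul_inv_cancel, affPt_one]

lemma affEval_affAct_affPt (w : ExtWeyl P) (a : ι × ℤ) (x : ℝ ⊗[ℤ] X) :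
    affEval P (affAct w a) (affPt w x) = affEval P a x := by
  simp [affEval, affAct, affPt, corootR_linPart]
  ring

lemma affEval_affAct (w : ExtWeyl P) (a : ι × ℤ) (x : ℝ ⊗[ℤ] X) :
    affEval P (affAct w a) x = affEval P a (affPt w⁻¹ x) := by
  conv_lhs => rw [← affPt_affPt_inv w x]
  exact affEval_affAct_affPt w a _

lemma affEval_negRoot (a : ι × ℤ) (x : ℝ ⊗[ℤ] X) :
    affEval P (negRoot P a) x = - affEval P a x := by
  simp only [affEval, negRoot, ← coweight_coroot, coroot_neg, map_neg, LinearMap.neg_apply]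
  push_cast
  ring

lemma negRoot_negRoot (a : ι × ℤ) : negRoot P (negRoot P a) = a := by
  simp only [negRoot, neg_neg_index, neg_neg]

lemma ofIdx_smul_index (i j : ι) :
    RootPairing.weylGroup.ofIdx P i • j = P.reflectionPerm i j := by
  apply P.root.injective
  rw [P.root_reflectionPerm]
  exact (P.weylGroup_apply_root (RootPairing.weylGroup.ofIdx P i) j).symm

lemma affAct_affRefl_self (a : ι × ℤ) : affAct (affRefl P a) a = negRoot P a := by
  have h : RootPairing.weylGroup.ofIdx P a.1 • a.1 = P.reflectionPerm a.1 a.1 :=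
    ofIdx_smul_index _ _
  ext
  · exact h
  · simp only [affAct, affRefl, h, coroot_neg, toAdd_ofAdd, map_neg, map_smul,
      LinearMap.smul_apply, P.root_coroot_eq_pairing, P.pairing_same, negRoot, smul_eq_mul]
    ring

lemma affRefl_mul_self (a : ι × ℤ) : affRefl P a * affRefl P a = 1 := by
  have h (x : X) : RootPairing.weylGroup.ofIdx P a.1 • x = P.reflection a.1 x := rfl
  refine SemidirectProduct.ext ?_ ?_
  · apply Multiplicative.toAdd.injective
    simp only [SemidirectProduct.mul_left, latticeAction_apply, affRefl, toAdd_mul, toAdd_ofAdd, h,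
      map_smul, P.reflection_apply_self, smul_neg, add_neg_cancel, SemidirectProduct.one_left,
      toAdd_one]
  · apply Subtype.ext
    apply RootPairing.Equiv.weightHom_injective P
    apply LinearEquiv.ext
    intro x
    exact P.reflection_same a.1 x

lemma affRefl_inv (a : ι × ℤ) : (affRefl P a)⁻¹ = affRefl P a :=
  inv_eq_of_mul_eq_one_left (affRefl_mul_self a)

lemma affRefl_mul_cancel_left (a : ι × ℤ) (w : ExtWeyl P) :
    affRefl P a * (affRefl P a * w) = w := by
  rw [← mul_assoc, affRefl_mul_self, one_mul]

lemma affRefl_mul_cancel_right (a : ι × ℤ) (w : ExtWeyl P) :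
    w * affRefl P a * affRefl P a = w := by
  rw [mul_assoc, affRefl_mul_self, mul_one]

lemma affPt_affRefl (a : ι × ℤ) (x : ℝ ⊗[ℤ] X) :
    affPt (affRefl P a) x = x - affEval P a x • ((1 : ℝ) ⊗ₜ[ℤ] P.root a.1) := by
  have h : linPart (affRefl P a) x = x - corootR P a.1 x • ((1 : ℝ) ⊗ₜ[ℤ] P.root a.1) := by
    induction x using TensorProduct.induction_on with
    | zero => simp
    | add x y hx hy => rw [map_add, hx, hy, map_add]; module
    | tmul r x =>
      have h (x : X) : (P.weylGroupRootRep (affRefl P a).right) x =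
        x - P.toLinearMap x (P.coroot a.1) • P.root a.1 := rfl
      simp only [linPart, LinearMap.baseChange_tmul, h, corootR_tmul, TensorProduct.tmul_sub,
        TensorProduct.smul_tmul']
      congr 1
      rw [← TensorProduct.smul_tmul]
      congr 1
      simp [mul_comm]
  rw [affPt, h, affEval]
  have h2 : (1 : ℝ) ⊗ₜ[ℤ] (affRefl P a).left.toAdd =
      -((a.2 : ℝ) • ((1 : ℝ) ⊗ₜ[ℤ] P.root a.1)) := by
    simp only [affRefl, toAdd_ofAdd, neg_smul, TensorProduct.tmul_neg]
    rw [TensorProduct.smul_tmul', ← TensorProduct.smul_tmul]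
    simp
  rw [h2]
  module

lemma affEval_lineMap (a : ι × ℤ) (ε : ℝ) (x y : ℝ ⊗[ℤ] X) :
    affEval P a ((1 - ε) • x + ε • y) = (1 - ε) * affEval P a x + ε * affEval P a y := by
  simp only [affEval, map_add, map_smul, smul_eq_mul]
  ring

end AffineAction

/-! ### Positivity of affine roots on the alcove -/

section Positivity

variable {ι X Y : Type*} [Finite ι] [AddCommGroup X] [AddCommGroup Y] {P : RootDatum ι X Y}
  {b : P.Base}

lemma corootR_nonneg_of_simple {x : ℝ ⊗[ℤ] X} (hx : ∀ a ∈ simpleAff b, 0 ≤ affEval P a x) :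
    ∀ i ∈ b.support, 0 ≤ corootR P i x := fun i hi => by
  simpa [affEval] using hx (i, 0) (zero_mem_simpleAff hi)

lemma affEval_neg_of_isMaxCoroot (t : ι) (x : ℝ ⊗[ℤ] X) :
    affEval P (P.reflectionPerm t t, 1) x = 1 - corootR P t x := by
  simp only [affEval, ← coweight_coroot, coroot_neg, map_neg, LinearMap.neg_apply]
  push_cast
  ring

/-- For k ≥ 1 choose a maximal coroot θ dominating -α. Then α + k exceeds 1 - θ by k - 1 plus an
element of the cone, and 1 - θ is a simple affine root. -/
lemma affEval_nonneg_of_simple {x : ℝ ⊗[ℤ] X} (hx : ∀ a ∈ simpleAff b, 0 ≤ affEval P a x)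
    {a : ι × ℤ} (ha : a ∈ posAff b) : 0 ≤ affEval P a x := by
  have h0 := corootR_nonneg_of_simple hx
  obtain ⟨i, k⟩ := a
  rcases ha with h | ⟨rfl : k = 0, h⟩
  · obtain ⟨t, ht, htj⟩ := exists_isMaxCoroot b (P.reflectionPerm i i)
    have h1 := coweight_nonneg h0 htj
    rw [coroot_neg, sub_neg_eq_add, map_add, LinearMap.add_apply, coweight_coroot,
      coweight_coroot] at h1
    have h2 := hx _ (neg_mem_simpleAff ht)
    rw [affEval_neg_of_isMaxCoroot] at h2
    have h3 : (1 : ℝ) ≤ k := by exact_mod_cast h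
    simp only [affEval]
    linarith
  · have := coweight_nonneg h0 (isPos_iff_coroot_mem.mp h)
    simpa [affEval, coweight_coroot] using this

lemma isAddTorsionFree_left (P : RootDatum ι X Y) : IsAddTorsionFree X := by
  have hinj : Function.Injective P.toLinearMap := (LinearMap.IsPerfPair.bijective_left _).1
  have : IsAddTorsionFree (Y →ₗ[ℤ] ℤ) := by
    refine ⟨fun n hn f g h => ?_⟩
    ext y
    have := LinearMap.congr_fun h y
    simpa [hn] using this
  exact hinj.isAddTorsionFree P.toLinearMap.toAddMonoidHom

lemma isAddTorsionFree_right (P : RootDatum ι X Y) : IsAddTorsionFree Y :=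
  isAddTorsionFree_left P.flip

/-- A simple root is determined by its ray. -/
lemma eq_of_coroot_eq_smul [P.IsReduced] {i j : ι} (hj : b.IsPos j) (hi : b.IsPos i) {m : ℕ}
    (h : P.coroot i = m • P.coroot j) : i = j := by
  have := isAddTorsionFree_left P
  have := isAddTorsionFree_right P
  by_contra hne
  have h1 := RootPairing.IsReduced.linearIndependent P.flip hne (by
    intro h2
    have h3 : P.coroot i = -P.coroot j := h2
    refine coroot_ne_zero (P := P) j (eq_zero_of_mem_neg_mem (b := b)
      (isPos_iff_coroot_mem.mp hj) ?_)
    rw [← h3]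
    exact isPos_iff_coroot_mem.mp hi)
  rw [LinearIndependent.pair_iff] at h1
  have := (h1 1 (-(m : ℤ)) (by
    change (1 : ℤ) • P.coroot i + (-(m : ℤ)) • P.coroot j = 0
    simp [h])).1
  omega

/-- This is the equality case of `affEval_nonneg_of_simple`: every discarded term must vanish, so
only the one root allowed to vanish can contribute. It is used with a wall and a generic point of
that wall, and with an interior point, where no simple root vanishes and `a` is merely a formal
argument. -/
lemma affEval_pos_of_simple_aux [P.IsReduced] {x : ℝ ⊗[ℤ] X} {a : ι × ℤ}
    (hx : ∀ c ∈ simpleAff b, 0 ≤ affEval P c x)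
    (hx' : ∀ c ∈ simpleAff b, c ≠ a → 0 < affEval P c x) {β : ι × ℤ} (hβ : β ∈ posAff b)
    (h : affEval P β x = 0) : β = a := by
  have h0 := corootR_nonneg_of_simple hx
  have h0' (j : ι) (hj : j ∈ b.support) (hja : (j, 0) ≠ a) : 0 < corootR P j x := by
    simpa [affEval] using hx' (j, 0) (zero_mem_simpleAff hj) hja
  have key {m : ι → ℕ} (hm : coweight P (∑ j ∈ b.support, m j • P.coroot j) x = 0) (j : ι)
      (hj : j ∈ b.support) (hja : (j, 0) ≠ a) : m j = 0 := by
    rw [coweight_sum] at hm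
    have := (Finset.sum_eq_zero_iff_of_nonneg fun i hi =>
      mul_nonneg (Nat.cast_nonneg _) (h0 i hi)).mp hm j hj
    exact_mod_cast (mul_eq_zero.mp this).resolve_right (h0' j hj hja).ne'
  obtain ⟨i, k⟩ := β
  rcases hβ with hk | ⟨rfl : k = 0, hi⟩
  · obtain ⟨t, ht, htj⟩ := exists_isMaxCoroot b (P.reflectionPerm i i)
    have h1 := coweight_nonneg h0 htj
    have h2 := hx _ (neg_mem_simpleAff ht)
    rw [affEval_neg_of_isMaxCoroot] at h2
    have h3 : (1 : ℝ) ≤ k := by exact_mod_cast hk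
    have h4 : coweight P (P.coroot t - P.coroot (P.reflectionPerm i i)) x =
        corootR P t x + corootR P i x := by
      rw [coroot_neg, sub_neg_eq_add, map_add]; rfl
    simp only [affEval] at h
    rw [h4] at h1
    have h5 : (P.reflectionPerm t t, (1 : ℤ)) = a := by
      by_contra hne
      have := hx' _ (neg_mem_simpleAff ht) hne
      rw [affEval_neg_of_isMaxCoroot] at this
      linarith
    have h6 : k = 1 := by
      have : (k : ℝ) = 1 := by linarith
      exact_mod_cast this
    obtain ⟨m, hm⟩ := exists_eq_sum_of_mem_corootCone htj
    have h7 := key (m := m) (by rw [← hm, h4]; linarith)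
    have h8 : P.coroot t - P.coroot (P.reflectionPerm i i) = 0 := by
      rw [hm]
      refine Finset.sum_eq_zero fun j hj => ?_
      rw [h7 j hj (by rw [← h5]; simp), zero_smul]
    have h9 := P.coroot.injective (sub_eq_zero.mp h8)
    rw [← h5, h6, h9, neg_neg_index]
  · have hi' := isPos_iff_coroot_mem.mp hi
    obtain ⟨m, hm⟩ := exists_eq_sum_of_mem_corootCone hi'
    have h1 := key (m := m) (by rw [← hm, coweight_coroot]; simpa [affEval] using h)
    by_cases ha : a.1 ∈ b.support ∧ a.2 = 0
    · obtain ⟨j, l⟩ := a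
      obtain ⟨hj : j ∈ b.support, rfl : l = 0⟩ := ha
      rw [Finset.sum_eq_single_of_mem j hj fun c hc hcj => by
        rw [h1 c hc (by simpa using hcj), zero_smul]] at hm
      -- The coroot is a multiple of a single simple coroot. Reducedness of the root system makes
      -- the multiple trivial.
      exact congrArg (·, (0 : ℤ)) (eq_of_coroot_eq_smul (RootPairing.Base.isPos_of_mem_support hj) hi hm)
    · exfalso
      refine coroot_ne_zero (P := P) i ?_
      rw [hm]
      refine Finset.sum_eq_zero fun j hj => ?_
      rw [h1 j hj (fun h => ha (h ▸ ⟨hj, rfl⟩)), zero_smul]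

lemma affEval_pos_of_simple [P.IsReduced] {x : ℝ ⊗[ℤ] X} {a : ι × ℤ}
    (hx : ∀ c ∈ simpleAff b, 0 ≤ affEval P c x)
    (hx' : ∀ c ∈ simpleAff b, c ≠ a → 0 < affEval P c x) {β : ι × ℤ} (hβ : β ∈ posAff b)
    (hne : β ≠ a) : 0 < affEval P β x :=
  (affEval_nonneg_of_simple hx hβ).lt_of_ne' fun h => hne (affEval_pos_of_simple_aux hx hx' hβ h)

lemma simpleAff_subset_posAff : simpleAff b ⊆ posAff b := by
  rintro ⟨i, k⟩ (⟨hi, rfl : k = 0⟩ | ⟨rfl : k = 1, -⟩)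
  · exact Or.inr ⟨rfl, RootPairing.Base.isPos_of_mem_support hi⟩
  · exact Or.inl one_pos

/-- In the open alcove the positive affine roots are exactly those with positive value. -/
lemma affEval_pos_iff [P.IsReduced] {x : ℝ ⊗[ℤ] X} (hx : ∀ a ∈ simpleAff b, 0 < affEval P a x)
    {a : ι × ℤ} : 0 < affEval P a x ↔ a ∈ posAff b := by
  have key {a : ι × ℤ} (ha : a ∈ posAff b) : 0 < affEval P a x := by
    refine (affEval_nonneg_of_simple (fun c hc => (hx c hc).le) ha).lt_of_ne' fun h => ?_
    have := affEval_pos_of_simple_aux (a := negRoot P a) (fun c hc => (hx c hc).le)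
      (fun c hc _ => hx c hc) ha h
    exact (negRoot_mem_iff b a).mp (this ▸ ha) ha
  refine ⟨fun h => ?_, key⟩
  by_contra hn
  have := key ((negRoot_mem_iff b a).mpr hn)
  rw [affEval_negRoot] at this
  linarith

/-- A face `A_J` is nonempty if and only if `J` contains no component. -/
lemma alcoveFace_nonempty_iff {J : Set (ι × ℤ)} (hJ : J ⊆ simpleAff b) :
    (alcoveFace b J).Nonempty ↔
      ∀ t, IsMaxCoroot b t → ∃ a ∈ simpleAff b, comp b a = t ∧ a ∉ J := by
  classical
  constructor
  · rintro ⟨x, -, hx, -⟩ t ht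
    by_contra! h
    have h1 := sum_weight_mul_affEval ht x
    rw [Finset.sum_eq_zero fun a ha => ?_] at h1
    · exact zero_ne_one h1
    · rw [Finset.mem_filter, mem_simpleFinset] at ha
      rw [hx a (h a ha.1 ha.2), mul_zero]
  · intro h
    -- The point has the same value at all walls of a component that are off J. The relation with
    -- sum 1 forces this value to be the inverse of their total weight N, which is positive because
    -- some wall is off J.
    set N : ι → ℝ := fun t => ∑ a ∈ simpleFinset b with comp b a = t, if a ∈ J then 0 else weight b a
    have hN (t : ι) (ht : IsMaxCoroot b t) : 0 < N t := by
      obtain ⟨a, ha, hat, haJ⟩ := h t ht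
      refine Finset.sum_pos' (fun c hc => ?_) ⟨a, by simp [ha, hat], by simp [haJ, weight_pos ha]⟩
      rw [Finset.mem_filter, mem_simpleFinset] at hc
      split_ifs
      · exact le_rfl
      · exact (weight_pos hc.1).le
    obtain ⟨x, hx, hxy⟩ := exists_affEval_eq b (fun a => if a ∈ J then 0 else (N (comp b a))⁻¹) (by
      intro t ht
      have : ∀ a ∈ (simpleFinset b).filter (fun a => comp b a = t),
          (weight b a * if a ∈ J then 0 else (N (comp b a))⁻¹) =
          (if a ∈ J then 0 else weight b a) * (N t)⁻¹ := fun a ha => by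
        rw [Finset.mem_filter] at ha
        split_ifs <;> simp [ha.2]
      rw [Finset.sum_congr rfl this, ← Finset.sum_mul]
      exact mul_inv_cancel₀ (hN t ht).ne')
    refine ⟨x, hx, fun a ha => by simp [hxy a (hJ ha), ha], fun a ha => ?_⟩
    rw [hxy a ha.1, if_neg ha.2]
    exact inv_pos.mpr (hN _ (isMaxCoroot_comp ha.1))

lemma exists_mem_comp {t : ι} (ht : IsMaxCoroot b t) :
    ∃ i ∈ b.support, comp b (i, 0) = t := by
  have : ∃ i ∈ b.support, maxCoeff b t i ≠ 0 := by
    by_contra! h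
    refine coroot_ne_zero (P := P) t ?_
    rw [ht.eq_sum]
    exact Finset.sum_eq_zero fun i hi => by simp [h i hi]
  obtain ⟨i, hi, hti⟩ := this
  exact ⟨i, hi, (comp_of_mem_support hi).1.eq_of_maxCoeff ht hi (comp_of_mem_support hi).2 hti⟩

lemma alcoveFace_empty_nonempty (b : P.Base) : (alcoveFace b ∅).Nonempty := by
  rw [alcoveFace_nonempty_iff (Set.empty_subset _)]
  exact fun t ht => ⟨_, neg_mem_simpleAff ht, comp_neg b, by simp⟩

lemma exists_alcove_point (b : P.Base) :
    ∃ x : ℝ ⊗[ℤ] X, ∀ a ∈ simpleAff b, 0 < affEval P a x := by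
  obtain ⟨x, hx⟩ := alcoveFace_empty_nonempty b
  exact ⟨x, fun a ha => hx.2.2 a ⟨ha, by simp⟩⟩

/-- Every component has at least two walls, an affine one and a linear one, so a single wall never
fills a component. -/
lemma alcoveFace_singleton_nonempty {a : ι × ℤ} (ha : a ∈ simpleAff b) :
    (alcoveFace b {a}).Nonempty := by
  rw [alcoveFace_nonempty_iff (by simpa using ha)]
  intro t ht
  by_cases h : a.2 = 0
  · exact ⟨_, neg_mem_simpleAff ht, comp_neg b, fun h' => by
      rw [Set.mem_singleton_iff] at h'; simp [← h'] at h⟩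
  · obtain ⟨i, hi, hit⟩ := exists_mem_comp ht
    exact ⟨_, zero_mem_simpleAff hi, hit, fun h' => by
      rw [Set.mem_singleton_iff] at h'; simp [← h'] at h⟩

lemma affEval_nonneg_of_mem_alcoveFace {J : Set (ι × ℤ)} {x : ℝ ⊗[ℤ] X} (hx : x ∈ alcoveFace b J) :
    ∀ a ∈ simpleAff b, 0 ≤ affEval P a x := fun a ha => by
  by_cases h : a ∈ J
  · exact (hx.2.1 a h).ge
  · exact (hx.2.2 a ⟨ha, h⟩).le

/-- The simple reflection `s_a` permutes the positive affine roots other than `a`. -/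
lemma affAct_affRefl_mem [P.IsReduced] {a β : ι × ℤ} (ha : a ∈ simpleAff b) (hβ : β ∈ posAff b)
    (hne : β ≠ a) : affAct (affRefl P a) β ∈ posAff b := by
  -- A generic point of the wall of `a` is fixed by the reflection, so the root and its image have
  -- the same value there. This value is positive because only `a` vanishes at the point.
  obtain ⟨x, hx⟩ := alcoveFace_singleton_nonempty ha
  have h1 := affEval_pos_of_simple (affEval_nonneg_of_mem_alcoveFace hx)
    (fun c hc hca => hx.2.2 c ⟨hc, hca⟩) hβ hne
  by_contra h
  have h2 := affEval_nonneg_of_simple (affEval_nonneg_of_mem_alcoveFace hx)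
    ((negRoot_mem_iff b _).mpr h)
  rw [affEval_negRoot, affEval_affAct, affRefl_inv, affPt_affRefl, hx.2.1 a rfl, zero_smul,
    sub_zero] at h2
  linarith

end Positivity

end

end AffineHecke

namespace AffineHecke

noncomputable section

set_option linter.unusedSectionVars false

/-! ### Inversions, descents and additivity of lengths -/

section Length

variable {ι X Y : Type*} [Finite ι] [AddCommGroup X] [AddCommGroup Y] {P : RootDatum ι X Y}
  {b : P.Base}

/-- The inversions of `w`. -/
def inversions (b : P.Base) (w : ExtWeyl P) : Set (ι × ℤ) :=
  {a | a ∈ posAff b ∧ affAct w a ∉ posAff b}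

lemma length_eq_ncard (w : ExtWeyl P) : length b w = (inversions b w).ncard := by
  rw [length, negAff_eq_compl]; rfl

lemma inversions_finite (b : P.Base) (w : ExtWeyl P) : (inversions b w).Finite := by
  have := length_set_finite b w
  rwa [negAff_eq_compl] at this

lemma affAct_injective (w : ExtWeyl P) : Function.Injective (affAct w) :=
  Function.LeftInverse.injective (affAct_inv_affAct w)

lemma length_one (b : P.Base) : length b 1 = 0 := length_Omega (one_mem_Omega b)

/-- Lengths add if `u⁻¹` maps the inversions of `w` to positive roots. -/
lemma length_mul_of_inversions {w u : ExtWeyl P}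
    (h : ∀ a ∈ inversions b w, affAct u⁻¹ a ∈ posAff b) :
    length b (w * u) = length b w + length b u := by
  have h1 : inversions b (w * u) = inversions b u ∪ affAct u⁻¹ '' inversions b w := by
    ext a
    constructor
    · rintro ⟨ha, hwa⟩
      rw [affAct_mul] at hwa
      by_cases hu : affAct u a ∈ posAff b
      · exact Or.inr ⟨affAct u a, ⟨hu, hwa⟩, affAct_inv_affAct u a⟩
      · exact Or.inl ⟨ha, hu⟩
    · rintro (⟨ha, hua⟩ | ⟨c, hc, rfl⟩)
      · refine ⟨ha, fun hw => ?_⟩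
        rw [affAct_mul] at hw
        have h2 := h (negRoot P (affAct u a)) ⟨(negRoot_mem_iff b _).mpr hua, by
          rw [affAct_negRoot, negRoot_mem_iff]; exact not_not_intro hw⟩
        rw [affAct_negRoot, affAct_inv_affAct, negRoot_mem_iff] at h2
        exact h2 ha
      · exact ⟨h c hc, by rw [affAct_mul, affAct_affAct_inv]; exact hc.2⟩
  have h2 : Disjoint (inversions b u) (affAct u⁻¹ '' inversions b w) := by
    rw [Set.disjoint_left]
    rintro _ ⟨-, h3⟩ ⟨c, hc, rfl⟩
    rw [affAct_affAct_inv] at h3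
    exact h3 hc.1
  rw [length_eq_ncard, h1, Set.ncard_union_eq h2 (inversions_finite b u)
    ((inversions_finite b w).image _), Set.ncard_image_of_injective _ (affAct_injective _),
    length_eq_ncard, length_eq_ncard, add_comm]

lemma length_mul_le (w u : ExtWeyl P) : length b (w * u) ≤ length b w + length b u := by
  have h1 : inversions b (w * u) ⊆ inversions b u ∪ affAct u⁻¹ '' inversions b w := by
    rintro a ⟨ha, hwa⟩
    rw [affAct_mul] at hwa
    by_cases hu : affAct u a ∈ posAff b
    · exact Or.inr ⟨affAct u a, ⟨hu, hwa⟩, affAct_inv_affAct u a⟩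
    · exact Or.inl ⟨ha, hu⟩
  rw [length_eq_ncard, length_eq_ncard, length_eq_ncard, add_comm]
  refine (Set.ncard_le_ncard h1 ((inversions_finite b u).union
    ((inversions_finite b w).image _))).trans ((Set.ncard_union_le _ _).trans ?_)
  rw [Set.ncard_image_of_injective _ (affAct_injective _)]

/-- Negation combined with w⁻¹ carries the inversions of w⁻¹ to inversions of w. -/
lemma length_inv (w : ExtWeyl P) : length b w⁻¹ = length b w := by
  have key (w : ExtWeyl P) : length b w⁻¹ ≤ length b w := by
    rw [length_eq_ncard, length_eq_ncard,
      ← Set.ncard_image_of_injective (inversions b w⁻¹) (affAct_injective w⁻¹),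
      ← Set.ncard_image_of_injective (affAct w⁻¹ '' inversions b w⁻¹)
        (Function.LeftInverse.injective (negRoot_negRoot (P := P)))]
    refine Set.ncard_le_ncard ?_ (inversions_finite b w)
    rintro _ ⟨_, ⟨a, ha, rfl⟩, rfl⟩
    refine ⟨(negRoot_mem_iff b _).mpr ha.2, ?_⟩
    rw [affAct_negRoot, affAct_affAct_inv, negRoot_mem_iff]
    exact not_not_intro ha.1
  exact le_antisymm (key w) (by simpa using key w⁻¹)

section Reduced

variable [P.IsReduced]

lemma affAct_affRefl_self_notMem {a : ι × ℤ} (ha : a ∈ simpleAff b) :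
    affAct (affRefl P a) a ∉ posAff b := by
  rw [affAct_affRefl_self, negRoot_mem_iff]
  exact not_not_intro (simpleAff_subset_posAff ha)

lemma inversions_affRefl {a : ι × ℤ} (ha : a ∈ simpleAff b) :
    inversions b (affRefl P a) = {a} := by
  ext c
  refine ⟨fun hc => ?_, ?_⟩
  · by_contra hne
    exact hc.2 (affAct_affRefl_mem ha hc.1 hne)
  · rintro rfl
    exact ⟨simpleAff_subset_posAff ha, affAct_affRefl_self_notMem ha⟩

lemma length_affRefl {a : ι × ℤ} (ha : a ∈ simpleAff b) : length b (affRefl P a) = 1 := by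
  rw [length_eq_ncard, inversions_affRefl ha, Set.ncard_singleton]

lemma length_mul_affRefl {w : ExtWeyl P} {a : ι × ℤ} (ha : a ∈ simpleAff b)
    (h : affAct w a ∈ posAff b) : length b (w * affRefl P a) = length b w + 1 := by
  rw [length_mul_of_inversions, length_affRefl ha]
  rintro c ⟨hc, hwc⟩
  rw [affRefl_inv]
  exact affAct_affRefl_mem ha hc (by rintro rfl; exact hwc h)

lemma affAct_mul_affRefl (w : ExtWeyl P) (a : ι × ℤ) :
    affAct (w * affRefl P a) a ∈ posAff b ↔ affAct w a ∉ posAff b := by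
  rw [affAct_mul, affAct_affRefl_self, affAct_negRoot, negRoot_mem_iff]

lemma length_mul_affRefl_of_notMem {w : ExtWeyl P} {a : ι × ℤ} (ha : a ∈ simpleAff b)
    (h : affAct w a ∉ posAff b) : length b (w * affRefl P a) + 1 = length b w := by
  have := length_mul_affRefl ha ((affAct_mul_affRefl w a).mpr h)
  rw [affRefl_mul_cancel_right] at this
  exact this.symm

lemma length_affRefl_mul {w : ExtWeyl P} {a : ι × ℤ} (ha : a ∈ simpleAff b)
    (h : affAct w⁻¹ a ∈ posAff b) : length b (affRefl P a * w) = length b w + 1 := by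
  rw [← length_inv, mul_inv_rev, affRefl_inv, length_mul_affRefl ha h, length_inv]

lemma length_affRefl_mul_of_notMem {w : ExtWeyl P} {a : ι × ℤ} (ha : a ∈ simpleAff b)
    (h : affAct w⁻¹ a ∉ posAff b) : length b (affRefl P a * w) + 1 = length b w := by
  rw [← length_inv, mul_inv_rev, affRefl_inv, length_mul_affRefl_of_notMem ha h, length_inv]

/-- If w keeps the simple roots positive, then w⁻¹ maps an alcove point to a point that is again in
the alcove, up to the central directions. Positivity of any affine root can be tested at either
point. -/
lemma mem_Omega_iff_simple {w : ExtWeyl P} :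
    w ∈ Omega b ↔ ∀ a ∈ simpleAff b, affAct w a ∈ posAff b := by
  rw [mem_Omega_iff]
  refine ⟨fun h a ha => h a (simpleAff_subset_posAff ha), fun h a ha => ?_⟩
  obtain ⟨x, hx⟩ := exists_alcove_point b
  have h1 : ∀ a ∈ simpleAff b, 0 < affEval P a (affPt w⁻¹ x) := fun a ha => by
    rw [← affEval_affAct, affEval_pos_iff hx]
    exact h a ha
  rw [← affEval_pos_iff hx, affEval_affAct, affEval_pos_iff h1]
  exact ha

lemma exists_descent {w : ExtWeyl P} (hw : length b w ≠ 0) :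
    ∃ a ∈ simpleAff b, affAct w a ∉ posAff b := by
  by_contra! h
  exact hw (mem_Omega_iff_simple.mpr h)

/-- An element of `Ω` permutes the simple affine roots. -/
lemma affAct_mem_simpleAff {w : ExtWeyl P} (hw : w ∈ Omega b) {a : ι × ℤ} (ha : a ∈ simpleAff b) :
    affAct w a ∈ simpleAff b := by
  -- Conjugation by Ω preserves lengths, so this reflection has exactly one inversion. Both its own
  -- positive root and a simple descent are inversions, hence they coincide.
  have h1 : length b (affRefl P (affAct w a)) = 1 := by
    rw [← conj_affRefl, length_mul_Omega (inv_mem_Omega hw), length_Omega_mul hw,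
      length_affRefl ha]
  obtain ⟨c, hc, hc'⟩ := exists_descent (b := b) (w := affRefl P (affAct w a)) (by omega)
  have h2 : affAct w a ∈ posAff b := (affAct_mem_iff hw a).mpr (simpleAff_subset_posAff ha)
  have h3 : affAct w a ∈ inversions b (affRefl P (affAct w a)) := by
    refine ⟨h2, ?_⟩
    rw [affAct_affRefl_self, negRoot_mem_iff]
    exact not_not_intro h2
  have h4 : c ∈ inversions b (affRefl P (affAct w a)) := ⟨simpleAff_subset_posAff hc, hc'⟩
  rw [length_eq_ncard, Set.ncard_eq_one] at h1
  obtain ⟨d, hd⟩ := h1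
  rw [hd, Set.mem_singleton_iff] at h3 h4
  rw [h3, ← h4]
  exact hc

/-- The right descents of `w`. -/
def descents (b : P.Base) (w : ExtWeyl P) : Set (ι × ℤ) := {a ∈ simpleAff b | affAct w a ∉ posAff b}

/-- No component consists of descents. -/
lemma exists_notMem_descents (w : ExtWeyl P) {t : ι} (ht : IsMaxCoroot b t) :
    ∃ a ∈ simpleAff b, comp b a = t ∧ a ∉ descents b w := by
  classical
  by_contra! h
  obtain ⟨x, hx⟩ := exists_alcove_point b
  -- If all walls of a component were descents, they would all be at most zero at w⁻¹ x, whereas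
  -- their weighted sum is 1.
  have h1 := sum_weight_mul_affEval ht (affPt w⁻¹ x)
  have h2 : ∑ a ∈ simpleFinset b with comp b a = t, weight b a * affEval P a (affPt w⁻¹ x) ≤ 0 := by
    refine Finset.sum_nonpos fun a ha => ?_
    rw [Finset.mem_filter, mem_simpleFinset] at ha
    refine mul_nonpos_of_nonneg_of_nonpos (weight_pos ha.1).le ?_
    rw [← affEval_affAct]
    have := (h a ha.1 ha.2).2
    rw [← affEval_pos_iff hx] at this
    exact not_lt.mp this
  linarith

lemma affPt_of_mem_stabJ {J : Set (ι × ℤ)} {x : ℝ ⊗[ℤ] X} (hx : ∀ a ∈ J, affEval P a x = 0)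
    {v : ExtWeyl P} (hv : v ∈ stabJ P J) : affPt v x = x := by
  induction hv using Subgroup.closure_induction with
  | mem v hv =>
    obtain ⟨a, ha, rfl⟩ := hv
    rw [affPt_affRefl, hx a ha, zero_smul, sub_zero]
  | one => exact affPt_one x
  | mul u v _ _ hu hv => rw [affPt_mul, hv, hu]
  | inv v _ hv =>
    conv_lhs => rw [← hv]
    rw [← affPt_mul, inv_mul_cancel, affPt_one]

/-- If `w` is minimal in `w W_J`, then lengths add. -/
lemma length_mul_of_mem_stabJ {J : Set (ι × ℤ)} (hJ : (alcoveFace b J).Nonempty)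
    {w v : ExtWeyl P} (hw : ∀ a ∈ J, affAct w a ∈ posAff b) (hv : v ∈ stabJ P J) :
    length b (w * v) = length b w + length b v := by
  obtain ⟨z, hz⟩ := hJ
  obtain ⟨x, hx⟩ := exists_alcove_point b
  refine length_mul_of_inversions ?_
  rintro β ⟨hβ, hwβ⟩
  -- Suppose v⁻¹ makes an inversion β of w negative. As v fixes the point z of the facet, β is both
  -- ≥ 0 and ≤ 0 at z. Moving from z towards w⁻¹ x one enters the alcove, since w keeps the roots in
  -- J positive. There β > 0, so β is positive at w⁻¹ x, and this contradicts that w inverts β.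
  by_contra hvβ
  have hz0 := affEval_nonneg_of_mem_alcoveFace hz
  have h1 := affEval_nonneg_of_simple hz0 hβ
  have h2 := affEval_nonneg_of_simple hz0 ((negRoot_mem_iff b _).mpr hvβ)
  rw [affEval_negRoot, affEval_affAct, inv_inv, affPt_of_mem_stabJ hz.2.1 hv] at h2
  have h3 : affEval P β z = 0 := by linarith
  set y := affPt w⁻¹ x with hy
  -- a point of the alcove close to `z`
  obtain ⟨ε, hε0, hε⟩ : ∃ ε : ℝ, 0 < ε ∧
      ∀ a ∈ simpleAff b, 0 < affEval P a ((1 - ε) • z + ε • y) := by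
    have h4 : ∀ a ∈ simpleAff b, ∀ᶠ ε in nhdsWithin (0 : ℝ) (Set.Ioi 0),
        0 < affEval P a ((1 - ε) • z + ε • y) := by
      intro a ha
      simp only [affEval_lineMap]
      by_cases haJ : a ∈ J
      · filter_upwards [self_mem_nhdsWithin] with ε hε
        rw [hz.2.1 a haJ, mul_zero, zero_add]
        refine mul_pos hε ?_
        rw [hy, ← affEval_affAct, affEval_pos_iff hx]
        exact hw a haJ
      · have h5 : 0 < affEval P a z := hz.2.2 a ⟨ha, haJ⟩
        have h6 : Continuous fun ε : ℝ => (1 - ε) * affEval P a z + ε * affEval P a y := by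
          fun_prop
        have h7 : ∀ᶠ ε in nhds (0 : ℝ), 0 < (1 - ε) * affEval P a z + ε * affEval P a y :=
          h6.continuousAt.eventually (lt_mem_nhds (by simpa using h5))
        exact h7.filter_mono nhdsWithin_le_nhds
    have h5 := ((simpleAff_finite b).eventually_all).mpr h4
    obtain ⟨ε, h6, h7⟩ := (h5.and self_mem_nhdsWithin).exists
    exact ⟨ε, h7, h6⟩
  have h4 := (affEval_pos_iff hε).mpr hβ
  rw [affEval_lineMap, h3, mul_zero, zero_add] at h4
  have h5 : 0 < affEval P β y := pos_of_mul_pos_right h4 hε0.le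
  rw [hy, ← affEval_affAct, affEval_pos_iff hx] at h5
  exact hwβ h5

/-! ### Words in simple reflections and the exchange condition -/

/-- A product of reflections. -/
def reflProd (P : RootDatum ι X Y) (l : List (ι × ℤ)) : ExtWeyl P := (l.map (affRefl P)).prod

@[simp] lemma reflProd_nil : reflProd P [] = 1 := rfl

@[simp] lemma reflProd_cons (a : ι × ℤ) (l : List (ι × ℤ)) :
    reflProd P (a :: l) = affRefl P a * reflProd P l := by simp [reflProd]

@[simp] lemma reflProd_append (l m : List (ι × ℤ)) :
    reflProd P (l ++ m) = reflProd P l * reflProd P m := by simp [reflProd]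

lemma exists_list_of_mem_stabJ {J : Set (ι × ℤ)} {v : ExtWeyl P} (hv : v ∈ stabJ P J) :
    ∃ l : List (ι × ℤ), (∀ a ∈ l, a ∈ J) ∧ reflProd P l = v := by
  induction hv using Subgroup.closure_induction with
  | mem v hv =>
    obtain ⟨a, ha, rfl⟩ := hv
    exact ⟨[a], by simpa using ha, by simp⟩
  | one => exact ⟨[], by simp, by simp⟩
  | mul u v _ _ hu hv =>
    obtain ⟨l, hl, rfl⟩ := hu
    obtain ⟨m, hm, rfl⟩ := hv
    exact ⟨l ++ m, fun a ha => (List.mem_append.mp ha).elim (hl a) (hm a), by simp⟩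
  | inv v _ hv =>
    obtain ⟨l, hl, rfl⟩ := hv
    refine ⟨l.reverse, by simpa using hl, ?_⟩
    rw [reflProd, reflProd, List.prod_inv_reverse, List.map_map, List.map_reverse]
    congr 3
    funext a
    exact (affRefl_inv a).symm

/-- The exchange condition. -/
lemma exchange {l : List (ι × ℤ)} (hl : ∀ a ∈ l, a ∈ simpleAff b) {a : ι × ℤ}
    (ha : a ∈ simpleAff b) (h : affAct (reflProd P l) a ∉ posAff b) :
    ∃ m : List (ι × ℤ), (∀ a ∈ m, a ∈ simpleAff b) ∧ m.length + 1 = l.length ∧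
      reflProd P m = reflProd P l * affRefl P a := by
  induction l with
  | nil =>
    refine absurd (simpleAff_subset_posAff ha) ?_
    simpa [affAct_one] using h
  | cons c l ih =>
    have hc : c ∈ simpleAff b := hl c (by simp)
    have hl' : ∀ a ∈ l, a ∈ simpleAff b := fun a ha => hl a (by simp [ha])
    have hprod : reflProd P (c :: l) = affRefl P c * reflProd P l := by simp
    by_cases h1 : affAct (reflProd P l) a ∈ posAff b
    · refine ⟨l, hl', rfl, ?_⟩
      rw [hprod, affAct_mul] at h
      have h2 : affAct (reflProd P l) a = c := by
        by_contra hne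
        exact h (affAct_affRefl_mem hc h1 hne)
      have h3 := conj_affRefl (reflProd P l) a
      rw [h2, mul_inv_eq_iff_eq_mul] at h3
      rw [hprod, mul_assoc, h3, affRefl_mul_cancel_left]
    · obtain ⟨m, hm, hm1, hm2⟩ := ih hl' h1
      refine ⟨c :: m, fun d hd => ?_, by simp [hm1], by simp [hm2, mul_assoc]⟩
      rcases List.mem_cons.mp hd with rfl | hd
      · exact hc
      · exact hm d hd

/-- The full product inverts no positive root, so its last letter is a descent of the prefix. The
exchange condition then rewrites the product as a word with two letters fewer. Thus the affine Weyl
group meets Ω trivially. -/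
lemma eq_one_of_reflProd_mem_Omega (n : ℕ) {l : List (ι × ℤ)} (hl : ∀ a ∈ l, a ∈ simpleAff b)
    (hn : l.length = n) (h : reflProd P l ∈ Omega b) : reflProd P l = 1 := by
  induction n using Nat.strong_induction_on generalizing l with
  | _ n ih =>
    rcases List.eq_nil_or_concat l with rfl | ⟨l', a, rfl⟩
    · simp
    · rw [List.concat_eq_append] at *
      have ha : a ∈ simpleAff b := hl a (by simp)
      have hl' : ∀ a ∈ l', a ∈ simpleAff b := fun c hc => hl c (by simp [hc])
      have hprod : reflProd P (l' ++ [a]) = reflProd P l' * affRefl P a := by simp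
      have h1 : affAct (reflProd P l') a ∉ posAff b := by
        rw [← affAct_mul_affRefl, ← hprod]
        exact (mem_Omega_iff b _).mp h a (simpleAff_subset_posAff ha)
      obtain ⟨m, hm, hm1, hm2⟩ := exchange hl' ha h1
      rw [hprod, ← hm2] at h ⊢
      exact ih m.length (by simp at hn; omega) hm rfl h

lemma eq_one_of_mem_stabJ {J : Set (ι × ℤ)} (hJ : J ⊆ simpleAff b) {v : ExtWeyl P}
    (hv : v ∈ stabJ P J) (h : length b v = 0) : v = 1 := by
  obtain ⟨l, hl, rfl⟩ := exists_list_of_mem_stabJ hv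
  exact eq_one_of_reflProd_mem_Omega l.length (fun a ha => hJ (hl a ha)) rfl h

/-- Without a descent in J the lengths of v and v⁻¹ would add up to the length of 1, so v would have
length zero and be trivial. Reduced words of elements of W_J thus stay inside J. -/
lemma exists_descent_of_mem_stabJ {J : Set (ι × ℤ)} (hJ : J ⊆ simpleAff b)
    (hne : (alcoveFace b J).Nonempty) {v : ExtWeyl P} (hv : v ∈ stabJ P J) (h : v ≠ 1) :
    ∃ a ∈ J, affAct v a ∉ posAff b := by
  by_contra! hcon
  have h1 := length_mul_of_mem_stabJ hne hcon (inv_mem hv)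
  rw [mul_inv_cancel, length_one] at h1
  exact h (eq_one_of_mem_stabJ hJ hv (by omega))

lemma affRefl_mem_stabJ {J : Set (ι × ℤ)} {a : ι × ℤ} (ha : a ∈ J) : affRefl P a ∈ stabJ P J :=
  Subgroup.subset_closure ⟨a, ha, rfl⟩

end Reduced

/-! ### The centre and finiteness -/

lemma toLinearMap_injective (P : RootDatum ι X Y) : Function.Injective P.toLinearMap :=
  (LinearMap.IsPerfPair.bijective_left _).1

lemma one_tmul_injective (P : RootDatum ι X Y) :
    Function.Injective fun x : X => (1 : ℝ) ⊗ₜ[ℤ] x := by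
  intro x y hxy
  apply toLinearMap_injective P
  ext f
  have := congrArg (coweight P f) hxy
  simpa using this

lemma smul_index_of_smul_root {v : P.weylGroup} {i j : ι} (h : v • P.root i = P.root j) :
    v • i = j := by
  apply P.root.injective
  rw [← h]
  exact (P.weylGroup_apply_root v i).symm

/-- `X` meets no combination of roots orthogonal to all coroots. -/
lemma eq_zero_of_mem_rootSpan {x : X} (hx : x ∈ P.rootSpan ℤ)
    (h : ∀ i, P.toLinearMap x (P.coroot i) = 0) : x = 0 := by
  have := Fintype.ofFinite ι
  refine P.eq_zero_of_mem_rootSpan_of_rootForm_self_eq_zero hx ?_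
  rw [P.rootForm_apply_apply]
  exact Finset.sum_eq_zero fun i _ => by
    rw [show P.coroot' i x = 0 from h i, mul_zero]

lemma smul_sub_mem_rootSpan (v : P.weylGroup) (x : X) : v • x - x ∈ P.rootSpan ℤ := by
  obtain ⟨v, hv⟩ := v
  induction hv using RootPairing.weylGroup.induction generalizing x with
  | mem i =>
    have : (⟨RootPairing.Equiv.reflection P i, P.reflection_mem_weylGroup i⟩ : P.weylGroup) • x - x
        = -(P.toLinearMap x (P.coroot i) • P.root i) := by
      change (x - P.toLinearMap x (P.coroot i) • P.root i) - x = _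
      abel
    rw [this]
    exact neg_mem (Submodule.smul_mem _ _ (Submodule.subset_span ⟨i, rfl⟩))
  | one =>
    rw [show (⟨1, one_mem _⟩ : P.weylGroup) = 1 from rfl, one_smul, sub_self]
    exact zero_mem _
  | mul u v hu hv h1 h2 =>
    have := add_mem (h1 ((⟨v, hv⟩ : P.weylGroup) • x)) (h2 x)
    rw [sub_add_sub_cancel, ← mul_smul] at this
    exact this

lemma weylGroup_ext {u v : P.weylGroup} (h : ∀ x : X, u • x = v • x) : u = v := by
  apply Subtype.ext
  apply RootPairing.Equiv.weightHom_injective P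
  apply LinearEquiv.ext
  exact h

/-- The vector v x - x lies in the root span. If v fixes all coroots, this vector is also orthogonal
to them, hence zero by definiteness of the root form. -/
lemma weylGroup_eq_one_of_smul_index {v : P.weylGroup} (h : ∀ i : ι, v • i = i) : v = 1 := by
  apply weylGroup_ext
  intro x
  rw [one_smul, ← sub_eq_zero]
  refine eq_zero_of_mem_rootSpan (smul_sub_mem_rootSpan v x) fun i => ?_
  have := pairing_smul v x i
  rw [h i] at this
  rw [map_sub, LinearMap.sub_apply, this, sub_self]

instance finite_weylGroup : Finite P.weylGroup := by
  refine Finite.of_injective (fun v : P.weylGroup => fun i : ι => v • i) fun u v h => ?_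
  rw [← inv_mul_eq_one]
  refine weylGroup_eq_one_of_smul_index fun i => ?_
  have := congrFun h i
  simp only at this
  rw [mul_smul, ← this, inv_smul_smul]

/-- The group fixes a point of the facet, so the linear part of an element determines its
translation part, and the finite Weyl group has only finitely many linear parts. -/
lemma finite_stabJ [P.IsReduced] {J : Set (ι × ℤ)} (hne : (alcoveFace b J).Nonempty) :
    Finite (stabJ P J) := by
  obtain ⟨x, hx⟩ := hne
  refine Finite.of_injective (fun v : stabJ P J => v.1.right) fun u v h => ?_
  apply Subtype.ext
  refine SemidirectProduct.ext ?_ h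
  have h1 := affPt_of_mem_stabJ hx.2.1 u.2
  have h2 := affPt_of_mem_stabJ hx.2.1 v.2
  have h3 : linPart u.1 x = linPart v.1 x := by
    simp only [linPart]; rw [show u.1.right = v.1.right from h]
  have h4 : (1 : ℝ) ⊗ₜ[ℤ] u.1.left.toAdd = (1 : ℝ) ⊗ₜ[ℤ] v.1.left.toAdd := by
    rw [affPt] at h1 h2
    rw [h3] at h1
    exact add_right_cancel (h1.trans h2.symm)
  exact Multiplicative.toAdd.injective (one_tmul_injective P h4)

/-- A central element conjugates every affine reflection to itself. A reflection determines its root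
only up to sign, so translation parts are compared at two levels: k = 0 shows that the translation
is orthogonal to the coroots, and k = 1 that the linear part fixes each root. -/
lemma affAct_of_mem_center {z : ExtWeyl P} (hz : z ∈ Subgroup.center (ExtWeyl P)) (a : ι × ℤ) :
    affAct z a = a := by
  have h1 (a : ι × ℤ) : affRefl P (affAct z a) = affRefl P a := by
    rw [← conj_affRefl, mul_inv_eq_iff_eq_mul]
    exact ((Subgroup.mem_center_iff.mp hz) _).symm
  have h2 (i : ι) (k : ℤ) : (k - P.toLinearMap z.left.toAdd (P.coroot (z.right • i))) •
      P.root (z.right • i) = k • P.root i := by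
    have := congrArg (fun w => Multiplicative.toAdd w.left) (h1 (i, k))
    simpa only [affRefl, affAct, toAdd_ofAdd, neg_smul, neg_inj] using this
  have h3 (i : ι) : P.toLinearMap z.left.toAdd (P.coroot (z.right • i)) = 0 := by
    have := congrArg (fun x => P.toLinearMap x (P.coroot (z.right • i))) (h2 i 0)
    simpa using this
  have h4 (i : ι) : z.right • i = i := by
    have := h2 i 1
    rw [h3, sub_zero, one_smul, one_smul] at this
    exact P.root.injective this
  ext
  · exact h4 _
  · simp only [affAct, h3, sub_zero]

lemma right_eq_one_of_affAct {z : ExtWeyl P} (hz : ∀ a, affAct z a = a) : z.right = 1 :=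
  weylGroup_eq_one_of_smul_index fun i => congrArg Prod.fst (hz (i, 0))

/-- The linear part is trivial, and the translation is orthogonal to all coroots, hence fixed by the
Weyl group. With `affAct_of_mem_center`, the centre is exactly the kernel of the action on affine
roots. -/
lemma mem_center_of_affAct {z : ExtWeyl P} (hz : ∀ a, affAct z a = a) :
    z ∈ Subgroup.center (ExtWeyl P) := by
  have h1 := right_eq_one_of_affAct hz
  have h2 (i : ι) : P.toLinearMap z.left.toAdd (P.coroot i) = 0 := by
    have := congrArg Prod.snd (hz (i, 0))
    simpa [affAct, h1] using this
  have h3 (v : P.weylGroup) : v • z.left.toAdd = z.left.toAdd := by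
    rw [← sub_eq_zero]
    refine eq_zero_of_mem_rootSpan (smul_sub_mem_rootSpan v _) fun i => ?_
    have := pairing_smul v z.left.toAdd (v⁻¹ • i)
    rw [smul_inv_smul, h2] at this
    rw [map_sub, LinearMap.sub_apply, this, h2, sub_zero]
  rw [Subgroup.mem_center_iff]
  intro w
  refine SemidirectProduct.ext ?_ (by simp [h1])
  apply Multiplicative.toAdd.injective
  simp [h1, h3, add_comm]

lemma mem_center_of_affAct_simple {z : ExtWeyl P} (hz : ∀ a ∈ simpleAff b, affAct z a = a) :
    z ∈ Subgroup.center (ExtWeyl P) := by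
  have h1 (i : ι) (hi : i ∈ b.support) : z.right • i = i :=
    congrArg Prod.fst (hz (i, 0) (zero_mem_simpleAff hi))
  have h2 (i : ι) (hi : i ∈ b.support) : P.toLinearMap z.left.toAdd (P.coroot i) = 0 := by
    have := congrArg Prod.snd (hz (i, 0) (zero_mem_simpleAff hi))
    simpa [affAct, h1 i hi] using this
  have h3 (i : ι) : z.right • i = i := by
    refine smul_index_of_smul_root ?_
    have h := b.root_mem_span_int i
    generalize P.root i = x at h
    induction h using Submodule.span_induction with
    | mem x hx =>
      obtain ⟨j, hj, rfl⟩ := hx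
      rw [show z.right • P.root j = P.root (z.right • j) from P.weylGroup_apply_root _ j, h1 j hj]
    | zero => simp
    | add x y _ _ hx hy => rw [smul_add, hx, hy]
    | smul a x _ hx => rw [smul_comm, hx]
  have h4 (i : ι) : P.toLinearMap z.left.toAdd (P.coroot i) = 0 := by
    have h := b.coroot_mem_span_int i
    generalize P.coroot i = x at h
    induction h using Submodule.span_induction with
    | mem x hx => obtain ⟨j, hj, rfl⟩ := hx; exact h2 j hj
    | zero => simp
    | add x y _ _ hx hy => simp [hx, hy]
    | smul a x _ hx => simp [hx]
  refine mem_center_of_affAct fun a => ?_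
  ext
  · exact h3 _
  · simp only [affAct, h4, sub_zero]

lemma mem_Omega_of_mem_center {z : ExtWeyl P} (hz : z ∈ Subgroup.center (ExtWeyl P)) :
    z ∈ Omega b := by
  rw [mem_Omega_iff]
  intro a ha
  rwa [affAct_of_mem_center hz]

end Length

end

end AffineHecke

namespace AffineHecke

noncomputable section

set_option linter.unusedSectionVars false

/-! ### The regular representation and the basis T_w -/

section HeckeBasis

variable {ι X Y : Type*} [Finite ι] [AddCommGroup X] [AddCommGroup Y] {P : RootDatum ι X Y}
  [P.IsReduced] {b : P.Base} {q : ExtWeyl P → ℝ}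

lemma IsParameter.mul_affRefl (hq : IsParameter b q) {a : ι × ℤ} (ha : a ∈ simpleAff b)
    {w : ExtWeyl P} (h : affAct w a ∈ posAff b) : q (w * affRefl P a) = q w * q (affRefl P a) :=
  hq.mul _ _ (by rw [length_mul_affRefl ha h, length_affRefl ha])

lemma IsParameter.affRefl_mul (hq : IsParameter b q) {a : ι × ℤ} (ha : a ∈ simpleAff b)
    {w : ExtWeyl P} (h : affAct w⁻¹ a ∈ posAff b) :
    q (affRefl P a * w) = q (affRefl P a) * q w :=
  hq.mul _ _ (by rw [length_affRefl_mul ha h, length_affRefl ha, add_comm])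

lemma affRefl_mul_eq {a c : ι × ℤ} {w : ExtWeyl P} (h : affAct w c = a) :
    affRefl P a * w = w * affRefl P c := by
  rw [← h, ← conj_affRefl, inv_mul_cancel_right]

lemma IsParameter.affRefl_eq (hq : IsParameter b q) {a c : ι × ℤ} (ha : a ∈ simpleAff b)
    (hc : c ∈ simpleAff b) {w : ExtWeyl P} (h : affAct w c = a) :
    q (affRefl P a) = q (affRefl P c) := by
  have h1 := hq.mul_affRefl (w := w) hc (h ▸ simpleAff_subset_posAff ha)
  have h2 := hq.affRefl_mul (w := w) ha (by
    rw [← h, affAct_inv_affAct]; exact simpleAff_subset_posAff hc)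
  rw [affRefl_mul_eq h, h1, mul_comm] at h2
  exact (mul_right_cancel₀ (hq.pos w).ne' h2).symm

open Classical in
/-- Left multiplication by `T_{s_a}` on the free vector space on `W`. -/
def leftOp (b : P.Base) (q : ExtWeyl P → ℝ) (a : ι × ℤ) :
    (ExtWeyl P →₀ ℂ) →ₗ[ℂ] (ExtWeyl P →₀ ℂ) :=
  Finsupp.linearCombination ℂ fun w => if affAct w⁻¹ a ∈ posAff b then
      Finsupp.single (affRefl P a * w) 1
    else (q (affRefl P a) : ℂ) • Finsupp.single (affRefl P a * w) 1 +
      ((q (affRefl P a) : ℂ) - 1) • Finsupp.single w 1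

open Classical in
/-- Right multiplication by `T_{s_a}` on the free vector space on `W`. -/
def rightOp (b : P.Base) (q : ExtWeyl P → ℝ) (a : ι × ℤ) :
    (ExtWeyl P →₀ ℂ) →ₗ[ℂ] (ExtWeyl P →₀ ℂ) :=
  Finsupp.linearCombination ℂ fun w => if affAct w a ∈ posAff b then
      Finsupp.single (w * affRefl P a) 1
    else (q (affRefl P a) : ℂ) • Finsupp.single (w * affRefl P a) 1 +
      ((q (affRefl P a) : ℂ) - 1) • Finsupp.single w 1

lemma leftOp_of_mem {a : ι × ℤ} {w : ExtWeyl P} (h : affAct w⁻¹ a ∈ posAff b) :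
    leftOp b q a (Finsupp.single w 1) = Finsupp.single (affRefl P a * w) 1 := by
  simp [leftOp, h]

lemma leftOp_of_notMem {a : ι × ℤ} {w : ExtWeyl P} (h : affAct w⁻¹ a ∉ posAff b) :
    leftOp b q a (Finsupp.single w 1) =
      (q (affRefl P a) : ℂ) • Finsupp.single (affRefl P a * w) 1 +
      ((q (affRefl P a) : ℂ) - 1) • Finsupp.single w 1 := by
  simp only [leftOp, Finsupp.linearCombination_single, if_neg h, one_smul]

lemma rightOp_of_mem {a : ι × ℤ} {w : ExtWeyl P} (h : affAct w a ∈ posAff b) :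
    rightOp b q a (Finsupp.single w 1) = Finsupp.single (w * affRefl P a) 1 := by
  simp [rightOp, h]

lemma rightOp_of_notMem {a : ι × ℤ} {w : ExtWeyl P} (h : affAct w a ∉ posAff b) :
    rightOp b q a (Finsupp.single w 1) =
      (q (affRefl P a) : ℂ) • Finsupp.single (w * affRefl P a) 1 +
      ((q (affRefl P a) : ℂ) - 1) • Finsupp.single w 1 := by
  simp only [rightOp, Finsupp.linearCombination_single, if_neg h, one_smul]

lemma affAct_affRefl_mem_iff {c β : ι × ℤ} (hc : c ∈ simpleAff b) (h1 : β ≠ c)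
    (h2 : β ≠ negRoot P c) : affAct (affRefl P c) β ∈ posAff b ↔ β ∈ posAff b := by
  refine ⟨fun h => ?_, fun h => affAct_affRefl_mem hc h h1⟩
  have := affAct_affRefl_mem hc h (fun h3 => h2 (by
    rw [← affAct_affRefl_self, ← affAct_one P β, ← affRefl_mul_self c, affAct_mul, h3]))
  rwa [← affAct_mul, affRefl_mul_self, affAct_one] at this

/-- The left and the right operators of simple reflections commute. -/
lemma leftOp_rightOp (hq : IsParameter b q) {a c : ι × ℤ} (ha : a ∈ simpleAff b)
    (hc : c ∈ simpleAff b) : leftOp b q a ∘ₗ rightOp b q c = rightOp b q c ∘ₗ leftOp b q a := by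
  refine Finsupp.lhom_ext' fun w => LinearMap.ext_ring ?_
  simp only [LinearMap.comp_apply, Finsupp.lsingle_apply]
  have hap := simpleAff_subset_posAff ha
  have hcp := simpleAff_subset_posAff hc
  have hL : affAct (w * affRefl P c)⁻¹ a = affAct (affRefl P c) (affAct w⁻¹ a) := by
    rw [mul_inv_rev, affRefl_inv, affAct_mul]
  have hR : affAct (affRefl P a * w) c = affAct (affRefl P a) (affAct w c) := affAct_mul _ _ _
  -- Left multiplication by s_a affects the right descent condition at c only if w c = ± a, and then
  -- s_a w = w s_c. In these two cases equality of the parameters of s_a and s_c is needed; in all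
  -- others the two operators act independently.
  by_cases h1 : affAct w c = a
  · have h2 : affAct w⁻¹ a = c := by rw [← h1, affAct_inv_affAct]
    have h3 := affRefl_mul_eq h1
    have hq' := hq.affRefl_eq ha hc h1
    have h4 : affAct (w * affRefl P c)⁻¹ a ∉ posAff b := by
      rw [hL, h2]; exact affAct_affRefl_self_notMem hc
    have h5 : affAct (affRefl P a * w) c ∉ posAff b := by
      rw [hR, h1]; exact affAct_affRefl_self_notMem ha
    rw [rightOp_of_mem (by rwa [h1]), leftOp_of_mem (w := w) (by rwa [h2]), leftOp_of_notMem h4,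
      rightOp_of_notMem h5, h3, hq', ← mul_assoc, h3]
  by_cases h1' : affAct w c = negRoot P a
  · have h2 : affAct w⁻¹ a = negRoot P c := by
      rw [← negRoot_negRoot (P := P) a, ← h1', affAct_negRoot, affAct_inv_affAct]
    have h0 : affAct (w * affRefl P c) c = a := by
      rw [affAct_mul, affAct_affRefl_self, affAct_negRoot, h1', negRoot_negRoot]
    have hq' := hq.affRefl_eq ha hc h0
    have h3 : affRefl P a * w = w * affRefl P c := by
      have := affRefl_mul_eq h0
      rw [affRefl_mul_cancel_right] at this
      conv_lhs => rw [← this]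
      exact affRefl_mul_cancel_left a _
    have h4 : affAct w c ∉ posAff b := by
      rw [h1', negRoot_mem_iff]; exact not_not_intro hap
    have h5 : affAct w⁻¹ a ∉ posAff b := by
      rw [h2, negRoot_mem_iff]; exact not_not_intro hcp
    have h6 : affAct (w * affRefl P c)⁻¹ a ∈ posAff b := by
      rw [hL, h2, affAct_negRoot, affAct_affRefl_self, negRoot_negRoot]; exact hcp
    have h7 : affAct (affRefl P a * w) c ∈ posAff b := by
      rw [hR, h1', affAct_negRoot, affAct_affRefl_self, negRoot_negRoot]; exact hap
    rw [rightOp_of_notMem h4, leftOp_of_notMem h5]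
    simp only [map_add, map_smul]
    rw [rightOp_of_notMem h4, leftOp_of_notMem h5, leftOp_of_mem h6, rightOp_of_mem h7, hq', h3,
      ← mul_assoc, h3]
  · have h2 : affAct w⁻¹ a ≠ c := fun h => h1 (by rw [← h, affAct_affAct_inv])
    have h2' : affAct w⁻¹ a ≠ negRoot P c := fun h => h1' (by
      rw [← negRoot_negRoot (P := P) c, ← h, affAct_negRoot, affAct_affAct_inv])
    have h3 := affAct_affRefl_mem_iff hc h2 h2'
    have h4 := affAct_affRefl_mem_iff ha h1 h1'
    rw [← hL] at h3
    rw [← hR] at h4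
    by_cases h5 : affAct w⁻¹ a ∈ posAff b <;> by_cases h6 : affAct w c ∈ posAff b
    · rw [rightOp_of_mem h6, leftOp_of_mem h5, rightOp_of_mem (h4.mpr h6),
        leftOp_of_mem (h3.mpr h5), mul_assoc]
    · rw [rightOp_of_notMem h6, leftOp_of_mem h5]
      simp only [map_add, map_smul]
      rw [rightOp_of_notMem (h4.not.mpr h6), leftOp_of_mem (h3.mpr h5), leftOp_of_mem h5, mul_assoc]
    · rw [rightOp_of_mem h6, leftOp_of_notMem h5]
      simp only [map_add, map_smul]
      rw [rightOp_of_mem (h4.mpr h6), leftOp_of_notMem (h3.not.mpr h5), rightOp_of_mem h6,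
        mul_assoc]
    · rw [rightOp_of_notMem h6, leftOp_of_notMem h5]
      simp only [map_add, map_smul]
      rw [rightOp_of_notMem (h4.not.mpr h6), leftOp_of_notMem (h3.not.mpr h5),
        rightOp_of_notMem h6, leftOp_of_notMem h5, mul_assoc]
      module

/-- Left translation by an element of `W`. -/
def leftTrans (u : ExtWeyl P) : (ExtWeyl P →₀ ℂ) →ₗ[ℂ] (ExtWeyl P →₀ ℂ) :=
  Finsupp.lmapDomain ℂ ℂ (u * ·)

/-- Right translation by an element of `W`. -/
def rightTrans (u : ExtWeyl P) : (ExtWeyl P →₀ ℂ) →ₗ[ℂ] (ExtWeyl P →₀ ℂ) :=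
  Finsupp.lmapDomain ℂ ℂ (· * u)

@[simp] lemma leftTrans_single (u w : ExtWeyl P) :
    leftTrans u (Finsupp.single w 1) = Finsupp.single (u * w) 1 := by simp [leftTrans]

@[simp] lemma rightTrans_single (u w : ExtWeyl P) :
    rightTrans u (Finsupp.single w 1) = Finsupp.single (w * u) 1 := by simp [rightTrans]

lemma leftOp_rightTrans {u : ExtWeyl P} (hu : u ∈ Omega b) (a : ι × ℤ) :
    leftOp b q a ∘ₗ rightTrans u = rightTrans u ∘ₗ leftOp b q a := by
  refine Finsupp.lhom_ext' fun w => LinearMap.ext_ring ?_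
  simp only [LinearMap.comp_apply, Finsupp.lsingle_apply, rightTrans_single]
  have h : affAct (w * u)⁻¹ a ∈ posAff b ↔ affAct w⁻¹ a ∈ posAff b := by
    rw [mul_inv_rev, affAct_mul, affAct_mem_iff (inv_mem_Omega hu)]
  by_cases h1 : affAct w⁻¹ a ∈ posAff b
  · rw [leftOp_of_mem h1, leftOp_of_mem (h.mpr h1), rightTrans_single, mul_assoc]
  · rw [leftOp_of_notMem h1, leftOp_of_notMem (h.not.mpr h1), map_add, map_smul, map_smul,
      rightTrans_single, rightTrans_single, mul_assoc]

lemma leftTrans_rightOp {u : ExtWeyl P} (hu : u ∈ Omega b) (a : ι × ℤ) :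
    leftTrans u ∘ₗ rightOp b q a = rightOp b q a ∘ₗ leftTrans u := by
  refine Finsupp.lhom_ext' fun w => LinearMap.ext_ring ?_
  simp only [LinearMap.comp_apply, Finsupp.lsingle_apply, leftTrans_single]
  have h : affAct (u * w) a ∈ posAff b ↔ affAct w a ∈ posAff b := by
    rw [affAct_mul, affAct_mem_iff hu]
  by_cases h1 : affAct w a ∈ posAff b
  · rw [rightOp_of_mem h1, rightOp_of_mem (h.mpr h1), leftTrans_single, mul_assoc]
  · rw [rightOp_of_notMem h1, rightOp_of_notMem (h.not.mpr h1), map_add, map_smul, map_smul,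
      leftTrans_single, leftTrans_single, mul_assoc]

lemma leftTrans_rightTrans (u v : ExtWeyl P) :
    leftTrans u ∘ₗ rightTrans v = rightTrans v ∘ₗ leftTrans (P := P) u := by
  refine Finsupp.lhom_ext' fun w => LinearMap.ext_ring ?_
  simp [mul_assoc]

/-- The operators that commute with all right operators. -/
def CommutesRight (b : P.Base) (q : ExtWeyl P → ℝ)
    (A : (ExtWeyl P →₀ ℂ) →ₗ[ℂ] (ExtWeyl P →₀ ℂ)) : Prop :=
  (∀ c ∈ simpleAff b, A ∘ₗ rightOp b q c = rightOp b q c ∘ₗ A) ∧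
    ∀ u ∈ Omega b, A ∘ₗ rightTrans u = rightTrans u ∘ₗ A

lemma CommutesRight.comp {A B : (ExtWeyl P →₀ ℂ) →ₗ[ℂ] (ExtWeyl P →₀ ℂ)}
    (hA : CommutesRight b q A) (hB : CommutesRight b q B) : CommutesRight b q (A ∘ₗ B) := by
  constructor
  · intro c hc
    rw [LinearMap.comp_assoc, hB.1 c hc, ← LinearMap.comp_assoc, hA.1 c hc, LinearMap.comp_assoc]
  · intro c hc
    rw [LinearMap.comp_assoc, hB.2 c hc, ← LinearMap.comp_assoc, hA.2 c hc, LinearMap.comp_assoc]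

lemma CommutesRight.add {A B : (ExtWeyl P →₀ ℂ) →ₗ[ℂ] (ExtWeyl P →₀ ℂ)}
    (hA : CommutesRight b q A) (hB : CommutesRight b q B) : CommutesRight b q (A + B) :=
  ⟨fun c hc => by rw [LinearMap.add_comp, LinearMap.comp_add, hA.1 c hc, hB.1 c hc],
    fun c hc => by rw [LinearMap.add_comp, LinearMap.comp_add, hA.2 c hc, hB.2 c hc]⟩

lemma CommutesRight.smul {A : (ExtWeyl P →₀ ℂ) →ₗ[ℂ] (ExtWeyl P →₀ ℂ)}
    (hA : CommutesRight b q A) (r : ℂ) : CommutesRight b q (r • A) :=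
  ⟨fun c hc => by rw [LinearMap.smul_comp, LinearMap.comp_smul, hA.1 c hc],
    fun c hc => by rw [LinearMap.smul_comp, LinearMap.comp_smul, hA.2 c hc]⟩

/-- Right operators produce every basis vector from the vector of 1 along a reduced word. An
operator that commutes with them is therefore known from a single value, and this replaces any check
that a construction does not depend on the reduced word. -/
lemma CommutesRight.ext {A B : (ExtWeyl P →₀ ℂ) →ₗ[ℂ] (ExtWeyl P →₀ ℂ)}
    (hA : CommutesRight b q A) (hB : CommutesRight b q B)
    (h : A (Finsupp.single 1 1) = B (Finsupp.single 1 1)) : A = B := by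
  have key (n : ℕ) : ∀ w : ExtWeyl P, length b w = n →
      A (Finsupp.single w 1) = B (Finsupp.single w 1) := by
    induction n with
    | zero =>
      intro w hw
      have h1 := rightTrans_single w (1 : ExtWeyl P)
      rw [one_mul] at h1
      have h2 := LinearMap.congr_fun (hA.2 w hw) (Finsupp.single 1 1)
      have h3 := LinearMap.congr_fun (hB.2 w hw) (Finsupp.single 1 1)
      simp only [LinearMap.comp_apply, h1] at h2 h3
      rw [h2, h3, h]
    | succ n ih =>
      intro w hw
      obtain ⟨c, hc, hwc⟩ := exists_descent (b := b) (w := w) (by omega)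
      have h0 := length_mul_affRefl_of_notMem hc hwc
      have h1 := rightOp_of_mem (q := q) ((affAct_mul_affRefl w c).mpr hwc)
      rw [affRefl_mul_cancel_right] at h1
      have h2 := LinearMap.congr_fun (hA.1 c hc) (Finsupp.single (w * affRefl P c) 1)
      have h3 := LinearMap.congr_fun (hB.1 c hc) (Finsupp.single (w * affRefl P c) 1)
      simp only [LinearMap.comp_apply, h1] at h2 h3
      rw [h2, h3, ih _ (by omega)]
  refine Finsupp.lhom_ext' fun w => LinearMap.ext_ring ?_
  exact key _ w rfl

lemma commutesRight_leftOp (hq : IsParameter b q) {a : ι × ℤ} (ha : a ∈ simpleAff b) :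
    CommutesRight b q (leftOp b q a) :=
  ⟨fun _ hc => leftOp_rightOp hq ha hc, fun _ hu => leftOp_rightTrans hu a⟩

/-- Compose left operators along some reduced word of w, ending with translation by an element of Ω.
Uniqueness is supplied by `CommutesRight.ext`. -/
lemma exists_leftMul (hq : IsParameter b q) (w : ExtWeyl P) :
    ∃ A : (ExtWeyl P →₀ ℂ) →ₗ[ℂ] (ExtWeyl P →₀ ℂ), CommutesRight b q A ∧
      ∀ v, length b (w * v) = length b w + length b v →
        A (Finsupp.single v 1) = Finsupp.single (w * v) 1 := by
  induction hn : length b w generalizing w with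
  | zero =>
    exact ⟨leftTrans w, ⟨fun c _ => leftTrans_rightOp hn c, fun u _ => leftTrans_rightTrans w u⟩,
      fun v _ => leftTrans_single w v⟩
  | succ n ih =>
    obtain ⟨a, ha, hwa⟩ := exists_descent (b := b) (w := w⁻¹) (by rw [length_inv]; omega)
    have h1 := length_affRefl_mul_of_notMem ha hwa
    obtain ⟨A, hA, hAv⟩ := ih (affRefl P a * w) (by omega)
    refine ⟨leftOp b q a ∘ₗ A, (commutesRight_leftOp hq ha).comp hA, fun v hv => ?_⟩
    -- Subadditivity squeezes the length of s_a w v between two equal bounds. Hence lengths add for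
    -- s_a w and v as well, and s_a lengthens s_a w v.
    have h2 := length_mul_le (b := b) (affRefl P a) (affRefl P a * (w * v))
    rw [affRefl_mul_cancel_left, length_affRefl ha] at h2
    have h3 := length_mul_le (b := b) (affRefl P a * w) v
    rw [mul_assoc] at h3
    have h4 : affAct (affRefl P a * (w * v))⁻¹ a ∈ posAff b := by
      by_contra hcon
      have h5 := length_affRefl_mul_of_notMem ha hcon
      rw [affRefl_mul_cancel_left] at h5
      omega
    rw [LinearMap.comp_apply, hAv v (by rw [mul_assoc]; omega), mul_assoc, leftOp_of_mem h4,
      affRefl_mul_cancel_left]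

/-- The action of `T_w` on the free vector space on `W`. -/
def leftMul (hq : IsParameter b q) (w : ExtWeyl P) : (ExtWeyl P →₀ ℂ) →ₗ[ℂ] (ExtWeyl P →₀ ℂ) :=
  (exists_leftMul hq w).choose

lemma commutesRight_leftMul (hq : IsParameter b q) (w : ExtWeyl P) :
    CommutesRight b q (leftMul hq w) := (exists_leftMul hq w).choose_spec.1

lemma leftMul_single (hq : IsParameter b q) {w v : ExtWeyl P}
    (h : length b (w * v) = length b w + length b v) :
    leftMul hq w (Finsupp.single v 1) = Finsupp.single (w * v) 1 :=
  (exists_leftMul hq w).choose_spec.2 v h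

lemma leftMul_single_one (hq : IsParameter b q) (w : ExtWeyl P) :
    leftMul hq w (Finsupp.single 1 1) = Finsupp.single w 1 := by
  rw [leftMul_single hq (by rw [mul_one, length_one, add_zero]), mul_one]

lemma leftMul_affRefl (hq : IsParameter b q) {a : ι × ℤ} (ha : a ∈ simpleAff b) :
    leftMul hq (affRefl P a) = leftOp b q a := by
  refine (commutesRight_leftMul hq _).ext (commutesRight_leftOp hq ha) ?_
  rw [leftMul_single_one, leftOp_of_mem, mul_one]
  rw [inv_one, affAct_one]
  exact simpleAff_subset_posAff ha

/-- The regular representation of the affine Hecke algebra. -/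
def heckeRep (hq : IsParameter b q) : Hecke b q →ₐ[ℂ] Module.End ℂ (ExtWeyl P →₀ ℂ) :=
  RingQuot.liftAlgHom ℂ ⟨FreeAlgebra.lift ℂ (leftMul hq), by
    intro x y h
    -- Both sides of a relation commute with the right operators, so each relation only needs to be
    -- tested on the vector of 1.
    induction h with
    | one =>
      rw [FreeAlgebra.lift_ι_apply, map_one]
      refine (commutesRight_leftMul hq 1).ext ⟨fun _ _ => rfl, fun _ _ => rfl⟩ ?_
      rw [leftMul_single_one]; rfl
    | mul w v h =>
      rw [map_mul, FreeAlgebra.lift_ι_apply, FreeAlgebra.lift_ι_apply, FreeAlgebra.lift_ι_apply]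
      refine ((commutesRight_leftMul hq w).comp (commutesRight_leftMul hq v)).ext
        (commutesRight_leftMul hq _) ?_
      rw [LinearMap.comp_apply, leftMul_single_one, leftMul_single_one, leftMul_single hq h]
    | sq a ha =>
      simp only [map_mul, map_add, map_smul, FreeAlgebra.lift_ι_apply]
      refine ((commutesRight_leftMul hq _).comp (commutesRight_leftMul hq _)).ext
        (((commutesRight_leftMul hq _).smul _).add ((commutesRight_leftMul hq _).smul _)) ?_
      rw [LinearMap.comp_apply, LinearMap.add_apply, LinearMap.smul_apply, LinearMap.smul_apply,
        leftMul_single_one, leftMul_single_one, leftMul_affRefl hq ha, leftOp_of_notMem,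
        affRefl_mul_self, add_comm]
      rw [affRefl_inv]
      exact affAct_affRefl_self_notMem ha⟩

lemma heckeRep_T (hq : IsParameter b q) (w : ExtWeyl P) :
    heckeRep hq (T b q w) = leftMul hq w := by
  exact (RingQuot.liftAlgHom_mkAlgHom_apply ℂ _ _ _).trans (FreeAlgebra.lift_ι_apply _ _)

/-- Applied to the vector of 1, the operator of T_w gives the basis vector of w. -/
lemma linearIndependent_T (hq : IsParameter b q) : LinearIndependent ℂ (T b q) := by
  refine LinearIndependent.of_comp
    ((LinearMap.applyₗ (Finsupp.single (1 : ExtWeyl P) (1 : ℂ))).comp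
      (heckeRep hq).toLinearMap) ?_
  have : ((LinearMap.applyₗ (Finsupp.single (1 : ExtWeyl P) (1 : ℂ))).comp
      (heckeRep hq).toLinearMap) ∘ T b q = fun w => Finsupp.single w (1 : ℂ) := by
    funext w
    simp [heckeRep_T, leftMul_single_one]
  rw [this]
  exact Finsupp.linearIndependent_single_one ℂ _

/-! #### Multiplication rules -/

lemma T_affRefl_sq {a : ι × ℤ} (ha : a ∈ simpleAff b) :
    T b q (affRefl P a) * T b q (affRefl P a) =
      ((q (affRefl P a) : ℂ) - 1) • T b q (affRefl P a) + (q (affRefl P a) : ℂ) • 1 := by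
  have := RingQuot.mkAlgHom_rel ℂ (HeckeRel.sq (b := b) (q := q) a ha)
  rw [map_mul, map_add, map_smul, map_smul] at this
  exact this.trans (by rw [← T_one b q]; rfl)

lemma T_affRefl_mul {a : ι × ℤ} (ha : a ∈ simpleAff b) {w : ExtWeyl P}
    (h : affAct w⁻¹ a ∈ posAff b) :
    T b q (affRefl P a) * T b q w = T b q (affRefl P a * w) :=
  T_mul b q (by rw [length_affRefl_mul ha h, length_affRefl ha, add_comm])

lemma T_mul_affRefl {a : ι × ℤ} (ha : a ∈ simpleAff b) {w : ExtWeyl P}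
    (h : affAct w a ∈ posAff b) :
    T b q w * T b q (affRefl P a) = T b q (w * affRefl P a) :=
  T_mul b q (by rw [length_mul_affRefl ha h, length_affRefl ha])

lemma affAct_affRefl_mul_inv (w : ExtWeyl P) (a : ι × ℤ) :
    affAct (affRefl P a * w)⁻¹ a ∈ posAff b ↔ affAct w⁻¹ a ∉ posAff b := by
  rw [mul_inv_rev, affRefl_inv, affAct_mul_affRefl]

lemma T_affRefl_mul_of_notMem {a : ι × ℤ} (ha : a ∈ simpleAff b) {w : ExtWeyl P}
    (h : affAct w⁻¹ a ∉ posAff b) :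
    T b q (affRefl P a) * T b q w = (q (affRefl P a) : ℂ) • T b q (affRefl P a * w) +
      ((q (affRefl P a) : ℂ) - 1) • T b q w := by
  have h1 := T_affRefl_mul (q := q) ha ((affAct_affRefl_mul_inv w a).mpr h)
  rw [affRefl_mul_cancel_left] at h1
  rw [← h1, ← mul_assoc, T_affRefl_sq ha, add_mul, smul_mul_assoc, smul_mul_assoc, one_mul,
    add_comm]

lemma T_mul_affRefl_of_notMem {a : ι × ℤ} (ha : a ∈ simpleAff b) {w : ExtWeyl P}
    (h : affAct w a ∉ posAff b) :
    T b q w * T b q (affRefl P a) = (q (affRefl P a) : ℂ) • T b q (w * affRefl P a) +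
      ((q (affRefl P a) : ℂ) - 1) • T b q w := by
  have h1 := T_mul_affRefl (q := q) ha ((affAct_mul_affRefl w a).mpr h)
  rw [affRefl_mul_cancel_right] at h1
  rw [← h1, mul_assoc, T_affRefl_sq ha, mul_add, mul_smul_comm, mul_smul_comm, mul_one,
    add_comm]

lemma T_mul_Omega {u : ExtWeyl P} (hu : u ∈ Omega b) (w : ExtWeyl P) :
    T b q w * T b q u = T b q (w * u) :=
  T_mul b q (by rw [length_mul_Omega hu, length_Omega hu, add_zero])

lemma T_Omega_mul {u : ExtWeyl P} (hu : u ∈ Omega b) (w : ExtWeyl P) :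
    T b q u * T b q w = T b q (u * w) :=
  T_mul b q (by rw [length_Omega_mul hu, length_Omega hu, zero_add])

lemma T_affRefl_mul_mem_span {a : ι × ℤ} (ha : a ∈ simpleAff b) {A : Set (ExtWeyl P)}
    (hA : ∀ w ∈ A, affRefl P a * w ∈ A) {h : Hecke b q} (hh : h ∈ Submodule.span ℂ (T b q '' A)) :
    T b q (affRefl P a) * h ∈ Submodule.span ℂ (T b q '' A) := by
  induction hh using Submodule.span_induction with
  | mem x hx =>
    obtain ⟨w, hw, rfl⟩ := hx
    have h1 : T b q (affRefl P a * w) ∈ Submodule.span ℂ (T b q '' A) :=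
      Submodule.subset_span ⟨_, hA w hw, rfl⟩
    by_cases h : affAct w⁻¹ a ∈ posAff b
    · rwa [T_affRefl_mul ha h]
    · rw [T_affRefl_mul_of_notMem ha h]
      exact add_mem (Submodule.smul_mem _ _ h1)
        (Submodule.smul_mem _ _ (Submodule.subset_span ⟨w, hw, rfl⟩))
  | zero => rw [mul_zero]; exact zero_mem _
  | add x y _ _ hx hy => rw [mul_add]; exact add_mem hx hy
  | smul r x _ hx => rw [mul_smul_comm]; exact Submodule.smul_mem _ _ hx

lemma T_mul_affRefl_mem_span {a : ι × ℤ} (ha : a ∈ simpleAff b) {A : Set (ExtWeyl P)}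
    (hA : ∀ w ∈ A, w * affRefl P a ∈ A) {h : Hecke b q} (hh : h ∈ Submodule.span ℂ (T b q '' A)) :
    h * T b q (affRefl P a) ∈ Submodule.span ℂ (T b q '' A) := by
  induction hh using Submodule.span_induction with
  | mem x hx =>
    obtain ⟨w, hw, rfl⟩ := hx
    have h1 : T b q (w * affRefl P a) ∈ Submodule.span ℂ (T b q '' A) :=
      Submodule.subset_span ⟨_, hA w hw, rfl⟩
    by_cases h : affAct w a ∈ posAff b
    · rwa [T_mul_affRefl ha h]
    · rw [T_mul_affRefl_of_notMem ha h]
      exact add_mem (Submodule.smul_mem _ _ h1)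
        (Submodule.smul_mem _ _ (Submodule.subset_span ⟨w, hw, rfl⟩))
  | zero => rw [zero_mul]; exact zero_mem _
  | add x y _ _ hx hy => rw [add_mul]; exact add_mem hx hy
  | smul r x _ hx => rw [smul_mul_assoc]; exact Submodule.smul_mem _ _ hx

lemma T_mul_mem_span (v : ExtWeyl P) {h : Hecke b q} (hh : h ∈ Submodule.span ℂ (Set.range (T b q))) :
    T b q v * h ∈ Submodule.span ℂ (Set.range (T b q)) := by
  induction hn : length b v generalizing v with
  | zero =>
    induction hh using Submodule.span_induction with
    | mem x hx =>
      obtain ⟨w, rfl⟩ := hx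
      rw [T_Omega_mul hn]
      exact Submodule.subset_span ⟨_, rfl⟩
    | zero => rw [mul_zero]; exact zero_mem _
    | add x y _ _ hx hy => rw [mul_add]; exact add_mem hx hy
    | smul r x _ hx => rw [mul_smul_comm]; exact Submodule.smul_mem _ _ hx
  | succ n ih =>
    obtain ⟨a, ha, hva⟩ := exists_descent (b := b) (w := v⁻¹) (by rw [length_inv]; omega)
    have h1 := length_affRefl_mul_of_notMem ha hva
    have h2 := T_affRefl_mul (q := q) ha ((affAct_affRefl_mul_inv v a).mpr hva)
    rw [affRefl_mul_cancel_left] at h2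
    rw [← h2, mul_assoc]
    have h3 := ih (affRefl P a * v) (by omega)
    rw [← Set.image_univ] at h3 ⊢
    exact T_affRefl_mul_mem_span ha (fun _ _ => Set.mem_univ _) h3

/-- The span contains 1 and is stable under left multiplication by the generators, hence by the
whole algebra. -/
lemma span_T (b : P.Base) (q : ExtWeyl P → ℝ) : Submodule.span ℂ (Set.range (T b q)) = ⊤ := by
  rw [eq_top_iff]
  rintro h -
  obtain ⟨x, rfl⟩ := RingQuot.mkAlgHom_surjective ℂ (HeckeRel b q) h
  suffices hs : ∀ y ∈ Submodule.span ℂ (Set.range (T b q)),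
      (show Hecke b q from RingQuot.mkAlgHom ℂ (HeckeRel b q) x) * y ∈
        Submodule.span ℂ (Set.range (T b q)) by
    have := hs 1 (Submodule.subset_span ⟨1, T_one b q⟩)
    rwa [mul_one] at this
  induction x using FreeAlgebra.induction with
  | grade0 r =>
    intro y hy
    rw [AlgHom.commutes]
    exact (Algebra.smul_def r y) ▸ Submodule.smul_mem _ r hy
  | grade1 w => exact fun y hy => T_mul_mem_span w hy
  | mul u v hu hv =>
    intro y hy
    rw [map_mul]
    have := hu _ (hv y hy)
    rwa [← mul_assoc] at this
  | add u v hu hv =>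
    intro y hy
    rw [map_add]
    have := add_mem (hu y hy) (hv y hy)
    rwa [← add_mul] at this

/-- The basis `T_w` of the affine Hecke algebra. -/
def basisT (hq : IsParameter b q) : Module.Basis (ExtWeyl P) ℂ (Hecke b q) :=
  Module.Basis.mk (linearIndependent_T hq) (span_T b q).ge

@[simp] lemma basisT_apply (hq : IsParameter b q) (w : ExtWeyl P) : basisT hq w = T b q w := by
  simp [basisT]

lemma isUnit_T_affRefl (hq : IsParameter b q) {a : ι × ℤ} (ha : a ∈ simpleAff b) :
    IsUnit (T b q (affRefl P a)) := by
  have hq0 : (q (affRefl P a) : ℂ) ≠ 0 := by exact_mod_cast (hq.pos _).ne'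
  set t := T b q (affRefl P a)
  set r : ℂ := (q (affRefl P a) : ℂ)
  have h : t * t = (r - 1) • t + r • 1 := T_affRefl_sq ha
  have h1 : t * (t - (r - 1) • 1) = r • 1 := by
    rw [mul_sub, h, mul_smul_comm, mul_one, add_sub_cancel_left]
  have h2 : (t - (r - 1) • 1) * t = r • 1 := by
    rw [sub_mul, h, smul_mul_assoc, one_mul, add_sub_cancel_left]
  refine ⟨⟨t, r⁻¹ • (t - (r - 1) • 1), ?_, ?_⟩, rfl⟩
  · rw [mul_smul_comm, h1, inv_smul_smul₀ hq0]
  · rw [smul_mul_assoc, h2, inv_smul_smul₀ hq0]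

lemma isUnit_T (hq : IsParameter b q) (w : ExtWeyl P) : IsUnit (T b q w) := by
  induction hn : length b w generalizing w with
  | zero => exact ⟨⟨_, _, T_mul_T_inv b q hn, T_inv_mul_T b q hn⟩, rfl⟩
  | succ n ih =>
    obtain ⟨a, ha, hwa⟩ := exists_descent (b := b) (w := w⁻¹) (by rw [length_inv]; omega)
    have h1 := length_affRefl_mul_of_notMem ha hwa
    have h2 := T_affRefl_mul (q := q) ha ((affAct_affRefl_mul_inv w a).mpr hwa)
    rw [affRefl_mul_cancel_left] at h2
    rw [← h2]
    exact (isUnit_T_affRefl hq ha).mul (ih _ (by omega))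

end HeckeBasis

end

end AffineHecke

namespace AffineHecke

noncomputable section

set_option linter.unusedSectionVars false

/-! ### The groups W_J Z(W) and tensor products balanced over their algebras -/

section Cosets

variable {ι X Y : Type*} [Finite ι] [AddCommGroup X] [AddCommGroup Y] {P : RootDatum ι X Y}
  [P.IsReduced] {b : P.Base} {q : ExtWeyl P → ℝ}

/-- The subgroup `W_J Z(W)` of `W`. -/
def facetGroup (P : RootDatum ι X Y) (J : Set (ι × ℤ)) : Subgroup (ExtWeyl P) :=
  stabJ P J ⊔ Subgroup.center (ExtWeyl P)

/-- The cosets `w W_J Z(W)`. -/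
abbrev FacetCoset (P : RootDatum ι X Y) (J : Set (ι × ℤ)) : Type _ := ExtWeyl P ⧸ facetGroup P J

lemma mem_facetGroup {J : Set (ι × ℤ)} {w : ExtWeyl P} :
    w ∈ facetGroup P J ↔ ∃ v ∈ stabJ P J, ∃ z ∈ Subgroup.center (ExtWeyl P), v * z = w :=
  Subgroup.mem_sup_of_normal_right

lemma stabJ_le_facetGroup (P : RootDatum ι X Y) (J : Set (ι × ℤ)) : stabJ P J ≤ facetGroup P J :=
  le_sup_left

lemma center_le_facetGroup (P : RootDatum ι X Y) (J : Set (ι × ℤ)) :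
    Subgroup.center (ExtWeyl P) ≤ facetGroup P J := le_sup_right

lemma stabJ_mono {J J' : Set (ι × ℤ)} (h : J ⊆ J') : stabJ P J ≤ stabJ P J' :=
  Subgroup.closure_mono (Set.image_mono h)

lemma facetGroup_mono {J J' : Set (ι × ℤ)} (h : J ⊆ J') : facetGroup P J ≤ facetGroup P J' :=
  sup_le_sup_right (stabJ_mono h) _

lemma T_mem_subJ_of_stabJ {J : Set (ι × ℤ)} {v : ExtWeyl P} (hv : v ∈ stabJ P J) :
    T b q v ∈ subJ b q J :=
  (le_sup_left : _ ≤ subJ b q J) (Algebra.subset_adjoin ⟨v, hv, rfl⟩)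

lemma T_mem_subJ_of_center {J : Set (ι × ℤ)} {v : ExtWeyl P}
    (hv : v ∈ Subgroup.center (ExtWeyl P)) : T b q v ∈ subJ b q J :=
  (le_sup_right : _ ≤ subJ b q J) (Algebra.subset_adjoin ⟨v, hv, rfl⟩)

/-- The span of the `T_w`, `w ∈ A`, is stable under `H(W_J, q) ⊗ ℂ[Z(W)]` if `A` is stable under
`W_J Z(W)`. -/
lemma subJ_mul_mem_span {J : Set (ι × ℤ)} (hJ : J ⊆ simpleAff b) (hne : (alcoveFace b J).Nonempty)
    {A : Set (ExtWeyl P)} (hA : ∀ v ∈ facetGroup P J, ∀ w ∈ A, v * w ∈ A) {c : Hecke b q}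
    (hc : c ∈ subJ b q J) {h : Hecke b q} (hh : h ∈ Submodule.span ℂ (T b q '' A)) :
    c * h ∈ Submodule.span ℂ (T b q '' A) := by
  have hΩ (z : ExtWeyl P) (hz : z ∈ Omega b) (hz' : z ∈ facetGroup P J) {h : Hecke b q}
      (hh : h ∈ Submodule.span ℂ (T b q '' A)) :
      T b q z * h ∈ Submodule.span ℂ (T b q '' A) := by
    induction hh using Submodule.span_induction with
    | mem x hx =>
      obtain ⟨w, hw, rfl⟩ := hx
      rw [T_Omega_mul hz]
      exact Submodule.subset_span ⟨_, hA z hz' w hw, rfl⟩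
    | zero => rw [mul_zero]; exact zero_mem _
    | add x y _ _ hx hy => rw [mul_add]; exact add_mem hx hy
    | smul r x _ hx => rw [mul_smul_comm]; exact Submodule.smul_mem _ _ hx
  rw [subJ, ← Algebra.adjoin_union] at hc
  induction hc using Algebra.adjoin_induction generalizing h with
  | mem x hx =>
    rcases hx with ⟨v, hv, rfl⟩ | ⟨z, hz, rfl⟩
    · change v ∈ stabJ P J at hv
      induction hn : length b v generalizing v with
      | zero => exact hΩ v hn (stabJ_le_facetGroup P J hv) hh
      | succ n ih =>
        obtain ⟨a, ha, hva⟩ := exists_descent_of_mem_stabJ hJ hne (inv_mem hv) (by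
          rintro h1
          rw [inv_eq_one] at h1
          rw [h1, length_one] at hn
          omega)
        have h1 := length_affRefl_mul_of_notMem (hJ ha) hva
        have h2 := T_affRefl_mul (q := q) (hJ ha) ((affAct_affRefl_mul_inv v a).mpr hva)
        rw [affRefl_mul_cancel_left] at h2
        rw [← h2, mul_assoc]
        exact T_affRefl_mul_mem_span (hJ ha)
          (hA _ (stabJ_le_facetGroup P J (affRefl_mem_stabJ ha)))
          (ih _ (mul_mem (affRefl_mem_stabJ ha) hv) (by omega))
    · exact hΩ z (mem_Omega_of_mem_center hz) (center_le_facetGroup P J hz) hh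
  | algebraMap r =>
    rw [← Algebra.smul_def]
    exact Submodule.smul_mem _ _ hh
  | add x y _ _ hx hy => rw [add_mul]; exact add_mem (hx hh) (hy hh)
  | mul x y _ _ hx hy => rw [mul_assoc]; exact hx (hy hh)

lemma mul_subJ_mem_span {J : Set (ι × ℤ)} (hJ : J ⊆ simpleAff b) (hne : (alcoveFace b J).Nonempty)
    {A : Set (ExtWeyl P)} (hA : ∀ v ∈ facetGroup P J, ∀ w ∈ A, w * v ∈ A) {c : Hecke b q}
    (hc : c ∈ subJ b q J) {h : Hecke b q} (hh : h ∈ Submodule.span ℂ (T b q '' A)) :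
    h * c ∈ Submodule.span ℂ (T b q '' A) := by
  have hΩ (z : ExtWeyl P) (hz : z ∈ Omega b) (hz' : z ∈ facetGroup P J) {h : Hecke b q}
      (hh : h ∈ Submodule.span ℂ (T b q '' A)) :
      h * T b q z ∈ Submodule.span ℂ (T b q '' A) := by
    induction hh using Submodule.span_induction with
    | mem x hx =>
      obtain ⟨w, hw, rfl⟩ := hx
      rw [T_mul_Omega hz]
      exact Submodule.subset_span ⟨_, hA z hz' w hw, rfl⟩
    | zero => rw [zero_mul]; exact zero_mem _
    | add x y _ _ hx hy => rw [add_mul]; exact add_mem hx hy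
    | smul r x _ hx => rw [smul_mul_assoc]; exact Submodule.smul_mem _ _ hx
  rw [subJ, ← Algebra.adjoin_union] at hc
  induction hc using Algebra.adjoin_induction generalizing h with
  | mem x hx =>
    rcases hx with ⟨v, hv, rfl⟩ | ⟨z, hz, rfl⟩
    · change v ∈ stabJ P J at hv
      induction hn : length b v generalizing v with
      | zero => exact hΩ v hn (stabJ_le_facetGroup P J hv) hh
      | succ n ih =>
        obtain ⟨a, ha, hva⟩ := exists_descent_of_mem_stabJ hJ hne hv (by
          rintro rfl
          rw [length_one] at hn
          omega)
        have h1 := length_mul_affRefl_of_notMem (hJ ha) hva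
        have h2 := T_mul_affRefl (q := q) (hJ ha) ((affAct_mul_affRefl v a).mpr hva)
        rw [affRefl_mul_cancel_right] at h2
        rw [← h2, ← mul_assoc]
        exact T_mul_affRefl_mem_span (hJ ha)
          (hA _ (stabJ_le_facetGroup P J (affRefl_mem_stabJ ha)))
          (ih _ (mul_mem hv (affRefl_mem_stabJ ha)) (by omega))
    · exact hΩ z (mem_Omega_of_mem_center hz) (center_le_facetGroup P J hz) hh
  | algebraMap r =>
    rw [← Algebra.commutes, ← Algebra.smul_def]
    exact Submodule.smul_mem _ _ hh
  | add x y _ _ hx hy => rw [mul_add]; exact add_mem (hx hh) (hy hh)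
  | mul x y _ _ hx hy => rw [← mul_assoc]; exact hy (hx hh)

/-- The class of `h ⊗ h'`. -/
def BalTensor.tmul (b : P.Base) (q : ExtWeyl P → ℝ) (J : Set (ι × ℤ)) (h h' : Hecke b q) :
    BalTensor b q J := (balanced b q J).mkQ (h ⊗ₜ[ℂ] op h')

lemma BalTensor.smul_tmul {J : Set (ι × ℤ)} (g g' h h' : Hecke b q) :
    (g ⊗ₜ[ℂ] op g' : Env b q) • BalTensor.tmul b q J h h' =
      BalTensor.tmul b q J (g * h) (h' * g') := by
  refine (LinearMap.map_smul (balanced b q J).mkQ _ _).symm.trans ?_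
  rw [smul_eq_mul, Algebra.TensorProduct.tmul_mul_tmul, ← op_mul]
  rfl

lemma BalTensor.mul_tmul {J : Set (ι × ℤ)} {c : Hecke b q} (hc : c ∈ subJ b q J)
    (h h' : Hecke b q) :
    BalTensor.tmul b q J (h * c) h' = BalTensor.tmul b q J h (c * h') := by
  have h1 : BalTensor.tmul b q J c 1 = BalTensor.tmul b q J 1 c := by
    exact (Submodule.Quotient.eq (balanced b q J)).mpr (Submodule.subset_span ⟨c, hc, rfl⟩)
  have h2 := congrArg (fun m => (h ⊗ₜ[ℂ] op h' : Env b q) • m) h1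
  simpa only [BalTensor.smul_tmul, mul_one, one_mul] using h2

@[elab_as_elim]
lemma BalTensor.induction {J : Set (ι × ℤ)} {p : BalTensor b q J → Prop} (m : BalTensor b q J)
    (zero : p 0) (tmul : ∀ h h', p (BalTensor.tmul b q J h h'))
    (add : ∀ m m', p m → p m' → p (m + m')) : p m := by
  obtain ⟨x, rfl⟩ := Submodule.mkQ_surjective (balanced b q J) m
  induction x using TensorProduct.induction_on with
  | zero => rw [map_zero]; exact zero
  | tmul h h' => exact tmul h (unop h')
  | add x y hx hy => rw [map_add]; exact add _ _ hx hy

/-- Additive maps out of `H ⊗_{H(W_J, q) ⊗ ℂ[Z(W)]} H`. -/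
def BalTensor.lift {J : Set (ι × ℤ)} {N : Type*} [AddCommGroup N] (f : Env b q →+ N)
    (hf : ∀ c ∈ subJ b q J, ∀ h h', f ((h * c) ⊗ₜ op h') = f (h ⊗ₜ op (c * h'))) :
    BalTensor b q J →+ N :=
  QuotientAddGroup.lift (balanced b q J).toAddSubgroup f fun x hx => by
    suffices h : ∀ y : Env b q, f (y * x) = 0 by
      rw [← one_mul x]
      exact h 1
    refine Submodule.span_induction (p := fun x _ => ∀ y : Env b q, f (y * x) = 0) ?_ ?_ ?_ ?_ hx
    · rintro x ⟨c, hc, rfl⟩ y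
      induction y using TensorProduct.induction_on with
      | zero => rw [zero_mul, map_zero]
      | add y y' hy hy' => rw [add_mul, map_add, hy, hy', add_zero]
      | tmul h h' =>
        rw [mul_sub, Algebra.TensorProduct.tmul_mul_tmul, Algebra.TensorProduct.tmul_mul_tmul,
          map_sub, mul_one, mul_one]
        exact sub_eq_zero.mpr (hf c hc h (unop h'))
    · intro y
      rw [mul_zero, map_zero]
    · intro x x' _ _ hx hx' y
      rw [mul_add, map_add, hx, hx', add_zero]
    · intro r x _ hx y
      rw [smul_eq_mul, ← mul_assoc]
      exact hx _

end Cosets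

end

end AffineHecke

namespace AffineHecke

noncomputable section

set_option linter.unusedSectionVars false

/-! ### Freeness of the balanced tensor product over the cosets of W_J Z(W) -/

section Free

variable {ι X Y : Type*} [Finite ι] [AddCommGroup X] [AddCommGroup Y] {P : RootDatum ι X Y}
  [P.IsReduced] {b : P.Base} {q : ExtWeyl P → ℝ}

/-- The quadratic relation gives T_s⁻¹ = q(s)⁻¹ (T_s - (q(s) - 1)), which lies in the subalgebra; it
requires q(s) ≠ 0. -/
lemma exists_inv_T_affRefl (hq : IsParameter b q) {J : Set (ι × ℤ)} (hJ : J ⊆ simpleAff b)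
    {a : ι × ℤ} (ha : a ∈ J) :
    ∃ c ∈ subJ b q J, c * T b q (affRefl P a) = 1 ∧ T b q (affRefl P a) * c = 1 := by
  have hq0 : (q (affRefl P a) : ℂ) ≠ 0 := by exact_mod_cast (hq.pos _).ne'
  have hs := T_mem_subJ_of_stabJ (b := b) (q := q) (affRefl_mem_stabJ (P := P) ha)
  have h := T_affRefl_sq (q := q) (hJ ha)
  refine ⟨(q (affRefl P a) : ℂ)⁻¹ • (T b q (affRefl P a) - ((q (affRefl P a) : ℂ) - 1) • 1),
    Subalgebra.smul_mem _ (sub_mem hs (Subalgebra.smul_mem _ (one_mem _) _)) _, ?_, ?_⟩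
  · rw [smul_mul_assoc, sub_mul, h, smul_mul_assoc, one_mul, add_sub_cancel_left, smul_smul,
      inv_mul_cancel₀ hq0, one_smul]
  · rw [mul_smul_comm, mul_sub, h, mul_smul_comm, mul_one, add_sub_cancel_left, smul_smul,
      inv_mul_cancel₀ hq0, one_smul]

/-- For `v ∈ W_J Z(W)`, the `T_{vw}` and `T_w` differ by a unit of `H(W_J, q) ⊗ ℂ[Z(W)]`. -/
lemma exists_T_facetGroup_mul (hq : IsParameter b q) {J : Set (ι × ℤ)} (hJ : J ⊆ simpleAff b)
    {v : ExtWeyl P} (hv : v ∈ facetGroup P J) (w : ExtWeyl P) :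
    ∃ c ∈ subJ b q J, ∃ c' ∈ subJ b q J, c * c' = 1 ∧ c' * c = 1 ∧
      T b q (v * w) = c * T b q w := by
  obtain ⟨v, hvJ, z, hz, rfl⟩ := mem_facetGroup.mp hv
  have key : ∀ v ∈ Subgroup.closure (affRefl P '' J), ∀ w, ∃ c ∈ subJ b q J, ∃ c' ∈ subJ b q J, c * c' = 1 ∧ c' * c = 1 ∧
      T b q (v * w) = c * T b q w := by
    intro v hv
    induction hv using Subgroup.closure_induction with
    | mem x hx =>
      obtain ⟨a, ha, rfl⟩ := hx
      intro w
      obtain ⟨c, hc, h1, h2⟩ := exists_inv_T_affRefl hq hJ ha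
      have hs := T_mem_subJ_of_stabJ (b := b) (q := q) (affRefl_mem_stabJ (P := P) ha)
      by_cases h : affAct w⁻¹ a ∈ posAff b
      · exact ⟨_, hs, c, hc, h2, h1, (T_affRefl_mul (hJ ha) h).symm⟩
      -- If s shortens w, then T_w = T_s T_{sw}, so the unit relating T_{sw} to T_w is T_s⁻¹ instead
      -- of T_s.
      · have h3 := T_affRefl_mul (q := q) (hJ ha) ((affAct_affRefl_mul_inv w a).mpr h)
        rw [affRefl_mul_cancel_left] at h3
        exact ⟨c, hc, _, hs, h1, h2, by rw [← h3, ← mul_assoc, h1, one_mul]⟩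
    | one => exact fun w => ⟨1, one_mem _, 1, one_mem _, by simp⟩
    | mul x y _ _ hx hy =>
      intro w
      obtain ⟨c, hc, c', hc', h1, h2, h3⟩ := hx (y * w)
      obtain ⟨d, hd, d', hd', h4, h5, h6⟩ := hy w
      refine ⟨c * d, mul_mem hc hd, d' * c', mul_mem hd' hc', ?_, ?_, ?_⟩
      · rw [mul_assoc, ← mul_assoc d, h4, one_mul, h1]
      · rw [mul_assoc, ← mul_assoc c', h2, one_mul, h5]
      · rw [mul_assoc, h3, h6, mul_assoc]
    | inv x _ hx =>
      intro w
      obtain ⟨c, hc, c', hc', h1, h2, h3⟩ := hx (x⁻¹ * w)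
      rw [mul_inv_cancel_left] at h3
      exact ⟨c', hc', c, hc, h2, h1, by rw [h3, ← mul_assoc, h2, one_mul]⟩
  obtain ⟨c, hc, c', hc', h1, h2, h3⟩ := key v hvJ (z * w)
  have hzO := mem_Omega_of_mem_center (b := b) hz
  refine ⟨c * T b q z, mul_mem hc (T_mem_subJ_of_center hz), T b q z⁻¹ * c',
    mul_mem (T_mem_subJ_of_center (inv_mem hz)) hc', ?_, ?_, ?_⟩
  · rw [mul_assoc, ← mul_assoc (T b q z), T_mul_T_inv b q hzO, one_mul, h1]
  · rw [mul_assoc, ← mul_assoc c', h2, one_mul, T_inv_mul_T b q hzO]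
  · rw [mul_assoc, h3, mul_assoc, T_Omega_mul hzO]

lemma exists_T_mul_facetGroup (hq : IsParameter b q) {J : Set (ι × ℤ)} (hJ : J ⊆ simpleAff b)
    {v : ExtWeyl P} (hv : v ∈ facetGroup P J) (w : ExtWeyl P) :
    ∃ c ∈ subJ b q J, ∃ c' ∈ subJ b q J, c * c' = 1 ∧ c' * c = 1 ∧
      T b q (w * v) = T b q w * c := by
  obtain ⟨v, hvJ, z, hz, rfl⟩ := mem_facetGroup.mp hv
  have key : ∀ v ∈ Subgroup.closure (affRefl P '' J), ∀ w, ∃ c ∈ subJ b q J, ∃ c' ∈ subJ b q J, c * c' = 1 ∧ c' * c = 1 ∧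
      T b q (w * v) = T b q w * c := by
    intro v hv
    induction hv using Subgroup.closure_induction with
    | mem x hx =>
      obtain ⟨a, ha, rfl⟩ := hx
      intro w
      obtain ⟨c, hc, h1, h2⟩ := exists_inv_T_affRefl hq hJ ha
      have hs := T_mem_subJ_of_stabJ (b := b) (q := q) (affRefl_mem_stabJ (P := P) ha)
      by_cases h : affAct w a ∈ posAff b
      · exact ⟨_, hs, c, hc, h2, h1, (T_mul_affRefl (hJ ha) h).symm⟩
      · have h3 := T_mul_affRefl (q := q) (hJ ha) ((affAct_mul_affRefl w a).mpr h)
        rw [affRefl_mul_cancel_right] at h3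
        exact ⟨c, hc, _, hs, h1, h2, by rw [← h3, mul_assoc, h2, mul_one]⟩
    | one => exact fun w => ⟨1, one_mem _, 1, one_mem _, by simp⟩
    | mul x y _ _ hx hy =>
      intro w
      obtain ⟨c, hc, c', hc', h1, h2, h3⟩ := hx w
      obtain ⟨d, hd, d', hd', h4, h5, h6⟩ := hy (w * x)
      refine ⟨c * d, mul_mem hc hd, d' * c', mul_mem hd' hc', ?_, ?_, ?_⟩
      · rw [mul_assoc, ← mul_assoc d, h4, one_mul, h1]
      · rw [mul_assoc, ← mul_assoc c', h2, one_mul, h5]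
      · rw [← mul_assoc, h6, h3, mul_assoc]
    | inv x _ hx =>
      intro w
      obtain ⟨c, hc, c', hc', h1, h2, h3⟩ := hx (w * x⁻¹)
      rw [inv_mul_cancel_right] at h3
      exact ⟨c', hc', c, hc, h2, h1, by rw [h3, mul_assoc, h1, mul_one]⟩
  obtain ⟨c, hc, c', hc', h1, h2, h3⟩ := key v hvJ w
  have hzO := mem_Omega_of_mem_center (b := b) hz
  refine ⟨c * T b q z, mul_mem hc (T_mem_subJ_of_center hz), T b q z⁻¹ * c',
    mul_mem (T_mem_subJ_of_center (inv_mem hz)) hc', ?_, ?_, ?_⟩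
  · rw [mul_assoc, ← mul_assoc (T b q z), T_mul_T_inv b q hzO, one_mul, h1]
  · rw [mul_assoc, ← mul_assoc c', h2, one_mul, T_inv_mul_T b q hzO]
  · rw [← mul_assoc, ← T_mul_Omega hzO, h3, mul_assoc]

/-- `T_w` as a unit of the affine Hecke algebra. -/
def unitT (hq : IsParameter b q) (w : ExtWeyl P) : (Hecke b q)ˣ := (isUnit_T hq w).unit

@[simp] lemma coe_unitT (hq : IsParameter b q) (w : ExtWeyl P) :
    (unitT hq w : Hecke b q) = T b q w := rfl

/-! #### Freeness on the left -/

/-- The element `T_w⁻¹ ⊗ T_w` with `w = x⁻¹`. -/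
def epsL (hq : IsParameter b q) (J : Set (ι × ℤ)) (x : ExtWeyl P) : BalTensor b q J :=
  BalTensor.tmul b q J ↑(unitT hq x⁻¹)⁻¹ (T b q x⁻¹)

/-- If x and y lie in the same coset, T_{y⁻¹} is a unit of the subalgebra times T_{x⁻¹}. The unit
crosses the tensor sign and cancels against the inverse in the first factor. -/
lemma epsL_eq (hq : IsParameter b q) {J : Set (ι × ℤ)} (hJ : J ⊆ simpleAff b)
    {x y : ExtWeyl P} (h : (x : FacetCoset P J) = y) : epsL hq J x = epsL hq J y := by
  obtain ⟨c, hc, c', hc', h1, h2, h3⟩ := exists_T_facetGroup_mul hq hJ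
    (inv_mem (QuotientGroup.eq.mp h)) x⁻¹
  rw [mul_inv_rev, inv_inv, mul_inv_cancel_right] at h3
  have h4 : (↑(unitT hq y⁻¹)⁻¹ : Hecke b q) * c = ↑(unitT hq x⁻¹)⁻¹ := by
    rw [Units.inv_mul_eq_iff_eq_mul, coe_unitT, h3, mul_assoc, ← coe_unitT hq x⁻¹, Units.mul_inv,
      mul_one]
  rw [epsL, epsL, h3, ← BalTensor.mul_tmul hc, h4]

lemma tmul_T_eq_smul_epsL (hq : IsParameter b q) (J : Set (ι × ℤ)) (h : Hecke b q)
    (w : ExtWeyl P) : BalTensor.tmul b q J h (T b q w) =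
      ((h * T b q w) ⊗ₜ[ℂ] op 1 : Env b q) • epsL hq J w⁻¹ := by
  rw [epsL, BalTensor.smul_tmul, mul_one, inv_inv, mul_assoc, ← coe_unitT hq w, Units.mul_inv,
    mul_one]

/-- The linear map with `T_w ↦ T_w [w⁻¹]`. -/
def cosetExpandL (hq : IsParameter b q) (J : Set (ι × ℤ)) :
    Hecke b q →ₗ[ℂ] FacetCoset P J →₀ Hecke b q :=
  (basisT hq).constr ℂ fun w => Finsupp.single (w⁻¹ : ExtWeyl P) (T b q w)

lemma cosetExpandL_T (hq : IsParameter b q) (J : Set (ι × ℤ)) (w : ExtWeyl P) :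
    cosetExpandL hq J (T b q w) =
      Finsupp.single ((w⁻¹ : ExtWeyl P) : FacetCoset P J) (T b q w) := by
  rw [← basisT_apply hq, cosetExpandL, Module.Basis.constr_basis, basisT_apply]

lemma cosetExpandL_of_mem_span (hq : IsParameter b q) (J : Set (ι × ℤ)) (c : FacetCoset P J)
    {h : Hecke b q}
    (hh : h ∈ Submodule.span ℂ (T b q '' {w | ((w⁻¹ : ExtWeyl P) : FacetCoset P J) = c})) :
    cosetExpandL hq J h = Finsupp.single c h := by
  induction hh using Submodule.span_induction with
  | mem x hx =>
    obtain ⟨w, rfl, rfl⟩ := hx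
    exact cosetExpandL_T hq J w
  | zero => simp
  | add x y _ _ hx hy => rw [map_add, hx, hy, Finsupp.single_add]
  | smul r x _ hx => rw [map_smul, hx, Finsupp.smul_single]

/-- Left multiplication by the subalgebra preserves the span of the T_w over a coset W_J Z(W) w,
which inversion turns into a left coset. This compatibility is what lets the coordinates descend to
the balanced tensor product. -/
lemma cosetExpandL_mul (hq : IsParameter b q) {J : Set (ι × ℤ)} (hJ : J ⊆ simpleAff b)
    (hne : (alcoveFace b J).Nonempty) {c : Hecke b q} (hc : c ∈ subJ b q J) (h : Hecke b q) :
    cosetExpandL hq J (c * h) = c • cosetExpandL hq J h := by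
  have key : (cosetExpandL hq J).comp (LinearMap.mulLeft ℂ c) =
      (Module.toModuleEnd ℂ (S := Hecke b q) (FacetCoset P J →₀ Hecke b q) c).comp
        (cosetExpandL hq J) := by
    refine (basisT hq).ext fun w => ?_
    simp only [basisT_apply, LinearMap.comp_apply, LinearMap.mulLeft_apply, cosetExpandL_T,
      Module.toModuleEnd_apply, DistribSMul.toLinearMap_apply]
    rw [cosetExpandL_of_mem_span hq J ((w⁻¹ : ExtWeyl P) : FacetCoset P J), Finsupp.smul_single,
      smul_eq_mul]
    refine subJ_mul_mem_span hJ hne ?_ hc (Submodule.subset_span ⟨w, rfl, rfl⟩)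
    rintro v hv u hu
    rw [Set.mem_ofPred_eq] at hu ⊢
    rw [← hu, mul_inv_rev, QuotientGroup.mk_mul_of_mem _ (inv_mem hv)]
  exact LinearMap.congr_fun key h

/-- The coordinates with respect to the left `H`-basis `epsL`. -/
def coordL (hq : IsParameter b q) {J : Set (ι × ℤ)} (hJ : J ⊆ simpleAff b)
    (hne : (alcoveFace b J).Nonempty) : BalTensor b q J →+ (FacetCoset P J →₀ Hecke b q) :=
  BalTensor.lift (TensorProduct.lift
    (LinearMap.mk₂ ℂ (fun (h : Hecke b q) (h' : (Hecke b q)ᵐᵒᵖ) =>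
      h • cosetExpandL hq J (unop h'))
      (fun _ _ _ => add_smul _ _ _) (fun _ _ _ => smul_assoc _ _ _)
      (fun _ _ _ => by rw [unop_add, map_add, smul_add])
      (fun _ _ _ => by rw [unop_smul, map_smul, smul_comm]))).toAddMonoidHom
    fun c hc h h' => by
      change (h * c) • cosetExpandL hq J h' = h • cosetExpandL hq J (c * h')
      rw [cosetExpandL_mul hq hJ hne hc, smul_smul]

variable (hq : IsParameter b q) {J : Set (ι × ℤ)} (hJ : J ⊆ simpleAff b)
    (hne : (alcoveFace b J).Nonempty)

lemma coordL_tmul (h h' : Hecke b q) :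
    coordL hq hJ hne (BalTensor.tmul b q J h h') = h • cosetExpandL hq J h' := rfl

lemma coordL_tmul_T (h : Hecke b q) (w : ExtWeyl P) :
    coordL hq hJ hne (BalTensor.tmul b q J h (T b q w)) =
      Finsupp.single ((w⁻¹ : ExtWeyl P) : FacetCoset P J) (h * T b q w) := by
  rw [coordL_tmul, cosetExpandL_T, Finsupp.smul_single, smul_eq_mul]

lemma coordL_smul (g : Hecke b q) (m : BalTensor b q J) :
    coordL hq hJ hne ((g ⊗ₜ[ℂ] op 1 : Env b q) • m) = g • coordL hq hJ hne m := by
  induction m using BalTensor.induction with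
  | zero => simp
  | tmul h h' => rw [BalTensor.smul_tmul, coordL_tmul, coordL_tmul, smul_smul, mul_one]
  | add m m' hm hm' => rw [smul_add, map_add, hm, hm', map_add, smul_add]

lemma coordL_epsL (x : ExtWeyl P) :
    coordL hq hJ hne (epsL hq J x) = Finsupp.single (x : FacetCoset P J) 1 := by
  rw [epsL, coordL_tmul_T, inv_inv, ← coe_unitT hq x⁻¹, Units.inv_mul]

lemma BalTensor.induction_T {p : BalTensor b q J → Prop} (m : BalTensor b q J)
    (zero : p 0) (tmul : ∀ h w, p (BalTensor.tmul b q J h (T b q w)))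
    (add : ∀ m m', p m → p m' → p (m + m')) : p m := by
  induction m using BalTensor.induction with
  | zero => exact zero
  | add m m' hm hm' => exact add _ _ hm hm'
  | tmul h h' =>
    have hh : h' ∈ Submodule.span ℂ (Set.range (T b q)) := by rw [span_T]; trivial
    induction hh using Submodule.span_induction generalizing h with
    | mem x hx => obtain ⟨w, rfl⟩ := hx; exact tmul h w
    | zero =>
      rw [BalTensor.tmul, op_zero, TensorProduct.tmul_zero, map_zero]
      exact zero
    | add x y _ _ hx hy =>
      rw [BalTensor.tmul, op_add, TensorProduct.tmul_add, map_add]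
      exact add _ _ (hx h) (hy h)
    | smul r x _ hx =>
      rw [BalTensor.tmul, op_smul, ← TensorProduct.smul_tmul]
      exact hx _

/-- The combination of the elements `epsL` with given coefficients. -/
def combL (hq : IsParameter b q) (J : Set (ι × ℤ)) :
    (FacetCoset P J →₀ Hecke b q) →+ BalTensor b q J :=
  Finsupp.liftAddHom fun c => AddMonoidHom.mk'
    (fun h => (h ⊗ₜ[ℂ] op 1 : Env b q) • epsL hq J c.out)
    fun h h' => by rw [TensorProduct.add_tmul, add_smul]

lemma combL_single (c : FacetCoset P J) (h : Hecke b q) :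
    combL hq J (Finsupp.single c h) = (h ⊗ₜ[ℂ] op 1 : Env b q) • epsL hq J c.out := by
  exact Finsupp.liftAddHom_apply_single _ _ _

/-- `H ⊗_{H(W_J, q) ⊗ ℂ[Z(W)]} H` is free as a left `H`-module, with basis the cosets of
`W_J Z(W)`. -/
def equivL : BalTensor b q J ≃+ (FacetCoset P J →₀ Hecke b q) where
  __ := coordL hq hJ hne
  invFun := combL hq J
  left_inv m := by
    change combL hq J (coordL hq hJ hne m) = m
    induction m using BalTensor.induction_T with
    | zero => simp
    | tmul h w =>
      rw [coordL_tmul_T, combL_single, tmul_T_eq_smul_epsL hq]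
      congr 1
      exact epsL_eq hq hJ (QuotientGroup.out_eq' _)
    | add m m' hm hm' => rw [map_add, map_add, hm, hm']
  right_inv f := by
    change coordL hq hJ hne (combL hq J f) = f
    induction f using Finsupp.induction_linear with
    | zero => simp
    | add f g hf hg => rw [map_add, map_add, hf, hg]
    | single c h =>
      rw [combL_single, coordL_smul, coordL_epsL, QuotientGroup.out_eq', Finsupp.smul_single,
        smul_eq_mul, mul_one]

/-! #### Freeness on the right -/

/-- The element `T_w ⊗ T_w⁻¹`. -/
def epsR (hq : IsParameter b q) (J : Set (ι × ℤ)) (w : ExtWeyl P) : BalTensor b q J :=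
  BalTensor.tmul b q J (T b q w) ↑(unitT hq w)⁻¹

lemma epsR_eq (hq : IsParameter b q) {J : Set (ι × ℤ)} (hJ : J ⊆ simpleAff b)
    {x y : ExtWeyl P} (h : (x : FacetCoset P J) = y) : epsR hq J x = epsR hq J y := by
  obtain ⟨c, hc, c', hc', h1, h2, h3⟩ := exists_T_mul_facetGroup hq hJ (QuotientGroup.eq.mp h) x
  rw [mul_inv_cancel_left] at h3
  have h4 : c * (↑(unitT hq y)⁻¹ : Hecke b q) = ↑(unitT hq x)⁻¹ := by
    rw [Units.mul_inv_eq_iff_eq_mul, coe_unitT, h3, ← mul_assoc, ← coe_unitT hq x, Units.inv_mul,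
      one_mul]
  rw [epsR, epsR, h3, BalTensor.mul_tmul hc, h4]

lemma T_tmul_eq_smul_epsR (hq : IsParameter b q) (J : Set (ι × ℤ)) (h : Hecke b q)
    (w : ExtWeyl P) : BalTensor.tmul b q J (T b q w) h =
      ((1 : Hecke b q) ⊗ₜ[ℂ] op (T b q w * h) : Env b q) • epsR hq J w := by
  rw [epsR, BalTensor.smul_tmul, one_mul, ← mul_assoc, ← coe_unitT hq w, Units.inv_mul, one_mul]

/-- The linear map with `T_w ↦ T_w [w]`. -/
def cosetExpandR (hq : IsParameter b q) (J : Set (ι × ℤ)) :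
    Hecke b q →ₗ[ℂ] FacetCoset P J →₀ (Hecke b q)ᵐᵒᵖ :=
  (basisT hq).constr ℂ fun w => Finsupp.single w (op (T b q w))

lemma cosetExpandR_T (hq : IsParameter b q) (J : Set (ι × ℤ)) (w : ExtWeyl P) :
    cosetExpandR hq J (T b q w) = Finsupp.single (w : FacetCoset P J) (op (T b q w)) := by
  rw [← basisT_apply hq, cosetExpandR, Module.Basis.constr_basis, basisT_apply]

lemma cosetExpandR_of_mem_span (hq : IsParameter b q) (J : Set (ι × ℤ)) (c : FacetCoset P J)
    {h : Hecke b q} (hh : h ∈ Submodule.span ℂ (T b q '' {w | (w : FacetCoset P J) = c})) :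
    cosetExpandR hq J h = Finsupp.single c (op h) := by
  induction hh using Submodule.span_induction with
  | mem x hx =>
    obtain ⟨w, rfl, rfl⟩ := hx
    exact cosetExpandR_T hq J w
  | zero => simp
  | add x y _ _ hx hy => rw [map_add, hx, hy, op_add, Finsupp.single_add]
  | smul r x _ hx => rw [map_smul, hx, op_smul, Finsupp.smul_single]

lemma cosetExpandR_mul (hq : IsParameter b q) {J : Set (ι × ℤ)} (hJ : J ⊆ simpleAff b)
    (hne : (alcoveFace b J).Nonempty) {c : Hecke b q} (hc : c ∈ subJ b q J) (h : Hecke b q) :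
    cosetExpandR hq J (h * c) = op c • cosetExpandR hq J h := by
  have key : (cosetExpandR hq J).comp (LinearMap.mulRight ℂ c) =
      (Module.toModuleEnd ℂ (S := (Hecke b q)ᵐᵒᵖ) (FacetCoset P J →₀ (Hecke b q)ᵐᵒᵖ) (op c)).comp
        (cosetExpandR hq J) := by
    refine (basisT hq).ext fun w => ?_
    simp only [basisT_apply, LinearMap.comp_apply, LinearMap.mulRight_apply, cosetExpandR_T,
      Module.toModuleEnd_apply, DistribSMul.toLinearMap_apply]
    rw [cosetExpandR_of_mem_span hq J (w : FacetCoset P J), Finsupp.smul_single, smul_eq_mul,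
      op_mul]
    refine mul_subJ_mem_span hJ hne ?_ hc (Submodule.subset_span ⟨w, rfl, rfl⟩)
    rintro v hv u hu
    rw [Set.mem_ofPred_eq] at hu ⊢
    rw [← hu, QuotientGroup.mk_mul_of_mem _ hv]
  exact LinearMap.congr_fun key h

/-- The coordinates with respect to the right `H`-basis `epsR`. -/
def coordR (hq : IsParameter b q) {J : Set (ι × ℤ)} (hJ : J ⊆ simpleAff b)
    (hne : (alcoveFace b J).Nonempty) : BalTensor b q J →+ (FacetCoset P J →₀ (Hecke b q)ᵐᵒᵖ) :=
  BalTensor.lift (TensorProduct.lift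
    (LinearMap.mk₂ ℂ (fun (h : Hecke b q) (h' : (Hecke b q)ᵐᵒᵖ) => h' • cosetExpandR hq J h)
      (fun _ _ _ => by rw [map_add, smul_add])
      (fun _ _ _ => by rw [map_smul, smul_comm])
      (fun _ _ _ => add_smul _ _ _) (fun _ _ _ => smul_assoc _ _ _))).toAddMonoidHom
    fun c hc h h' => by
      change op h' • cosetExpandR hq J (h * c) = op (c * h') • cosetExpandR hq J h
      rw [cosetExpandR_mul hq hJ hne hc, smul_smul, op_mul]

lemma coordR_tmul (h h' : Hecke b q) :
    coordR hq hJ hne (BalTensor.tmul b q J h h') = op h' • cosetExpandR hq J h := rfl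

lemma coordR_T_tmul (h : Hecke b q) (w : ExtWeyl P) :
    coordR hq hJ hne (BalTensor.tmul b q J (T b q w) h) =
      Finsupp.single (w : FacetCoset P J) (op (T b q w * h)) := by
  rw [coordR_tmul, cosetExpandR_T, Finsupp.smul_single, smul_eq_mul, op_mul]

lemma coordR_smul (g : Hecke b q) (m : BalTensor b q J) :
    coordR hq hJ hne ((1 ⊗ₜ[ℂ] op g : Env b q) • m) = op g • coordR hq hJ hne m := by
  induction m using BalTensor.induction with
  | zero => simp
  | tmul h h' => rw [BalTensor.smul_tmul, coordR_tmul, coordR_tmul, smul_smul, one_mul, op_mul]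
  | add m m' hm hm' => rw [smul_add, map_add, hm, hm', map_add, smul_add]

lemma coordR_epsR (x : ExtWeyl P) :
    coordR hq hJ hne (epsR hq J x) = Finsupp.single (x : FacetCoset P J) 1 := by
  rw [epsR, coordR_T_tmul, ← coe_unitT hq x, Units.mul_inv, op_one]

lemma BalTensor.induction_T_left {p : BalTensor b q J → Prop} (m : BalTensor b q J)
    (zero : p 0) (tmul : ∀ w h, p (BalTensor.tmul b q J (T b q w) h))
    (add : ∀ m m', p m → p m' → p (m + m')) : p m := by
  induction m using BalTensor.induction with
  | zero => exact zero
  | add m m' hm hm' => exact add _ _ hm hm'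
  | tmul h h' =>
    have hh : h ∈ Submodule.span ℂ (Set.range (T b q)) := by rw [span_T]; trivial
    induction hh using Submodule.span_induction generalizing h' with
    | mem x hx => obtain ⟨w, rfl⟩ := hx; exact tmul w h'
    | zero =>
      rw [BalTensor.tmul, TensorProduct.zero_tmul, map_zero]
      exact zero
    | add x y _ _ hx hy =>
      rw [BalTensor.tmul, TensorProduct.add_tmul, map_add]
      exact add _ _ (hx h') (hy h')
    | smul r x _ hx =>
      rw [BalTensor.tmul, TensorProduct.smul_tmul, ← op_smul]
      exact hx _

/-- The combination of the elements `epsR` with given coefficients. -/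
def combR (hq : IsParameter b q) (J : Set (ι × ℤ)) :
    (FacetCoset P J →₀ (Hecke b q)ᵐᵒᵖ) →+ BalTensor b q J :=
  Finsupp.liftAddHom fun c => AddMonoidHom.mk'
    (fun h => ((1 : Hecke b q) ⊗ₜ[ℂ] h : Env b q) • epsR hq J c.out)
    fun h h' => by rw [TensorProduct.tmul_add, add_smul]

lemma combR_single (c : FacetCoset P J) (h : (Hecke b q)ᵐᵒᵖ) :
    combR hq J (Finsupp.single c h) = ((1 : Hecke b q) ⊗ₜ[ℂ] h : Env b q) • epsR hq J c.out := by
  exact Finsupp.liftAddHom_apply_single _ _ _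

/-- `H ⊗_{H(W_J, q) ⊗ ℂ[Z(W)]} H` is free as a right `H`-module, with basis the cosets of
`W_J Z(W)`. -/
def equivR : BalTensor b q J ≃+ (FacetCoset P J →₀ (Hecke b q)ᵐᵒᵖ) where
  __ := coordR hq hJ hne
  invFun := combR hq J
  left_inv m := by
    change combR hq J (coordR hq hJ hne m) = m
    induction m using BalTensor.induction_T_left with
    | zero => simp
    | tmul w h =>
      rw [coordR_T_tmul, combR_single, T_tmul_eq_smul_epsR hq]
      congr 1
      exact epsR_eq hq hJ (QuotientGroup.out_eq' _)
    | add m m' hm hm' => rw [map_add, map_add, hm, hm']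
  right_inv f := by
    change coordR hq hJ hne (combR hq J f) = f
    induction f using Finsupp.induction_linear with
    | zero => simp
    | add f g hf hg => rw [map_add, map_add, hf, hg]
    | single c h =>
      rw [combR_single, ← op_unop h, coordR_smul, coordR_epsR, QuotientGroup.out_eq',
        Finsupp.smul_single, smul_eq_mul, mul_one]

/-! #### The maps between the coefficients -/

lemma BalTensor.factor_tmul {J J' : Set (ι × ℤ)} (h : J ⊆ J') (g g' : Hecke b q) :
    BalTensor.factor b q h (BalTensor.tmul b q J g g') = BalTensor.tmul b q J' g g' := rfl

lemma BalTensor.twist_tmul {w : ExtWeyl P} (hw : w ∈ Omega b) {J J' : Set (ι × ℤ)}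
    (h : affAct w '' J = J') (g g' : Hecke b q) :
    BalTensor.twist b q hw h (BalTensor.tmul b q J g g') =
      BalTensor.tmul b q J' (g * T b q w⁻¹) (T b q w * g') := by
  change (balanced b q J').mkQ ((g ⊗ₜ[ℂ] op g') • (T b q w⁻¹ ⊗ₜ[ℂ] op (T b q w))) = _
  rw [smul_eq_mul, Algebra.TensorProduct.tmul_mul_tmul, ← op_mul]
  rfl

lemma mulMap_tmul (J : Set (ι × ℤ)) (g g' : Hecke b q) :
    mulMap b q J (BalTensor.tmul b q J g g') = g * g' := by
  change (g ⊗ₜ[ℂ] op g' : Env b q) • (1 : Hecke b q) = _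
  rw [TensorProduct.Algebra.smul_def, op_smul_eq_mul, one_mul, smul_eq_mul]

/-- For `J ⊆ J'`, the map of cosets `w W_J Z(W) ↦ w W_J' Z(W)`. -/
def FacetCoset.map {J J' : Set (ι × ℤ)} (h : J ⊆ J') : FacetCoset P J → FacetCoset P J' :=
  Quotient.map' id fun x y hxy => by
    rw [QuotientGroup.leftRel_apply] at hxy ⊢
    exact facetGroup_mono h hxy

lemma FacetCoset.map_mk {J J' : Set (ι × ℤ)} (h : J ⊆ J') (x : ExtWeyl P) :
    FacetCoset.map h (x : FacetCoset P J) = (x : FacetCoset P J') := rfl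

/-- The elements `epsL` of different facets correspond under the structure maps, so only the cosets
change and the coefficients stay. This reduces exactness to the combinatorics of cosets. -/
lemma coordL_factor {J' : Set (ι × ℤ)} (hJ' : J' ⊆ simpleAff b) (hne' : (alcoveFace b J').Nonempty)
    (h : J ⊆ J') (m : BalTensor b q J) :
    coordL hq hJ' hne' (BalTensor.factor b q h m) =
      Finsupp.mapDomain (FacetCoset.map h) (coordL hq hJ hne m) := by
  induction m using BalTensor.induction_T with
  | zero => simp
  | tmul g w =>
    rw [BalTensor.factor_tmul, coordL_tmul_T, coordL_tmul_T, Finsupp.mapDomain_single,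
      FacetCoset.map_mk]
  | add m m' hm hm' => rw [map_add, map_add, hm, hm', map_add, Finsupp.mapDomain_add]

end Free

end

end AffineHecke

namespace AffineHecke

noncomputable section

set_option linter.unusedSectionVars false

/-! ### Volume forms of the facets -/

section Volume

variable {V : Type*} [AddCommGroup V] [Module ℝ V]

/-- A linear retraction onto a subspace. -/
def retraction (U : Submodule ℝ V) : V →ₗ[ℝ] U :=
  (LinearMap.exists_leftInverse_of_injective U.subtype U.ker_subtype).choose

lemma retraction_coe (U : Submodule ℝ V) (x : U) : retraction U x = x :=
  LinearMap.congr_fun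
    (LinearMap.exists_leftInverse_of_injective U.subtype U.ker_subtype).choose_spec x

/-- The determinant with respect to an ordered basis of a subspace, as a form on the space. -/
def volForm {n : ℕ} {U : Submodule ℝ V} (B : Module.Basis (Fin n) ℝ U) : V [⋀^Fin n]→ₗ[ℝ] ℝ :=
  B.det.compLinearMap (retraction U)

/-- The vectors of a basis of a subspace. -/
def vecs {n : ℕ} {U : Submodule ℝ V} (B : Module.Basis (Fin n) ℝ U) (k : Fin n) : V := B k

/-- The choice of a retraction is invisible on vectors of the subspace. Extending the forms to the
ambient space lets forms on different face directions be compared without coercions. -/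
lemma volForm_coe {n : ℕ} {U : Submodule ℝ V} (B : Module.Basis (Fin n) ℝ U) (v : Fin n → U) :
    volForm B (fun k => (v k : V)) = B.det v := by
  rw [volForm, AlternatingMap.compLinearMap_apply]
  congr 1
  ext k
  rw [retraction_coe]

lemma volForm_vecs {n : ℕ} {U : Submodule ℝ V} (B : Module.Basis (Fin n) ℝ U) :
    volForm B (vecs B) = 1 := by
  rw [← B.det_self]
  exact volForm_coe B B

/-- An `n`-form on a space of dimension `n` is determined by its value on a basis. -/
lemma eq_mul_volForm {n : ℕ} {U : Submodule ℝ V} (B : Module.Basis (Fin n) ℝ U)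
    (ω : V [⋀^Fin n]→ₗ[ℝ] ℝ) {v : Fin n → V} (hv : ∀ k, v k ∈ U) :
    ω v = ω (vecs B) * volForm B v := by
  have h := congrArg (fun f => f fun k => (⟨v k, hv k⟩ : U))
    (AlternatingMap.eq_smul_basis_det B (ω.compLinearMap U.subtype))
  have h2 := volForm_coe B fun k => (⟨v k, hv k⟩ : U)
  rw [h2]
  exact h

lemma map_cons_smul_add {n : ℕ} (ω : V [⋀^Fin (n + 1)]→ₗ[ℝ] ℝ) (c : ℝ) (x y : V)
    (v : Fin n → V) : ω (Fin.cons (c • x + y) v) = c * ω (Fin.cons x v) + ω (Fin.cons y v) := by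
  have h := (ω.curryLeft).map_add (c • x) y
  rw [map_smul] at h
  exact congrArg (fun f => f v) h

lemma map_cons_of_mem_span {n : ℕ} (ω : V [⋀^Fin (n + 1)]→ₗ[ℝ] ℝ) {x : V} {v : Fin n → V}
    (hx : x ∈ Submodule.span ℝ (Set.range v)) : ω (Fin.cons x v) = 0 := by
  refine AlternatingMap.map_linearDependent ω _ fun h => ?_
  exact (linearIndependent_finCons.mp h).2 hx

lemma span_vecs {n : ℕ} {U : Submodule ℝ V} (B : Module.Basis (Fin n) ℝ U) :
    Submodule.span ℝ (Set.range (vecs B)) = U := by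
  have h : Set.range (vecs B) = U.subtype '' Set.range B := by
    rw [← Set.range_comp]
    rfl
  rw [h, Submodule.span_image, B.span_eq, Submodule.map_top, Submodule.range_subtype]

lemma linearIndependent_vecs {n : ℕ} {U : Submodule ℝ V} (B : Module.Basis (Fin n) ℝ U) :
    LinearIndependent ℝ (vecs B) :=
  B.linearIndependent.map' U.subtype U.ker_subtype

lemma vecs_mem {n : ℕ} {U : Submodule ℝ V} (B : Module.Basis (Fin n) ℝ U) (k : Fin n) :
    vecs B k ∈ U := (B k).2

lemma volForm_ne_zero {n : ℕ} {U : Submodule ℝ V} (B : Module.Basis (Fin (n + 1)) ℝ U)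
    {v : Fin (n + 1) → V} (hv : ∀ k, v k ∈ U) (h : LinearIndependent ℝ v) : volForm B v ≠ 0 := by
  let v' : Fin (n + 1) → U := fun k => ⟨v k, hv k⟩
  have h1 : LinearIndependent ℝ v' := LinearIndependent.of_comp U.subtype h
  have h2 := h1.span_eq_top_of_card_eq_finrank
    (by rw [Module.finrank_eq_card_basis B])
  have h3 : IsUnit (B.det v') := (Module.Basis.is_basis_iff_det B).mp ⟨h1, h2⟩
  rw [← volForm_coe B v'] at h3
  exact h3.ne_zero

/-- If `U'` is the kernel in `U` of the functional `g`, the forms of `U` depend only on the sign of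
`g` in their first argument, when the others make up a basis of `U'`. -/
lemma sign_volForm_cons {n : ℕ} {U U' : Submodule ℝ V} (B : Module.Basis (Fin (n + 1)) ℝ U)
    (B' : Module.Basis (Fin n) ℝ U') (g : V →ₗ[ℝ] ℝ) (hU : ∀ x, x ∈ U' ↔ x ∈ U ∧ g x = 0)
    {u u' : V} (hu : u ∈ U) (hu' : u' ∈ U) (h : g u < 0) (h' : g u' < 0) :
    volForm B (Fin.cons u (vecs B')) ≠ 0 ∧
      SignType.sign (volForm B (Fin.cons u (vecs B'))) =
        SignType.sign (volForm B (Fin.cons u' (vecs B'))) := by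
  constructor
  · refine volForm_ne_zero B ?_ ?_
    · intro k
      refine Fin.cases hu (fun k => ((hU _).mp (vecs_mem B' k)).1) k
    · rw [linearIndependent_finCons, span_vecs]
      exact ⟨linearIndependent_vecs B', fun h1 => h.ne ((hU _).mp h1).2⟩
  · have h1 : u = (g u / g u') • u' + (u - (g u / g u') • u') := by abel
    have h2 : u - (g u / g u') • u' ∈ Submodule.span ℝ (Set.range (vecs B')) := by
      rw [span_vecs, hU]
      refine ⟨sub_mem hu (U.smul_mem _ hu'), ?_⟩
      rw [map_sub, map_smul, smul_eq_mul, div_mul_cancel₀ _ h'.ne, sub_self]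
    rw [h1, map_cons_smul_add, map_cons_of_mem_span _ h2, add_zero, sign_mul,
      sign_pos (div_pos_of_neg_of_neg h h'), one_mul]

end Volume

/-! ### Facets and incidence numbers -/

section Incidence

variable {ι X Y : Type*} [Finite ι] [AddCommGroup X] [AddCommGroup Y] {P : RootDatum ι X Y}
  {b : P.Base}

instance finiteDimensional_euclid (P : RootDatum ι X Y) : FiniteDimensional ℝ (euclid P) :=
  FiniteDimensional.span_of_finite ℝ (Set.finite_range _)

instance finiteDimensional_faceDir (P : RootDatum ι X Y) (J : Set (ι × ℤ)) :
    FiniteDimensional ℝ (faceDir P J) :=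
  Submodule.finiteDimensional_of_le (inf_le_left : faceDir P J ≤ euclid P)

lemma mem_faceDir_insert {J : Set (ι × ℤ)} {a : ι × ℤ} {x : ℝ ⊗[ℤ] X} :
    x ∈ faceDir P (insert a J) ↔ x ∈ faceDir P J ∧ corootR P a.1 x = 0 := by
  simp only [mem_faceDir, Set.mem_insert_iff, forall_eq_or_imp]
  tauto

lemma alcoveFace_nonempty_mono {J J' : Set (ι × ℤ)} (hJ' : J' ⊆ simpleAff b) (h : J ⊆ J')
    (hne : (alcoveFace b J').Nonempty) : (alcoveFace b J).Nonempty := by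
  rw [alcoveFace_nonempty_iff (h.trans hJ')]
  rw [alcoveFace_nonempty_iff hJ'] at hne
  intro t ht
  obtain ⟨a, ha, h1, h2⟩ := hne t ht
  exact ⟨a, ha, h1, fun h3 => h2 (h h3)⟩

lemma corootR_sub_neg {J J' : Set (ι × ℤ)} {a : ι × ℤ} (ha : a ∈ simpleAff b) (haJ : a ∉ J)
    (haJ' : a ∈ J') {x y : ℝ ⊗[ℤ] X} (hx : x ∈ alcoveFace b J) (hy : y ∈ alcoveFace b J') :
    corootR P a.1 (y - x) < 0 := by
  have h1 := hx.2.2 a ⟨ha, haJ⟩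
  have h2 := hy.2.1 a haJ'
  simp only [affEval] at h1 h2
  rw [map_sub]
  linarith

/-- The functional of `a` is strictly negative on a vector from the facet to its face. So it is
nonzero, and its kernel has codimension one. -/
lemma finrank_faceDir_insert {J : Set (ι × ℤ)} {a : ι × ℤ} (haJ : a ∉ J)
    (hJ : insert a J ⊆ simpleAff b) (hne : (alcoveFace b (insert a J)).Nonempty) :
    Module.finrank ℝ (faceDir P J) = Module.finrank ℝ (faceDir P (insert a J)) + 1 := by
  obtain ⟨y, hy⟩ := hne
  obtain ⟨x, hx⟩ := alcoveFace_nonempty_mono hJ (Set.subset_insert a J) ⟨y, hy⟩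
  let g : faceDir P J →ₗ[ℝ] ℝ := (corootR P a.1).comp (faceDir P J).subtype
  have hg : g ⟨y - x, sub_mem_faceDir (Set.subset_insert a J) hx hy⟩ < 0 :=
    corootR_sub_neg (hJ (Set.mem_insert a J)) haJ (Set.mem_insert a J) hx hy
  have h1 : LinearMap.range g = ⊤ := by
    refine LinearMap.range_eq_top.mpr (LinearMap.surjective fun h0 => ?_)
    rw [h0] at hg
    exact lt_irrefl _ hg
  have h2 := LinearMap.finrank_range_add_finrank_ker g
  rw [h1, finrank_top, Module.finrank_self] at h2
  have h3 : (LinearMap.ker g).map (faceDir P J).subtype = faceDir P (insert a J) := by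
    ext z
    rw [mem_faceDir_insert, Submodule.mem_map]
    constructor
    · rintro ⟨z, hz, rfl⟩
      exact ⟨z.2, hz⟩
    · rintro ⟨hz, hz'⟩
      exact ⟨⟨z, hz⟩, hz', rfl⟩
  rw [← h3, Submodule.finrank_map_subtype_eq, ← h2, add_comm]

namespace Facet

lemma eq_of_J_eq {n : ℕ} {f f' : Facet b n} (h : f.J = f'.J) : f = f' := by
  cases f
  cases f'
  cases h
  rfl

/-- The face of a facet on the wall of a further simple affine root. -/
def face {n : ℕ} (f : Facet b (n + 1)) (a : ι × ℤ) (ha : a ∈ simpleAff b) (haJ : a ∉ f.J)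
    (hne : (alcoveFace b (insert a f.J)).Nonempty) : Facet b n where
  J := insert a f.J
  subset := Set.insert_subset ha f.subset
  nonempty := hne
  dim := by
    have h := finrank_faceDir_insert haJ (Set.insert_subset ha f.subset) hne
    rw [f.dim] at h
    omega

/-- One additional wall already accounts for the drop in dimension, so the intermediate facet has
the direction of f'. A further wall would vanish on this direction, yet be negative on a vector from
the intermediate facet to f'. -/
lemma J_eq_insert {n : ℕ} {f : Facet b (n + 1)} {f' : Facet b n} (h : f.J ⊆ f'.J) {a : ι × ℤ}
    (ha : a ∈ f'.J) (haJ : a ∉ f.J) : f'.J = insert a f.J := by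
  have h1 : insert a f.J ⊆ f'.J := Set.insert_subset ha h
  refine h1.antisymm' fun c hc => ?_
  by_contra hcJ
  have hne := alcoveFace_nonempty_mono f'.subset h1 f'.nonempty
  let g := f.face a (f'.subset ha) haJ hne
  have h2 : faceDir P f'.J = faceDir P g.J :=
    Submodule.eq_of_le_of_finrank_le (faceDir_anti h1) (by rw [g.dim, f'.dim])
  obtain ⟨x, hx⟩ := g.nonempty
  obtain ⟨y, hy⟩ := f'.nonempty
  have h3 := sub_mem_faceDir h1 hx hy
  change y - x ∈ faceDir P g.J at h3
  rw [← h2, mem_faceDir] at h3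
  exact (corootR_sub_neg (f'.subset hc) hcJ hc hx hy).ne (h3.2 c hc)

lemma exists_J_eq_insert {n : ℕ} {f : Facet b (n + 1)} {f' : Facet b n} (h : f.J ⊆ f'.J) :
    ∃ a ∈ simpleAff b, a ∉ f.J ∧ f'.J = insert a f.J := by
  obtain ⟨a, ha, haJ⟩ : ∃ a ∈ f'.J, a ∉ f.J := by
    by_contra! h1
    have h2 : f.J = f'.J := h.antisymm h1
    have h3 := f.dim
    rw [h2, f'.dim] at h3
    omega
  exact ⟨a, f'.subset ha, haJ, J_eq_insert h ha haJ⟩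

end Facet

variable (o : Orientations b)

/-- The sign depends only on the side of the wall to which the first vector points. This frees the
incidence number from the chosen points and permits any convenient vector. -/
lemma incidence_spec {n : ℕ} {f : Facet b (n + 1)} {f' : Facet b n} {a : ι × ℤ} (haJ : a ∉ f.J)
    (h : f'.J = insert a f.J) {u : ℝ ⊗[ℤ] X} (hu : u ∈ faceDir P f.J) (hau : corootR P a.1 u < 0) :
    volForm (o (n + 1) f) (Fin.cons u (vecs (o n f'))) ≠ 0 ∧
      incidence o f f' = SignType.sign (volForm (o (n + 1) f) (Fin.cons u (vecs (o n f')))) := by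
  have hs : f.J ⊆ f'.J := h ▸ Set.subset_insert a f.J
  have ha : a ∈ f'.J := h ▸ Set.mem_insert a f.J
  have hU : ∀ x, x ∈ faceDir P f'.J ↔ x ∈ faceDir P f.J ∧ corootR P a.1 x = 0 := fun x => by
    rw [h]
    exact mem_faceDir_insert
  have hu0 := sub_mem_faceDir hs f.nonempty.some_mem f'.nonempty.some_mem
  have hau0 := corootR_sub_neg (f'.subset ha) haJ ha f.nonempty.some_mem f'.nonempty.some_mem
  obtain ⟨h1, h2⟩ := sign_volForm_cons (o (n + 1) f) (o n f') (corootR P a.1) hU hu hu0 hau hau0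
  refine ⟨h1, ?_⟩
  rw [h2, incidence, dif_pos hs, ← volForm_coe]
  congr 3
  ext k
  refine Fin.cases rfl (fun k => rfl) k

lemma exists_corootR_neg {n : ℕ} {f : Facet b (n + 1)} {f' : Facet b n} {a : ι × ℤ} (haJ : a ∉ f.J)
    (h : f'.J = insert a f.J) : ∃ u ∈ faceDir P f.J, corootR P a.1 u < 0 := by
  have ha : a ∈ f'.J := h ▸ Set.mem_insert a f.J
  exact ⟨_, sub_mem_faceDir (h ▸ Set.subset_insert a f.J) f.nonempty.some_mem f'.nonempty.some_mem,
    corootR_sub_neg (f'.subset ha) haJ ha f.nonempty.some_mem f'.nonempty.some_mem⟩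

lemma sign_mul_self_of_ne_zero {x : ℝ} (h : x ≠ 0) :
    (SignType.sign x : ℤ) * (SignType.sign x : ℤ) = 1 := by
  rcases lt_or_gt_of_ne h with h | h
  · simp [sign_neg h]
  · simp [sign_pos h]

lemma incidence_mul_self {n : ℕ} {f : Facet b (n + 1)} {f' : Facet b n} (h : f.J ⊆ f'.J) :
    incidence o f f' * incidence o f f' = 1 := by
  obtain ⟨a, -, haJ, ha⟩ := Facet.exists_J_eq_insert h
  obtain ⟨u, hu, hau⟩ := exists_corootR_neg haJ ha
  obtain ⟨h1, h2⟩ := incidence_spec o haJ ha hu hau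
  rw [h2]
  exact sign_mul_self_of_ne_zero h1

/-- Contracting the form of f with u gives a top form on the direction of f', hence a multiple of
the form of f'. The product of the two signs is thus the sign of one determinant. -/
lemma incidence_mul_incidence {n : ℕ} {f : Facet b (n + 2)} {f' : Facet b (n + 1)} {f'' : Facet b n}
    {a c : ι × ℤ} (ha : a ∉ f.J) (h : f'.J = insert a f.J) (hc : c ∉ f'.J)
    (h' : f''.J = insert c f'.J) {u v : ℝ ⊗[ℤ] X} (hu : u ∈ faceDir P f.J)
    (hau : corootR P a.1 u < 0) (hv : v ∈ faceDir P f'.J) (hcv : corootR P c.1 v < 0) :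
    incidence o f f' * incidence o f' f'' = SignType.sign
      (volForm (o (n + 2) f) (Fin.cons u (Fin.cons v (vecs (o n f''))))) := by
  rw [(incidence_spec o ha h hu hau).2, (incidence_spec o hc h' hv hcv).2]
  have h1 := eq_mul_volForm (o (n + 1) f') ((volForm (o (n + 2) f)).curryLeft u)
    (v := Fin.cons v (vecs (o n f''))) (by
      intro k
      refine Fin.cases hv (fun k => ?_) k
      have h2 : f'.J ⊆ f''.J := h' ▸ Set.subset_insert c f'.J
      exact faceDir_anti h2 (vecs_mem (o n f'') k))
  change volForm (o (n + 2) f) (Fin.cons u (Fin.cons v (vecs (o n f'')))) =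
    volForm (o (n + 2) f) (Fin.cons u (vecs (o (n + 1) f'))) * _ at h1
  rw [h1, sign_mul]
  exact (SignType.coe_mul _ _).symm

/-- The two paths from a facet to a face of codimension two have opposite signs. -/
lemma incidence_mul_incidence_add {n : ℕ} {f : Facet b (n + 2)} {f₁ f₂ : Facet b (n + 1)}
    {f'' : Facet b n} {a c : ι × ℤ} (ha : a ∉ f.J) (hc : c ∉ f.J) (hac : a ≠ c)
    (h₁ : f₁.J = insert a f.J) (h₂ : f₂.J = insert c f.J) (h : f''.J = insert c (insert a f.J)) :
    incidence o f f₁ * incidence o f₁ f'' + incidence o f f₂ * incidence o f₂ f'' = 0 := by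
  have hc₁ : c ∉ f₁.J := by simp [h₁, hc, hac.symm]
  have ha₂ : a ∉ f₂.J := by simp [h₂, ha, hac]
  have h₁'' : f''.J = insert c f₁.J := by rw [h, h₁]
  have h₂'' : f''.J = insert a f₂.J := by rw [h, h₂, Set.insert_comm]
  -- The vectors u and v are taken in the directions of f₂ and f₁, so that each is admissible along
  -- both paths. The two products are then the same determinant with its first two entries
  -- exchanged.
  obtain ⟨u, hu, hau⟩ := exists_corootR_neg ha₂ h₂''
  obtain ⟨v, hv, hcv⟩ := exists_corootR_neg hc₁ h₁''
  rw [incidence_mul_incidence o ha h₁ hc₁ h₁'' (faceDir_anti (h₂ ▸ Set.subset_insert c f.J) hu) hau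
    hv hcv, incidence_mul_incidence o hc h₂ ha₂ h₂''
    (faceDir_anti (h₁ ▸ Set.subset_insert a f.J) hv) hcv hu hau]
  have h3 := (volForm (o (n + 2) f)).map_swap (Fin.cons u (Fin.cons v (vecs (o n f''))))
    (i := 0) (j := 1) (by simp)
  have h4 : (Fin.cons u (Fin.cons v (vecs (o n f''))) : Fin (n + 2) → ℝ ⊗[ℤ] X) ∘
      Equiv.swap (0 : Fin (n + 2)) 1 = Fin.cons v (Fin.cons u (vecs (o n f''))) := by
    funext k
    refine Fin.cases (by simp) (fun k => Fin.cases (by simp) (fun k => ?_) k) k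
    rw [Function.comp_apply, Equiv.swap_apply_of_ne_of_ne]
    · rfl
    · exact Fin.succ_ne_zero _
    · exact fun h => Fin.succ_ne_zero _ (Fin.succ_injective _ h)
  rw [h4] at h3
  rw [h3, Left.sign_neg, SignType.coe_neg, add_neg_cancel]

/-! #### Vertices and edges -/

open Classical in
-- The linear part of the component relation, obtained by subtracting its value at the origin.
lemma sum_weight_mul_corootR {t : ι} (ht : IsMaxCoroot b t) (u : ℝ ⊗[ℤ] X) :
    ∑ a ∈ simpleFinset b with comp b a = t, weight b a * corootR P a.1 u = 0 := by
  have h1 := sum_weight_mul_affEval ht u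
  have h2 := sum_weight_mul_affEval ht (0 : ℝ ⊗[ℤ] X)
  simp only [affEval, mul_add, Finset.sum_add_distrib, map_zero,
    zero_add] at h1 h2
  linarith

lemma insert_nonempty_of_comp_eq {J : Set (ι × ℤ)} (hJ : J ⊆ simpleAff b)
    (hne : (alcoveFace b J).Nonempty) {a a' : ι × ℤ} (ha : a ∈ simpleAff b) (ha' : a' ∈ simpleAff b)
    (haJ' : a' ∉ J) (haa' : a ≠ a') (h : comp b a = comp b a') :
    (alcoveFace b (insert a J)).Nonempty := by
  rw [alcoveFace_nonempty_iff (Set.insert_subset ha hJ)]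
  rw [alcoveFace_nonempty_iff hJ] at hne
  intro t ht
  by_cases h1 : comp b a = t
  · exact ⟨a', ha', h ▸ h1, by simp [haa'.symm, haJ']⟩
  · obtain ⟨c, hc, h2, h3⟩ := hne t ht
    refine ⟨c, hc, h2, ?_⟩
    rw [Set.mem_insert_iff, not_or]
    exact ⟨fun h4 => h1 (h4 ▸ h2), h3⟩

open Classical in
/-- The vertices are the facets with only one wall in every component missing. -/
lemma finrank_faceDir_eq_zero_iff {J : Set (ι × ℤ)} (hJ : J ⊆ simpleAff b)
    (hne : (alcoveFace b J).Nonempty) :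
    Module.finrank ℝ (faceDir P J) = 0 ↔ ∀ a ∈ simpleAff b, a ∉ J → ∀ a' ∈ simpleAff b, a' ∉ J →
      comp b a = comp b a' → a = a' := by
  constructor
  · intro h a ha haJ a' ha' haJ' hc
    by_contra hne'
    have h1 := finrank_faceDir_insert haJ (Set.insert_subset ha hJ)
      (insert_nonempty_of_comp_eq hJ hne ha ha' haJ' hne' hc)
    omega
  · intro h
    have h0 : faceDir P J = ⊥ := by
      rw [eq_bot_iff]
      intro u hu
      rw [mem_faceDir] at hu
      refine eq_zero_of_mem_euclid b hu.1 fun i hi => ?_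
      have hi' := zero_mem_simpleAff hi
      by_cases hiJ : (i, (0 : ℤ)) ∈ J
      · exact hu.2 (i, 0) hiJ
      · have h1 := sum_weight_mul_corootR (isMaxCoroot_comp hi') u
        have hm : (i, (0 : ℤ)) ∈ (simpleFinset b).filter (fun a => comp b a = comp b (i, 0)) :=
          Finset.mem_filter.mpr ⟨mem_simpleFinset.mpr hi', rfl⟩
        rw [Finset.sum_eq_single_of_mem (i, 0) hm] at h1
        · exact (mul_eq_zero.mp h1).resolve_left (weight_pos hi').ne'
        · intro c hc hci
          rw [Finset.mem_filter, mem_simpleFinset] at hc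
          by_cases hcJ : c ∈ J
          · rw [hu.2 c hcJ, mul_zero]
          · exact absurd (h c hc.1 hcJ _ hi' hiJ hc.2) hci
    rw [h0, finrank_bot]

open Classical in
/-- An edge has exactly two vertices, and they have opposite signs. -/
lemma exists_vertices (f : Facet b 1) : ∃ f₁ f₂ : Facet b 0, f₁ ≠ f₂ ∧ f.J ⊆ f₁.J ∧ f.J ⊆ f₂.J ∧
    incidence o f f₁ + incidence o f f₂ = 0 ∧ ∀ f' : Facet b 0, f.J ⊆ f'.J → f' = f₁ ∨ f' = f₂ := by
  have h0 : ¬ Module.finrank ℝ (faceDir P f.J) = 0 := by rw [f.dim]; omega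
  rw [finrank_faceDir_eq_zero_iff f.subset f.nonempty] at h0
  push Not at h0
  obtain ⟨a, ha, haJ, c, hc, hcJ, hac, hne⟩ := h0
  let f₁ := f.face a ha haJ (insert_nonempty_of_comp_eq f.subset f.nonempty ha hc hcJ hne hac)
  let f₂ := f.face c hc hcJ
    (insert_nonempty_of_comp_eq f.subset f.nonempty hc ha haJ hne.symm hac.symm)
  have vert (f' : Facet b 0) := (finrank_faceDir_eq_zero_iff f'.subset f'.nonempty).mp f'.dim
  have hc₁ : c ∉ f₁.J := fun h => (Set.mem_insert_iff.mp h).elim (fun h => hne h.symm) hcJ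
  have h3 (d : ι × ℤ) (hd : d ∈ simpleAff b) (hdJ : d ∉ f.J) (hda : comp b d = comp b a)
      (hdne : d ≠ a) : d = c := by
    refine vert f₁ d hd (fun h => ?_) c hc hc₁ (hda.trans hac)
    exact (Set.mem_insert_iff.mp h).elim hdne hdJ
  refine ⟨f₁, f₂, ?_, Set.subset_insert a f.J, Set.subset_insert c f.J, ?_, ?_⟩
  · intro h
    exact hc₁ (h ▸ Set.mem_insert c f.J)
  · obtain ⟨u, hu, hau⟩ := exists_corootR_neg (f' := f₁) haJ rfl
    -- Along the edge only the walls `a` and `c` of this component vary. The linear relation has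
    -- positive weights, so c increases where a decreases, and -u points to the other vertex. The
    -- bases of the vertices are empty, so the two signs are those of the form at u and -u.
    have h1 := sum_weight_mul_corootR (isMaxCoroot_comp ha) u
    rw [Finset.sum_eq_add_of_mem a c (by simp [mem_simpleFinset, ha])
      (by simp [mem_simpleFinset, hc, hac]) hne] at h1
    · have h4 := mul_neg_of_pos_of_neg (weight_pos ha) hau
      have h5 : corootR P c.1 (-u) < 0 := by
        rw [map_neg, neg_lt_zero]
        refine pos_of_mul_pos_right (a := weight b c) ?_ (weight_pos hc).le
        linarith
      rw [(incidence_spec o (f' := f₁) haJ rfl hu hau).2,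
        (incidence_spec o (f' := f₂) hcJ rfl (neg_mem hu) h5).2]
      have h6 : -u = (-1 : ℝ) • u + 0 := by simp
      have h7 : vecs (o 0 f₂) = vecs (o 0 f₁) := Subsingleton.elim _ _
      rw [h6, map_cons_smul_add, map_cons_of_mem_span _ (zero_mem _), add_zero, h7, neg_one_mul,
        Left.sign_neg, SignType.coe_neg, add_neg_cancel]
    · rintro d hd ⟨hda, hdc⟩
      rw [Finset.mem_filter, mem_simpleFinset] at hd
      by_cases hdJ : d ∈ f.J
      · rw [(mem_faceDir.mp hu).2 d hdJ, mul_zero]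
      · exact absurd (h3 d hd.1 hdJ hd.2 hda) hdc
  · intro f' hf'
    obtain ⟨d, hd, hdJ, hf''⟩ := Facet.exists_J_eq_insert hf'
    by_cases hda : d = a
    · exact Or.inl (Facet.eq_of_J_eq (by rw [hf'', hda]; rfl))
    · by_cases hdc : d = c
      · exact Or.inr (Facet.eq_of_J_eq (by rw [hf'', hdc]; rfl))
      · refine absurd (vert f' a ha ?_ c hc ?_ hac) hne
        · rw [hf'']
          exact fun h => (Set.mem_insert_iff.mp h).elim (fun h => hda h.symm) haJ
        · rw [hf'']
          exact fun h => (Set.mem_insert_iff.mp h).elim (fun h => hdc h.symm) hcJ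

/-- There are no facets of dimension greater than the rank. -/
lemma isEmpty_facet {n : ℕ} (hn : b.support.card < n) : IsEmpty (Facet b n) := by
  refine ⟨fun f => ?_⟩
  have h1 : Module.finrank ℝ (faceDir P f.J) ≤ Module.finrank ℝ (euclid P) :=
    Submodule.finrank_mono inf_le_left
  have h2 : Module.finrank ℝ (euclid P) ≤ b.support.card := by
    rw [euclid_eq_span_support b]
    refine (finrank_range_le_card _).trans ?_
    rw [Fintype.card_coe]
  rw [f.dim] at h1
  omega

end Incidence

end

end AffineHecke

namespace AffineHecke

noncomputable section

set_option linter.unusedSectionVars false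

/-! ### The action of Ω on facets and orientations -/

section OmegaFacets

variable {ι X Y : Type*} [Finite ι] [AddCommGroup X] [AddCommGroup Y] {P : RootDatum ι X Y}
  [P.IsReduced] {b : P.Base}

lemma corootR_eq_of_support {x y : ℝ ⊗[ℤ] X} (h : ∀ i ∈ b.support, corootR P i x = corootR P i y)
    (i : ι) : corootR P i x = corootR P i y := by
  have key : ∀ z ∈ AddSubmonoid.closure (P.coroot '' b.support),
      coweight P z x = coweight P z y := by
    intro z hz
    induction hz using AddSubmonoid.closure_induction with
    | mem z hz =>
      obtain ⟨j, hj, rfl⟩ := hz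
      rw [coweight_coroot]
      exact h j hj
    | zero => simp
    | add z z' _ _ hz hz' => rw [map_add, LinearMap.add_apply, LinearMap.add_apply, hz, hz']
  rcases b.coroot_mem_or_neg_mem i with h1 | h1
  · simpa only [coweight_coroot] using key _ h1
  · have := key _ h1
    rw [map_neg, LinearMap.neg_apply, LinearMap.neg_apply, coweight_coroot] at this
    exact neg_injective this

lemma affAct_inv_image (w : ExtWeyl P) (J : Set (ι × ℤ)) : affAct w⁻¹ '' (affAct w '' J) = J := by
  rw [Set.image_image]
  simp only [affAct_inv_affAct, Set.image_id']

lemma affAct_image_inv (w : ExtWeyl P) (J : Set (ι × ℤ)) : affAct w '' (affAct w⁻¹ '' J) = J := by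
  rw [Set.image_image]
  simp only [affAct_affAct_inv, Set.image_id']

lemma affAct_image_mul (w v : ExtWeyl P) (J : Set (ι × ℤ)) :
    affAct (w * v) '' J = affAct w '' (affAct v '' J) := by
  rw [Set.image_image]
  simp only [affAct_mul]

lemma affAct_image_subset {w : ExtWeyl P} (hw : w ∈ Omega b) {J : Set (ι × ℤ)}
    (hJ : J ⊆ simpleAff b) : affAct w '' J ⊆ simpleAff b := by
  rintro _ ⟨a, ha, rfl⟩
  exact affAct_mem_simpleAff hw (hJ ha)

/-- The image of a point of E under W may leave E in central directions. It is replaced by the point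
of E with the same values at the simple coroots, which is its projection. -/
lemma alcoveFace_image_nonempty {w : ExtWeyl P} (hw : w ∈ Omega b) {J : Set (ι × ℤ)}
    (hne : (alcoveFace b J).Nonempty) : (alcoveFace b (affAct w '' J)).Nonempty := by
  obtain ⟨x, hx⟩ := hne
  obtain ⟨y, hy, hxy⟩ := exists_mem_euclid b fun i => corootR P i (affPt w x)
  have key (a : ι × ℤ) : affEval P (affAct w a) y = affEval P a x := by
    rw [← affEval_affAct_affPt w a x, affEval, affEval, corootR_eq_of_support hxy]
  refine ⟨y, hy, ?_, ?_⟩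
  · rintro _ ⟨a, ha, rfl⟩
    rw [key, hx.2.1 a ha]
  · rintro a ⟨ha, haJ⟩
    rw [← affAct_affAct_inv w a, key]
    refine hx.2.2 _ ⟨affAct_mem_simpleAff (inv_mem_Omega hw) ha, fun h => haJ ?_⟩
    exact ⟨_, h, affAct_affAct_inv w a⟩

lemma linPart_injective (w : ExtWeyl P) : Function.Injective (linPart w) := by
  refine Function.LeftInverse.injective (g := linPart w⁻¹) fun x => ?_
  rw [← linPart_mul, inv_mul_cancel, linPart_one]

lemma finrank_faceDir_image (w : ExtWeyl P) (J : Set (ι × ℤ)) :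
    Module.finrank ℝ (faceDir P (affAct w '' J)) = Module.finrank ℝ (faceDir P J) := by
  have h1 (w : ExtWeyl P) (J : Set (ι × ℤ)) :
      Module.finrank ℝ (faceDir P J) ≤ Module.finrank ℝ (faceDir P (affAct w '' J)) := by
    refine LinearMap.finrank_le_finrank_of_injective
      (f := (linPart w).restrict fun x hx => linPart_mem_faceDir w hx) fun x y hxy => ?_
    exact Subtype.ext (linPart_injective w (congrArg Subtype.val hxy))
  refine le_antisymm ?_ (h1 w J)
  have h2 := h1 w⁻¹ (affAct w '' J)
  rwa [affAct_inv_image] at h2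

namespace Facet

/-- The action of `Ω` on the facets. -/
def map {w : ExtWeyl P} (hw : w ∈ Omega b) {n : ℕ} (f : Facet b n) : Facet b n where
  J := affAct w '' f.J
  subset := affAct_image_subset hw f.subset
  nonempty := alcoveFace_image_nonempty hw f.nonempty
  dim := by rw [finrank_faceDir_image, f.dim]

/-- The action of `Ω` on the facets, as a permutation. -/
def perm {w : ExtWeyl P} (hw : w ∈ Omega b) (n : ℕ) : Equiv.Perm (Facet b n) where
  toFun := map hw
  invFun := map (inv_mem_Omega hw)
  left_inv f := eq_of_J_eq (affAct_inv_image w f.J)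
  right_inv f := eq_of_J_eq (affAct_image_inv w f.J)

lemma image_J {w : ExtWeyl P} (hw : w ∈ Omega b) {n : ℕ} (f : Facet b n) :
    affAct w '' f.J = (perm hw n f).J := rfl

end Facet

variable (o : Orientations b)

lemma orientSign_eq {w : ExtWeyl P} {n : ℕ} {f f' : Facet b n} (h : affAct w '' f.J = f'.J) :
    orientSign o w f f' =
      SignType.sign (volForm (o n f') fun k => linPart w (vecs (o n f) k)) := by
  rw [orientSign, dif_pos h, ← volForm_coe]
  rfl

lemma linPart_vecs_mem {w : ExtWeyl P} {n : ℕ} {f f' : Facet b n} (h : affAct w '' f.J = f'.J)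
    (k : Fin n) : linPart w (vecs (o n f) k) ∈ faceDir P f'.J :=
  h ▸ linPart_mem_faceDir w (vecs_mem (o n f) k)

lemma orientSign_mul {w v : ExtWeyl P} {n : ℕ} {f f' f'' : Facet b n}
    (h : affAct v '' f.J = f'.J) (h' : affAct w '' f'.J = f''.J) :
    orientSign o (w * v) f f'' = orientSign o w f' f'' * orientSign o v f f' := by
  rw [orientSign_eq o h, orientSign_eq o h',
    orientSign_eq o (f := f) (f' := f'') (by rw [affAct_image_mul, h, h'])]
  have h1 := eq_mul_volForm (o n f') ((volForm (o n f'')).compLinearMap (linPart w))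
    (linPart_vecs_mem o h)
  simp only [linPart_mul]
  refine (congrArg (fun x : ℝ => ((SignType.sign x : SignType) : ℤ)) h1).trans ?_
  rw [sign_mul]
  exact SignType.coe_mul _ _

lemma orientSign_of_mem_center {z : ExtWeyl P} (hz : z ∈ Subgroup.center (ExtWeyl P)) {n : ℕ}
    (f : Facet b n) : orientSign o z f f = 1 := by
  have h (a : ι × ℤ) := affAct_of_mem_center hz a
  have h1 : affAct z '' f.J = f.J := by simp only [h, Set.image_id']
  rw [orientSign_eq o h1]
  simp only [linPart_of_right_eq_one (right_eq_one_of_affAct h)]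
  have h2 := volForm_vecs (o n f)
  change ((SignType.sign (volForm (o n f) (vecs (o n f)))) : ℤ) = 1
  rw [h2, sign_one, SignType.coe_one]

lemma orientSign_mul_self {w : ExtWeyl P} {n : ℕ} {f f' : Facet b n} (h : affAct w '' f.J = f'.J) :
    orientSign o w f f' * orientSign o w f f' = 1 := by
  have h' : affAct w⁻¹ '' f'.J = f.J := by rw [← h, affAct_inv_image]
  have h1 := orientSign_mul o h h'
  rw [inv_mul_cancel, orientSign_of_mem_center o (one_mem _)] at h1
  rw [orientSign_eq o h]
  refine sign_mul_self_of_ne_zero fun h2 => ?_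
  rw [orientSign_eq o h, h2] at h1
  simp at h1

/-- Both products are the sign of one determinant: the form of F on the images under w of the vector
u and of the basis of f'. One side factors it through the basis of F', the other through the basis
of f. -/
lemma incidence_mul_orientSign {w : ExtWeyl P} {n : ℕ} {f F : Facet b (n + 1)} {f' F' : Facet b n}
    (hs : f.J ⊆ f'.J) (h : affAct w '' f.J = F.J) (h' : affAct w '' f'.J = F'.J) :
    incidence o F F' * orientSign o w f' F' = orientSign o w f F * incidence o f f' := by
  obtain ⟨a, -, haJ, ha⟩ := Facet.exists_J_eq_insert hs
  obtain ⟨u, hu, hau⟩ := exists_corootR_neg haJ ha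
  have haJ' : affAct w a ∉ F.J := by
    rw [← h]
    rintro ⟨c, hc, hca⟩
    exact haJ (affAct_injective w hca ▸ hc)
  have ha' : F'.J = insert (affAct w a) F.J := by rw [← h', ha, Set.image_insert_eq, h]
  have hu' : linPart w u ∈ faceDir P F.J := h ▸ linPart_mem_faceDir w hu
  have hau' : corootR P (affAct w a).1 (linPart w u) < 0 := by
    rw [affAct, corootR_linPart]
    exact hau
  rw [(incidence_spec o haJ ha hu hau).2, (incidence_spec o haJ' ha' hu' hau').2,
    orientSign_eq o h, orientSign_eq o h', ← SignType.coe_mul, ← SignType.coe_mul, ← sign_mul,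
    ← sign_mul]
  have h1 := eq_mul_volForm (o n F') ((volForm (o (n + 1) F)).curryLeft (linPart w u))
    (linPart_vecs_mem o h')
  have h2 := eq_mul_volForm (o (n + 1) f) ((volForm (o (n + 1) F)).compLinearMap (linPart w))
    (v := Fin.cons u (vecs (o n f'))) (by
      refine fun k => Fin.cases hu (fun k => ?_) k
      exact faceDir_anti hs (vecs_mem (o n f') k))
  have h3 : (fun k => linPart w ((Fin.cons u (vecs (o n f')) : Fin (n + 1) → ℝ ⊗[ℤ] X) k)) =
      Fin.cons (linPart w u) fun k => linPart w (vecs (o n f') k) := by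
    funext k
    exact Fin.cases rfl (fun k => rfl) k
  have h4 : volForm (o (n + 1) F) (Fin.cons (linPart w u) fun k => linPart w (vecs (o n f') k)) =
      volForm (o (n + 1) F) (Fin.cons (linPart w u) (vecs (o n F'))) *
        volForm (o n F') fun k => linPart w (vecs (o n f') k) := h1
  have h5 : volForm (o (n + 1) F)
      (fun k => linPart w ((Fin.cons u (vecs (o n f')) : Fin (n + 1) → ℝ ⊗[ℤ] X) k)) =
      volForm (o (n + 1) F) (fun k => linPart w (vecs (o (n + 1) f) k)) *
        volForm (o (n + 1) f) (Fin.cons u (vecs (o n f'))) := h2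
  rw [h3] at h5
  rw [← h4, ← h5]

lemma orientSign_zero {w : ExtWeyl P} {f f' : Facet b 0} (h : affAct w '' f.J = f'.J) :
    orientSign o w f f' = 1 := by
  rw [orientSign_eq o h, Subsingleton.elim (fun k => linPart w (vecs (o 0 f) k)) (vecs (o 0 f')),
    volForm_vecs, sign_one, SignType.coe_one]

end OmegaFacets

/-! ### The action of Ω on the complex and its factorization through Ω/Z(W) -/

section OmegaAction

variable {ι X Y : Type*} [Finite ι] [AddCommGroup X] [AddCommGroup Y] {P : RootDatum ι X Y}
  [P.IsReduced] {b : P.Base} {q : ExtWeyl P → ℝ} (o : Orientations b)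

instance fintypeFacet (b : P.Base) (n : ℕ) : Fintype (Facet b n) := Fintype.ofFinite _

open Classical in
lemma diff_apply {n : ℕ} (p : PMod b q (n + 1)) (f' : Facet b n) :
    diff q o n p f' = ∑ f : Facet b (n + 1),
      if h : f.J ⊆ f'.J then incidence o f f' • BalTensor.factor b q h (p f) else 0 := by
  rw [diff, LinearMap.pi_apply, LinearMap.sum_apply]
  refine Finset.sum_congr rfl fun f _ => ?_
  split_ifs <;> rfl

lemma augmentation_apply (p : PMod b q 0) :
    augmentation b q p = ∑ f : Facet b 0, mulMap b q f.J (p f) := by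
  rw [augmentation, LinearMap.sum_apply]
  rfl

lemma omegaAct_apply (w : Omega b) {n : ℕ} (p : PMod b q n) {f f' : Facet b n}
    (h : affAct w.1 '' f.J = f'.J) :
    omegaAct q o w n p f' = orientSign o w.1 f f' • BalTensor.twist b q w.2 h (p f) := by
  rw [omegaAct, LinearMap.pi_apply, LinearMap.sum_apply, Finset.sum_eq_single_of_mem f
    (Finset.mem_univ f)]
  · rw [dif_pos h]
    rfl
  · intro g _ hg
    rw [dif_neg]
    · rfl
    · intro h'
      refine hg (Facet.eq_of_J_eq ?_)
      rw [← affAct_inv_image w.1 g.J, h', ← h, affAct_inv_image]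

lemma BalTensor.twist_factor {w : ExtWeyl P} (hw : w ∈ Omega b) {J J' K K' : Set (ι × ℤ)}
    (h : J ⊆ J') (h' : K ⊆ K') (hK : affAct w '' J = K) (hK' : affAct w '' J' = K')
    (m : BalTensor b q J) : BalTensor.factor b q h' (BalTensor.twist b q hw hK m) =
      BalTensor.twist b q hw hK' (BalTensor.factor b q h m) := by
  induction m using BalTensor.induction with
  | zero => simp
  | tmul g g' => simp only [BalTensor.twist_tmul, BalTensor.factor_tmul]
  | add m m' hm hm' => simp only [map_add, hm, hm']

lemma BalTensor.twist_mul {w v : ExtWeyl P} (hw : w ∈ Omega b) (hv : v ∈ Omega b)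
    (hwv : w * v ∈ Omega b) {J J' K : Set (ι × ℤ)} (h : affAct v '' J = J')
    (h' : affAct w '' J' = K) (hK : affAct (w * v) '' J = K) (m : BalTensor b q J) :
    BalTensor.twist b q hw h' (BalTensor.twist b q hv h m) = BalTensor.twist b q hwv hK m := by
  induction m using BalTensor.induction with
  | zero => simp
  | tmul g g' =>
    rw [BalTensor.twist_tmul, BalTensor.twist_tmul, BalTensor.twist_tmul, mul_inv_rev, mul_assoc,
      T_Omega_mul (inv_mem_Omega hv), ← mul_assoc, T_Omega_mul hw]
  | add m m' hm hm' => simp only [map_add, hm, hm']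

/-- For central z, T_z lies in the subalgebra over which the tensor product is balanced, so it
crosses the tensor sign and cancels. -/
lemma BalTensor.twist_of_mem_center {z : ExtWeyl P} (hz : z ∈ Subgroup.center (ExtWeyl P))
    (hzO : z ∈ Omega b) {J : Set (ι × ℤ)} (h : affAct z '' J = J) (m : BalTensor b q J) :
    BalTensor.twist b q hzO h m = m := by
  induction m using BalTensor.induction with
  | zero => simp
  | tmul g g' =>
    rw [BalTensor.twist_tmul, ← BalTensor.mul_tmul (T_mem_subJ_of_center hz), mul_assoc,
      T_inv_mul_T b q hzO, mul_one]
  | add m m' hm hm' => simp only [map_add, hm, hm']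

lemma mulMap_twist {w : ExtWeyl P} (hw : w ∈ Omega b) {J J' : Set (ι × ℤ)}
    (h : affAct w '' J = J') (m : BalTensor b q J) :
    mulMap b q J' (BalTensor.twist b q hw h m) = mulMap b q J m := by
  induction m using BalTensor.induction with
  | zero => simp
  | tmul g g' =>
    rw [BalTensor.twist_tmul, mulMap_tmul, mulMap_tmul, mul_assoc, ← mul_assoc (T b q w⁻¹),
      T_inv_mul_T b q hw, one_mul]
  | add m m' hm hm' => simp only [map_add, hm, hm']

lemma mulMap_factor {J J' : Set (ι × ℤ)} (h : J ⊆ J') (m : BalTensor b q J) :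
    mulMap b q J' (BalTensor.factor b q h m) = mulMap b q J m := by
  induction m using BalTensor.induction with
  | zero => simp
  | tmul g g' => rw [BalTensor.factor_tmul, mulMap_tmul, mulMap_tmul]
  | add m m' hm hm' => simp only [map_add, hm, hm']

lemma diff_omegaAct (w : Omega b) {n : ℕ} (p : PMod b q (n + 1)) :
    diff q o n (omegaAct q o w (n + 1) p) = omegaAct q o w n (diff q o n p) := by
  classical
  funext F'
  obtain ⟨f', rfl⟩ := (Facet.perm w.2 n).surjective F'
  rw [omegaAct_apply o w (diff q o n p) (f := f') rfl, diff_apply, diff_apply, map_sum,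
    Finset.smul_sum, ← Equiv.sum_comp (Facet.perm w.2 (n + 1))]
  refine Finset.sum_congr rfl fun f _ => ?_
  by_cases h : f.J ⊆ f'.J
  · have h' : (Facet.perm w.2 (n + 1) f).J ⊆ (Facet.perm w.2 n f').J := Set.image_mono h
    rw [dif_pos h, dif_pos h', omegaAct_apply o w p (f := f) rfl, map_zsmul, map_zsmul, smul_smul,
      smul_smul, BalTensor.twist_factor w.2 h h' rfl rfl]
    congr 1
    have h1 := incidence_mul_orientSign o (w := w.1) (F := Facet.perm w.2 (n + 1) f)
      (F' := Facet.perm w.2 n f') h rfl rfl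
    have h2 := orientSign_mul_self o (w := w.1) (f := f) (f' := Facet.perm w.2 (n + 1) f) rfl
    have h3 := orientSign_mul_self o (w := w.1) (f := f') (f' := Facet.perm w.2 n f') rfl
    -- The orientation signs are ±1. Multiplying the equivariance of the incidence numbers by both
    -- of them moves each sign to the other side.
    linear_combination (orientSign o w.1 f (Facet.perm w.2 (n + 1) f) *
      orientSign o w.1 f' (Facet.perm w.2 n f')) * h1 -
      orientSign o w.1 f (Facet.perm w.2 (n + 1) f) *
        incidence o (Facet.perm w.2 (n + 1) f) (Facet.perm w.2 n f') * h3 +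
      orientSign o w.1 f' (Facet.perm w.2 n f') * incidence o f f' * h2
  · have h' : ¬ (Facet.perm w.2 (n + 1) f).J ⊆ (Facet.perm w.2 n f').J :=
      fun h1 => h ((Set.image_subset_image_iff (affAct_injective w.1)).mp h1)
    rw [dif_neg h, dif_neg h', map_zero, smul_zero]

lemma augmentation_omegaAct (w : Omega b) (p : PMod b q 0) :
    augmentation b q (omegaAct q o w 0 p) = augmentation b q p := by
  rw [augmentation_apply, augmentation_apply, ← Equiv.sum_comp (Facet.perm w.2 0)]
  refine Finset.sum_congr rfl fun f _ => ?_
  rw [omegaAct_apply o w p (Facet.image_J w.2 f), orientSign_zero o rfl, one_smul, mulMap_twist]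

lemma omegaAct_mul (w v wv : Omega b) (h : wv.1 = w.1 * v.1) {n : ℕ} (p : PMod b q n) :
    omegaAct q o w n (omegaAct q o v n p) = omegaAct q o wv n p := by
  obtain ⟨_, hwv⟩ := wv
  obtain rfl : _ = w.1 * v.1 := h
  funext F
  obtain ⟨F, rfl⟩ := (Facet.perm w.2 n).surjective F
  obtain ⟨f, rfl⟩ := (Facet.perm v.2 n).surjective F
  have h1 : affAct (w.1 * v.1) '' f.J = (Facet.perm w.2 n (Facet.perm v.2 n f)).J :=
    affAct_image_mul _ _ _
  rw [omegaAct_apply o w _ (Facet.image_J w.2 (Facet.perm v.2 n f)),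
    omegaAct_apply o v p (Facet.image_J v.2 f),
    omegaAct_apply o ⟨w.1 * v.1, hwv⟩ p h1, map_zsmul, smul_smul,
    BalTensor.twist_mul w.2 v.2 hwv (Facet.image_J v.2 f)
      (Facet.image_J w.2 (Facet.perm v.2 n f)) h1,
    orientSign_mul o (Facet.image_J v.2 f) (Facet.image_J w.2 (Facet.perm v.2 n f))]

lemma omegaAct_of_mem_center (z : Omega b) (hz : z.1 ∈ Subgroup.center (ExtWeyl P)) {n : ℕ}
    (p : PMod b q n) : omegaAct q o z n p = p := by
  funext f
  have h : affAct z.1 '' f.J = f.J := by simp only [affAct_of_mem_center hz, Set.image_id']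
  rw [omegaAct_apply o z p h, orientSign_of_mem_center o hz, one_smul,
    BalTensor.twist_of_mem_center hz]

/-- `Ω` as a subgroup of `W`. -/
def omegaSub (b : P.Base) : Subgroup (ExtWeyl P) where
  carrier := Omega b
  one_mem' := one_mem_Omega b
  mul_mem' {_ v} hw hv := (length_Omega_mul hw v).trans hv
  inv_mem' hw := inv_mem_Omega hw

/-- The members of `omegaSub` as elements of the set `Ω`. -/
def toOmega (w : omegaSub b) : Omega b := ⟨w.1, w.2⟩

/-- The centre of `W` as a subgroup of `Ω`. -/
abbrev centerOmega (b : P.Base) : Subgroup (omegaSub b) :=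
  (Subgroup.center (ExtWeyl P)).subgroupOf (omegaSub b)

/-- Ω permutes the finite set of simple affine roots, and an element fixing all of them is central.
Finiteness is what makes averaging possible. -/
instance finite_omegaSub_quotient (b : P.Base) : Finite (omegaSub b ⧸ centerOmega b) := by
  have : Finite (simpleAff b) := (simpleAff_finite b).to_subtype
  let g : omegaSub b ⧸ centerOmega b → (simpleAff b → simpleAff b) := fun c a =>
    ⟨affAct c.out.1 a.1, affAct_mem_simpleAff c.out.2 a.2⟩
  refine Finite.of_injective g fun c d h => ?_
  rw [← QuotientGroup.out_eq' c, ← QuotientGroup.out_eq' d, QuotientGroup.eq,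
    Subgroup.mem_subgroupOf]
  refine mem_center_of_affAct_simple (b := b) fun a ha => ?_
  have h1 : affAct c.out.1 a = affAct d.out.1 a := congrArg Subtype.val (congrFun h ⟨a, ha⟩)
  change affAct (c.out.1⁻¹ * d.out.1) a = a
  rw [affAct_mul, ← h1, affAct_inv_affAct]

instance fintype_omegaSub_quotient (b : P.Base) : Fintype (omegaSub b ⧸ centerOmega b) :=
  Fintype.ofFinite _

/-- The action of `Ω / Z(W)` on `P_n(H)`. -/
def quotAct (q : ExtWeyl P → ℝ) (o : Orientations b) (n : ℕ) (c : omegaSub b ⧸ centerOmega b) :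
    PMod b q n →ₗ[Env b q] PMod b q n := omegaAct q o (toOmega c.out) n

/-- Two representatives differ by a central element, and this acts trivially both on orientations
and on the balanced tensor products. -/
lemma quotAct_mk (n : ℕ) (w : omegaSub b) (p : PMod b q n) :
    quotAct q o n (w : omegaSub b ⧸ centerOmega b) p = omegaAct q o (toOmega w) n p := by
  have h := QuotientGroup.eq.mp (QuotientGroup.out_eq' (w : omegaSub b ⧸ centerOmega b))
  rw [Subgroup.mem_subgroupOf] at h
  set v := (w : omegaSub b ⧸ centerOmega b).out
  rw [quotAct, ← omegaAct_mul o (toOmega v) (toOmega (v⁻¹ * w)) (toOmega w)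
    (congrArg Subtype.val (mul_inv_cancel_left v w).symm), omegaAct_of_mem_center o (toOmega (v⁻¹ * w)) h]

lemma omegaAct_quotAct (n : ℕ) (w : omegaSub b) (c : omegaSub b ⧸ centerOmega b) (p : PMod b q n) :
    omegaAct q o (toOmega w) n (quotAct q o n c p) =
      quotAct q o n ((w : omegaSub b ⧸ centerOmega b) * c) p := by
  obtain ⟨v, rfl⟩ := QuotientGroup.mk_surjective c
  rw [← QuotientGroup.mk_mul, quotAct_mk, quotAct_mk, omegaAct_mul o (toOmega w) (toOmega v) (toOmega (w * v)) rfl]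

lemma quotAct_omegaAct (n : ℕ) (w : omegaSub b) (c : omegaSub b ⧸ centerOmega b) (p : PMod b q n) :
    quotAct q o n c (omegaAct q o (toOmega w) n p) =
      quotAct q o n (c * (w : omegaSub b ⧸ centerOmega b)) p := by
  obtain ⟨v, rfl⟩ := QuotientGroup.mk_surjective c
  rw [← QuotientGroup.mk_mul, quotAct_mk, quotAct_mk, omegaAct_mul o (toOmega v) (toOmega w) (toOmega (v * w)) rfl]

lemma mem_PInv {n : ℕ} {p : PMod b q n} :
    p ∈ PInv q o n ↔ ∀ w : Omega b, omegaAct q o w n p = p := by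
  simp [PInv]

end OmegaAction

/-! #### Averaging over `Ω` -/

section Scalar

variable {A M N : Type*} [Ring A] [Algebra ℂ A] [AddCommGroup M] [Module A M] [AddCommGroup N]
  [Module A N]

/-- Multiplication by a scalar on a module over an algebra. -/
def scalarMul (A M : Type*) [Ring A] [Algebra ℂ A] [AddCommGroup M] [Module A M] (r : ℂ) :
    M →ₗ[A] M where
  toFun m := algebraMap ℂ A r • m
  map_add' := smul_add _
  map_smul' a m := by
    rw [smul_smul, Algebra.commutes, ← smul_smul]
    rfl

lemma scalarMul_apply (r : ℂ) (m : M) : scalarMul A M r m = algebraMap ℂ A r • m := rfl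

lemma map_scalarMul (f : M →ₗ[A] N) (r : ℂ) (m : M) :
    f (scalarMul A M r m) = scalarMul A N r (f m) := f.map_smul _ m

lemma scalarMul_inv_nsmul {k : ℕ} (hk : k ≠ 0) (m : M) :
    scalarMul A M (k : ℂ)⁻¹ (k • m) = m := by
  have h : k • m = algebraMap ℂ A k • m := by
    rw [map_natCast, Nat.cast_smul_eq_nsmul]
  rw [h, scalarMul_apply, smul_smul, ← map_mul, inv_mul_cancel₀ (by exact_mod_cast hk), map_one,
    one_smul]

end Scalar

section Average

variable {ι X Y : Type*} [Finite ι] [AddCommGroup X] [AddCommGroup Y] {P : RootDatum ι X Y}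
  [P.IsReduced] {b : P.Base} (q : ExtWeyl P → ℝ) (o : Orientations b)

/-- The projection of `P_n(H)` to the invariants. -/
def average (n : ℕ) : PMod b q n →ₗ[Env b q] PMod b q n :=
  scalarMul (Env b q) (PMod b q n) (Fintype.card (omegaSub b ⧸ centerOmega b) : ℂ)⁻¹ ∘ₗ
    ∑ c, quotAct q o n c

lemma average_apply {n : ℕ} (p : PMod b q n) : average q o n p =
    scalarMul (Env b q) (PMod b q n) (Fintype.card (omegaSub b ⧸ centerOmega b) : ℂ)⁻¹
      (∑ c, quotAct q o n c p) := by
  rw [average, LinearMap.comp_apply, LinearMap.sum_apply]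

lemma average_mem {n : ℕ} (p : PMod b q n) : average q o n p ∈ PInv q o n := by
  rw [mem_PInv]
  intro w
  have h := Equiv.sum_comp (Equiv.mulLeft ((⟨w.1, w.2⟩ : omegaSub b) : omegaSub b ⧸ centerOmega b))
    fun c => quotAct q o n c p
  rw [average_apply, map_scalarMul, map_sum, ← h]
  congr 1
  exact Finset.sum_congr rfl fun c _ => omegaAct_quotAct o n ⟨w.1, w.2⟩ c p

lemma average_of_mem {n : ℕ} {p : PMod b q n} (hp : p ∈ PInv q o n) : average q o n p = p := by
  rw [mem_PInv] at hp
  rw [average_apply, Finset.sum_congr rfl fun c _ => hp (toOmega c.out), Finset.sum_const,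
    Finset.card_univ, scalarMul_inv_nsmul Fintype.card_ne_zero]

lemma average_omegaAct (w : Omega b) {n : ℕ} (p : PMod b q n) :
    average q o n (omegaAct q o w n p) = average q o n p := by
  have h := Equiv.sum_comp (Equiv.mulRight ((⟨w.1, w.2⟩ : omegaSub b) : omegaSub b ⧸ centerOmega b))
    fun c => quotAct q o n c p
  rw [average_apply, average_apply, ← h]
  congr 1
  exact Finset.sum_congr rfl fun c _ => quotAct_omegaAct o n ⟨w.1, w.2⟩ c p

lemma diff_average {n : ℕ} (p : PMod b q (n + 1)) :
    diff q o n (average q o (n + 1) p) = average q o n (diff q o n p) := by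
  rw [average_apply, average_apply, map_scalarMul, map_sum]
  congr 1
  exact Finset.sum_congr rfl fun c _ => diff_omegaAct o _ p

lemma augmentation_average (p : PMod b q 0) :
    augmentation b q (average q o 0 p) = augmentation b q p := by
  rw [average_apply, map_scalarMul, map_sum,
    Finset.sum_congr rfl fun c _ => augmentation_omegaAct o (toOmega c.out) p, Finset.sum_const,
    Finset.card_univ, scalarMul_inv_nsmul Fintype.card_ne_zero]

/-! #### The composites of the differentials -/

/-- A face of codimension two arises by adding two walls, in either order. The two intermediate
facets are the only ones, and their signs cancel. -/
lemma exists_intermediate {n : ℕ} {f : Facet b (n + 2)} {f'' : Facet b n} (h : f.J ⊆ f''.J) :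
    ∃ f₁ f₂ : Facet b (n + 1), f₁ ≠ f₂ ∧ (f.J ⊆ f₁.J ∧ f₁.J ⊆ f''.J) ∧
      (f.J ⊆ f₂.J ∧ f₂.J ⊆ f''.J) ∧
      incidence o f f₁ * incidence o f₁ f'' + incidence o f f₂ * incidence o f₂ f'' = 0 ∧
      ∀ f' : Facet b (n + 1), f.J ⊆ f'.J → f'.J ⊆ f''.J → f' = f₁ ∨ f' = f₂ := by
  have hface (a : ι × ℤ) (ha : a ∈ f''.J) (haJ : a ∉ f.J) :
      ∃ g : Facet b (n + 1), g.J = insert a f.J ∧ f.J ⊆ g.J ∧ g.J ⊆ f''.J :=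
    ⟨f.face a (f''.subset ha) haJ (alcoveFace_nonempty_mono f''.subset (Set.insert_subset ha h)
      f''.nonempty), rfl, Set.subset_insert a f.J, Set.insert_subset ha h⟩
  obtain ⟨a, ha, haJ⟩ : ∃ a ∈ f''.J, a ∉ f.J := by
    by_contra! h1
    have h2 : f.J = f''.J := h.antisymm h1
    have h3 := f.dim
    rw [h2, f''.dim] at h3
    omega
  obtain ⟨f₁, h₁, h₁s, h₁s'⟩ := hface a ha haJ
  obtain ⟨c, -, hc₁, hc⟩ := Facet.exists_J_eq_insert h₁s'
  have hc'' : c ∈ f''.J := hc ▸ Set.mem_insert c f₁.J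
  rw [h₁, Set.mem_insert_iff, not_or] at hc₁
  rw [h₁] at hc
  obtain ⟨f₂, h₂, h₂s, h₂s'⟩ := hface c hc'' hc₁.2
  refine ⟨f₁, f₂, ?_, ⟨h₁s, h₁s'⟩, ⟨h₂s, h₂s'⟩,
    incidence_mul_incidence_add o haJ hc₁.2 (Ne.symm hc₁.1) h₁ h₂ hc, ?_⟩
  · rintro rfl
    have h3 : c ∈ insert a f.J := by rw [← h₁, h₂]; exact Set.mem_insert c f.J
    exact (Set.mem_insert_iff.mp h3).elim hc₁.1 hc₁.2
  · intro f' hf hf'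
    obtain ⟨d, -, hdJ, hd⟩ := Facet.exists_J_eq_insert hf
    have hd'' : d ∈ f''.J := hf' (hd ▸ Set.mem_insert d f.J)
    rw [hc] at hd''
    rcases hd'' with rfl | rfl | h3
    · exact Or.inr (Facet.eq_of_J_eq (hd.trans h₂.symm))
    · exact Or.inl (Facet.eq_of_J_eq (hd.trans h₁.symm))
    · exact absurd h3 hdJ

lemma BalTensor.factor_factor {J J' J'' : Set (ι × ℤ)} (h : J ⊆ J') (h' : J' ⊆ J'')
    (m : BalTensor b q J) : BalTensor.factor b q h' (BalTensor.factor b q h m) =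
      BalTensor.factor b q (h.trans h') m := by
  induction m using BalTensor.induction with
  | zero => simp
  | tmul g g' => simp only [BalTensor.factor_tmul]
  | add m m' hm hm' => simp only [map_add, hm, hm']

/-- The composite of two structure maps does not depend on the intermediate facet. Each pair of
facets therefore contributes a single map times a sum of two opposite incidence products. -/
lemma diff_diff {n : ℕ} (p : PMod b q (n + 2)) : diff q o n (diff q o (n + 1) p) = 0 := by
  classical
  funext f''
  have h1 (f : Facet b (n + 2)) (f' : Facet b (n + 1)) : (if h' : f'.J ⊆ f''.J then
        incidence o f' f'' • BalTensor.factor b q h'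
          (if h : f.J ⊆ f'.J then incidence o f f' • BalTensor.factor b q h (p f) else 0)
        else 0) = if h : f.J ⊆ f''.J then (if f.J ⊆ f'.J ∧ f'.J ⊆ f''.J then
          incidence o f f' * incidence o f' f'' else 0) • BalTensor.factor b q h (p f) else 0 := by
    by_cases h' : f'.J ⊆ f''.J
    · by_cases h : f.J ⊆ f'.J
      · rw [dif_pos h', dif_pos h, dif_pos (h.trans h'), if_pos ⟨h, h'⟩, map_zsmul, smul_smul,
          mul_comm]
        congr 1
        exact BalTensor.factor_factor q h h' (p f)
      · simp [h]
    · simp [h']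
  have h2 : diff q o n (diff q o (n + 1) p) f'' = ∑ f' : Facet b (n + 1), ∑ f : Facet b (n + 2),
      if h : f.J ⊆ f''.J then (if f.J ⊆ f'.J ∧ f'.J ⊆ f''.J then
          incidence o f f' * incidence o f' f'' else 0) • BalTensor.factor b q h (p f) else 0 := by
    rw [diff_apply]
    refine Finset.sum_congr rfl fun f' _ => ?_
    simp only [← h1]
    by_cases h' : f'.J ⊆ f''.J
    · simp only [dif_pos h']
      rw [diff_apply, map_sum, Finset.smul_sum]
    · simp only [dif_neg h', Finset.sum_const_zero]
  rw [h2, Finset.sum_comm]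
  refine Finset.sum_eq_zero fun f _ => ?_
  by_cases h : f.J ⊆ f''.J
  · simp only [dif_pos h]
    obtain ⟨f₁, f₂, hne, h₁, h₂, h3, h4⟩ := exists_intermediate o h
    rw [← Finset.sum_smul, Finset.sum_eq_add_of_mem f₁ f₂ (Finset.mem_univ _) (Finset.mem_univ _)
      hne, if_pos h₁, if_pos h₂, h3, zero_smul]
    rintro f' - hf'
    rw [if_neg]
    intro h
    exact (h4 f' h.1 h.2).elim hf'.1 hf'.2
  · simp only [dif_neg h, Finset.sum_const_zero]

lemma augmentation_diff (p : PMod b q 1) : augmentation b q (diff q o 0 p) = 0 := by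
  classical
  rw [augmentation_apply]
  simp only [diff_apply, map_sum]
  rw [Finset.sum_comm]
  refine Finset.sum_eq_zero fun f _ => ?_
  obtain ⟨f₁, f₂, hne, h₁, h₂, h3, h4⟩ := exists_vertices o f
  rw [Finset.sum_eq_add_of_mem f₁ f₂ (Finset.mem_univ _) (Finset.mem_univ _) hne]
  · rw [dif_pos h₁, dif_pos h₂, map_zsmul, map_zsmul, mulMap_factor, mulMap_factor, ← add_smul, h3,
      zero_smul]
  · rintro f' - hf'
    rw [dif_neg, map_zero]
    intro h
    exact (h4 f' h).elim hf'.1 hf'.2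

end Average

end

end AffineHecke

namespace AffineHecke

noncomputable section

set_option linter.unusedSectionVars false

/-! ### The cellular complexes of the alcove relative to a set of walls -/

section Local

variable {ι X Y : Type*} [Finite ι] [AddCommGroup X] [AddCommGroup Y] {P : RootDatum ι X Y}
  [P.IsReduced] {b : P.Base} (o : Orientations b) {A : Type*} [AddCommGroup A]

lemma incidence_of_not_subset {n : ℕ} {f : Facet b (n + 1)} {f' : Facet b n} (h : ¬ f.J ⊆ f'.J) :
    incidence o f f' = 0 := dif_neg h

lemma sum_incidence_mul_incidence {n : ℕ} (f : Facet b (n + 2)) (f'' : Facet b n) :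
    ∑ f' : Facet b (n + 1), incidence o f f' * incidence o f' f'' = 0 := by
  by_cases h : f.J ⊆ f''.J
  · obtain ⟨f₁, f₂, hne, -, -, h3, h4⟩ := exists_intermediate o h
    rw [Finset.sum_eq_add_of_mem f₁ f₂ (Finset.mem_univ _) (Finset.mem_univ _) hne, h3]
    rintro f' - hf'
    by_cases h1 : f.J ⊆ f'.J
    · by_cases h2 : f'.J ⊆ f''.J
      · exact absurd (h4 f' h1 h2) (not_or.mpr hf')
      · rw [incidence_of_not_subset o h2, mul_zero]
    · rw [incidence_of_not_subset o h1, zero_mul]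
  · refine Finset.sum_eq_zero fun f' _ => ?_
    by_cases h1 : f.J ⊆ f'.J
    · rw [incidence_of_not_subset o fun h2 => h (h1.trans h2), mul_zero]
    · rw [incidence_of_not_subset o h1, zero_mul]

/-- The cellular boundary map of the alcove. -/
def cellDiff {n : ℕ} : (Facet b (n + 1) → A) →+ (Facet b n → A) where
  toFun g f' := ∑ f, incidence o f f' • g f
  map_zero' := by
    funext f'
    simp
  map_add' g g' := by
    funext f'
    simp [Finset.sum_add_distrib]

lemma cellDiff_apply {n : ℕ} (g : Facet b (n + 1) → A) (f' : Facet b n) :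
    cellDiff o g f' = ∑ f, incidence o f f' • g f := rfl

lemma cellDiff_cellDiff {n : ℕ} (g : Facet b (n + 2) → A) : cellDiff o (cellDiff o g) = 0 := by
  funext f''
  simp only [cellDiff_apply, Finset.smul_sum, smul_smul]
  rw [Finset.sum_comm, Pi.zero_apply]
  refine Finset.sum_eq_zero fun f _ => ?_
  have h := sum_incidence_mul_incidence o f f''
  rw [← Finset.sum_smul]
  simp only [mul_comm (incidence o _ f'')]
  rw [h, zero_smul]

lemma exists_of_cellDiff_ne_zero {n : ℕ} {g : Facet b (n + 1) → A} {f' : Facet b n}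
    (h : cellDiff o g f' ≠ 0) : ∃ f, f.J ⊆ f'.J ∧ g f ≠ 0 := by
  obtain ⟨f, -, hf⟩ := Finset.exists_ne_zero_of_sum_ne_zero h
  refine ⟨f, ?_, fun h0 => hf (by rw [h0, smul_zero])⟩
  by_contra h0
  exact hf (by rw [incidence_of_not_subset o h0, zero_smul])

/-- The facet that is obtained by leaving a wall. -/
def Facet.leave {n : ℕ} (f : Facet b n) (t : ι × ℤ) (ht : t ∈ f.J) : Facet b (n + 1) where
  J := f.J \ {t}
  subset := Set.sdiff_subset.trans f.subset
  nonempty := alcoveFace_nonempty_mono f.subset Set.sdiff_subset f.nonempty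
  dim := by
    have h : insert t (f.J \ {t}) = f.J := by simp [Set.insert_eq_of_mem ht]
    have h1 := finrank_faceDir_insert (P := P) (b := b) (J := f.J \ {t}) (a := t) (by simp)
      (h.symm ▸ f.subset) (h.symm ▸ f.nonempty)
    rw [h1, h, f.dim]

open Classical in
/-- The partial homotopy in the direction of the wall `t`. -/
def toggle (t : ι × ℤ) {n : ℕ} (g : Facet b n → A) (e : Facet b (n + 1)) : A :=
  if h : ∃ f : Facet b n, t ∉ e.J ∧ f.J = insert t e.J then
    incidence o e h.choose • g h.choose else 0

lemma toggle_apply {t : ι × ℤ} {n : ℕ} (g : Facet b n → A) {e : Facet b (n + 1)} {f : Facet b n}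
    (ht : t ∉ e.J) (h : f.J = insert t e.J) : toggle o t g e = incidence o e f • g f := by
  have h' : ∃ f : Facet b n, t ∉ e.J ∧ f.J = insert t e.J := ⟨f, ht, h⟩
  have h1 : h'.choose = f := Facet.eq_of_J_eq (h'.choose_spec.2.trans h.symm)
  rw [toggle, dif_pos h', h1]

lemma exists_of_toggle_ne_zero {t : ι × ℤ} {n : ℕ} {g : Facet b n → A} {e : Facet b (n + 1)}
    (h : toggle o t g e ≠ 0) : ∃ f : Facet b n, t ∉ e.J ∧ f.J = insert t e.J ∧ g f ≠ 0 := by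
  by_cases h' : ∃ f : Facet b n, t ∉ e.J ∧ f.J = insert t e.J
  · obtain ⟨f, ht, hf⟩ := h'
    rw [toggle_apply o g ht hf] at h
    exact ⟨f, ht, hf, fun h0 => h (by rw [h0, smul_zero])⟩
  · exact absurd (dif_neg h') h

/-- The only facet off the wall t that has f as a face is the one obtained from f by leaving t. The
incidence number occurs twice and squares to 1, so subtracting this boundary clears a chain on the
wall t. -/
lemma cellDiff_toggle {t : ι × ℤ} {n : ℕ} (g : Facet b n → A) {f : Facet b n} (ht : t ∈ f.J) :
    cellDiff o (toggle o t g) f = g f := by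
  have h : f.J = insert t (f.leave t ht).J := by
    change f.J = insert t (f.J \ {t})
    simp [Set.insert_eq_of_mem ht]
  have h1 : t ∉ (f.leave t ht).J := fun h => h.2 rfl
  rw [cellDiff_apply, Finset.sum_eq_single_of_mem (f.leave t ht) (Finset.mem_univ _)]
  · rw [toggle_apply o g h1 h, smul_smul, incidence_mul_self o Set.sdiff_subset, one_smul]
  · intro e _ he
    by_cases h2 : e.J ⊆ f.J
    · by_cases h3 : toggle o t g e = 0
      · rw [h3, smul_zero]
      · obtain ⟨-, hte, -⟩ := exists_of_toggle_ne_zero o h3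
        refine absurd (Facet.eq_of_J_eq ?_) he
        change e.J = f.J \ {t}
        rw [Facet.J_eq_insert h2 ht hte]
        simp [hte]
    · rw [incidence_of_not_subset o h2, zero_smul]

/-- The condition that all the walls in the component `θ` other than `t` belong to `J`. -/
def Full (b : P.Base) (θ : ι) (t : ι × ℤ) (J : Set (ι × ℤ)) : Prop :=
  ∀ a ∈ simpleAff b, comp b a = θ → a ≠ t → a ∈ J

/-- New coefficients arise from an old facet by leaving the wall t and then adding some other wall.
Leaving t loses no wall of a different component, and t ∉ D keeps the old facet in the relative
complex. So work done in other components is not destroyed. -/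
lemma toggle_step_full {D : Set (ι × ℤ)} {t t' : ι × ℤ} (htD : t ∉ D) {θ' : ι}
    (hθ : comp b t ≠ θ') {n : ℕ} {g : Facet b n → A}
    (hg : ∀ f, Disjoint f.J D → g f ≠ 0 → Full b θ' t' f.J) (f : Facet b n) (hf : Disjoint f.J D)
    (hne : (g - cellDiff o (toggle o t g)) f ≠ 0) : Full b θ' t' f.J := by
  by_cases h0 : g f = 0
  · rw [Pi.sub_apply, h0, zero_sub, neg_ne_zero] at hne
    obtain ⟨e, hef, he⟩ := exists_of_cellDiff_ne_zero o hne
    obtain ⟨f₂, hte, hf₂, hne₂⟩ := exists_of_toggle_ne_zero o he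
    have hD : Disjoint f₂.J D := by
      rw [hf₂, Set.disjoint_insert_left]
      exact ⟨htD, hf.mono_left hef⟩
    intro a ha hac hat
    have h1 := hg f₂ hD hne₂ a ha hac hat
    rw [hf₂] at h1
    rcases h1 with rfl | h1
    · exact absurd hac hθ
    · exact hef h1
  · exact hg f hf h0

lemma notMem_of_toggle_step {t : ι × ℤ} {n : ℕ} {g : Facet b n → A} {f : Facet b n}
    (hne : (g - cellDiff o (toggle o t g)) f ≠ 0) : t ∉ f.J := by
  intro ht
  rw [Pi.sub_apply, cellDiff_toggle o g ht, sub_self] at hne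
  exact hne rfl

variable {D : Set (ι × ℤ)} {τ : ι → ι × ℤ}

/-- At a vertex only one wall per component is missing. Once the chain is cleared on the wall t,
this missing wall must be t. -/
lemma toggle_step_full_self_zero {t : ι × ℤ} (ht : t ∈ simpleAff b) {g : Facet b 0 → A}
    {f : Facet b 0} (hne : (g - cellDiff o (toggle o t g)) f ≠ 0) : Full b (comp b t) t f.J := by
  intro a ha hac hat
  by_contra haJ
  exact hat ((finrank_faceDir_eq_zero_iff f.subset f.nonempty).mp f.dim a ha haJ t ht
    (notMem_of_toggle_step o hne) hac)

/-- If a second wall of the component were missing at f, then f would have a face on the wall t.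
Among the facets off that wall only f has this face, so the relative cycle condition there forces
the coefficient at f to vanish. -/
lemma toggle_step_full_self {t : ι × ℤ} (ht : t ∈ simpleAff b) (htD : t ∉ D) {n : ℕ}
    {g : Facet b (n + 1) → A} (hcyc : ∀ f', Disjoint f'.J D → cellDiff o g f' = 0)
    {f : Facet b (n + 1)} (hf : Disjoint f.J D)
    (hne : (g - cellDiff o (toggle o t g)) f ≠ 0) : Full b (comp b t) t f.J := by
  intro a ha hac hat
  by_contra haJ
  have htf := notMem_of_toggle_step o hne
  let f' := f.face t ht htf
    (insert_nonempty_of_comp_eq f.subset f.nonempty ht ha haJ (Ne.symm hat) hac.symm)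
  have hf' : Disjoint f'.J D := Set.disjoint_insert_left.mpr ⟨htD, hf⟩
  have h1 : cellDiff o (g - cellDiff o (toggle o t g)) f' = 0 := by
    rw [map_sub, cellDiff_cellDiff, sub_zero, hcyc f' hf']
  have hs : f.J ⊆ f'.J := Set.subset_insert t f.J
  rw [cellDiff_apply, Finset.sum_eq_single_of_mem f (Finset.mem_univ _)] at h1
  · have h2 := congrArg (fun x => incidence o f f' • x) h1
    simp only [smul_smul, incidence_mul_self o hs, one_smul, smul_zero] at h2
    exact hne h2
  · intro e _ he
    by_cases h2 : e.J ⊆ f'.J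
    · by_cases h3 : (g - cellDiff o (toggle o t g)) e = 0
      · rw [h3, smul_zero]
      · refine absurd (Facet.eq_of_J_eq ?_) he
        have hte := notMem_of_toggle_step o h3
        have h4 := Facet.J_eq_insert h2 (Set.mem_insert t f.J) hte
        change insert t f.J = insert t e.J at h4
        rw [← Set.insert_sdiff_self_of_notMem hte, ← h4, Set.insert_sdiff_self_of_notMem htf]
    · rw [incidence_of_not_subset o h2, zero_smul]

/-- The components are treated one after the other. The predicate `p` carries the relative cycle
condition where it is needed and is trivial in degree zero, so one induction serves both cases. -/
lemma exists_full_of_step {n : ℕ} {p : (Facet b n → A) → Prop}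
    (hp : ∀ g y, p g → p (g - cellDiff o y))
    (hτ : ∀ θ, IsMaxCoroot b θ → τ θ ∈ simpleAff b ∧ comp b (τ θ) = θ ∧ τ θ ∉ D)
    (step : ∀ t ∈ simpleAff b, t ∉ D → ∀ g, p g → ∀ f, Disjoint f.J D →
      (g - cellDiff o (toggle o t g)) f ≠ 0 → Full b (comp b t) t f.J)
    (g : Facet b n → A) (hg : p g) : ∃ y : Facet b (n + 1) → A, ∀ f, Disjoint f.J D →
      (g - cellDiff o y) f ≠ 0 → ∀ θ, IsMaxCoroot b θ → Full b θ (τ θ) f.J := by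
  classical
  have : Fintype ι := Fintype.ofFinite ι
  suffices h : ∀ Θ : Finset ι, ∃ y : Facet b (n + 1) → A, ∀ f, Disjoint f.J D →
      (g - cellDiff o y) f ≠ 0 → ∀ θ ∈ Θ, IsMaxCoroot b θ → Full b θ (τ θ) f.J by
    obtain ⟨y, hy⟩ := h Finset.univ
    exact ⟨y, fun f hf hne θ => hy f hf hne θ (Finset.mem_univ θ)⟩
  intro Θ
  induction Θ using Finset.induction_on with
  | empty => exact ⟨0, fun f _ _ θ hθ => absurd hθ (Finset.notMem_empty θ)⟩
  | insert θ Θ hθΘ ih =>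
    obtain ⟨y, hy⟩ := ih
    by_cases hθ : IsMaxCoroot b θ
    · obtain ⟨h1, h2, h3⟩ := hτ θ hθ
      refine ⟨y + toggle o (τ θ) (g - cellDiff o y), fun f hf hne θ' hθ' hmax => ?_⟩
      rw [map_add, ← sub_sub] at hne
      rcases Finset.mem_insert.mp hθ' with rfl | hθ'
      · have h4 := step _ h1 h3 _ (hp g y hg) f hf hne
        rwa [h2] at h4
      · refine toggle_step_full o h3 ?_ (fun f hf hne => hy f hf hne θ' hθ' hmax) f hf hne
        rw [h2]
        rintro rfl
        exact hθΘ hθ'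
    · refine ⟨y, fun f hf hne θ' hθ' hmax => ?_⟩
      rcases Finset.mem_insert.mp hθ' with rfl | hθ'
      · exact absurd hmax hθ
      · exact hy f hf hne θ' hθ' hmax

/-- Relative to a set of walls without full components, the alcove has no homology in positive
degrees. -/
lemma exists_cellDiff_eq (hτ : ∀ θ, IsMaxCoroot b θ → τ θ ∈ simpleAff b ∧ comp b (τ θ) = θ ∧ τ θ ∉ D)
    {n : ℕ} (g : Facet b (n + 1) → A) (hg : ∀ f', Disjoint f'.J D → cellDiff o g f' = 0) :
    ∃ y : Facet b (n + 2) → A, ∀ f, Disjoint f.J D → cellDiff o y f = g f := by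
  obtain ⟨y, hy⟩ := exists_full_of_step o (D := D)
    (p := fun g : Facet b (n + 1) → A => ∀ f', Disjoint f'.J D → cellDiff o g f' = 0)
    (fun g y hg f' hf' => by rw [map_sub, cellDiff_cellDiff, sub_zero, hg f' hf']) hτ
    (fun t ht htD g hg f hf hne => toggle_step_full_self o ht htD hg hf hne) g hg
  refine ⟨y, fun f hf => ?_⟩
  by_contra hne
  have h1 : (g - cellDiff o y) f ≠ 0 := fun h0 => hne (sub_eq_zero.mp h0).symm
  have h2 := hy f hf h1
  -- After all components are treated, a surviving facet lies on every wall except one per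
  -- component. It is a vertex, which is impossible in positive degree.
  have h3 : Module.finrank ℝ (faceDir P f.J) = 0 := by
    rw [finrank_faceDir_eq_zero_iff f.subset f.nonempty]
    intro a ha haJ a' ha' haJ' hc
    have h4 (c : ι × ℤ) (hc : c ∈ simpleAff b) (hcJ : c ∉ f.J) : c = τ (comp b c) := by
      by_contra h5
      exact hcJ (h2 _ (isMaxCoroot_comp hc) c hc rfl h5)
    rw [h4 a ha haJ, h4 a' ha' haJ', hc]
  rw [f.dim] at h3
  omega

/-- Up to boundaries, a chain of dimension zero is concentrated on a given vertex. -/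
lemma exists_cellDiff_eq_single
    (hτ : ∀ θ, IsMaxCoroot b θ → τ θ ∈ simpleAff b ∧ comp b (τ θ) = θ) (g : Facet b 0 → A) :
    ∃ y : Facet b 1 → A, ∀ f, (g - cellDiff o y) f ≠ 0 →
      f.J = {a ∈ simpleAff b | a ≠ τ (comp b a)} := by
  obtain ⟨y, hy⟩ := exists_full_of_step o (D := ∅) (τ := τ)
    (p := fun _ : Facet b 0 → A => True) (fun _ _ _ => trivial)
    (fun θ hθ => ⟨(hτ θ hθ).1, (hτ θ hθ).2, Set.notMem_empty _⟩)
    (fun t ht htD g hg f hf hne => toggle_step_full_self_zero o ht hne) g trivial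
  refine ⟨y, fun f hne => ?_⟩
  have h1 := hy f (Set.disjoint_empty _) hne
  have h2 (c : ι × ℤ) (hc : c ∈ simpleAff b) (h : c ≠ τ (comp b c)) : c ∈ f.J :=
    h1 _ (isMaxCoroot_comp hc) c hc rfl h
  refine Set.Subset.antisymm (fun a ha => ⟨f.subset ha, fun h => ?_⟩) fun a ha => h2 a ha.1 ha.2
  obtain ⟨c, hc, hca, hcJ⟩ := (alcoveFace_nonempty_iff f.subset).mp f.nonempty _
    (isMaxCoroot_comp (f.subset ha))
  refine hcJ ?_
  by_cases h3 : c = τ (comp b c)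
  · rw [h3, hca, ← h]
    exact ha
  · exact h2 c hc h3

end Local

end

end AffineHecke

namespace AffineHecke

noncomputable section

set_option linter.unusedSectionVars false

/-! ### Exactness -/

section Level

variable {ι X Y : Type*} [Finite ι] [AddCommGroup X] [AddCommGroup Y] {P : RootDatum ι X Y}
  [P.IsReduced] (b : P.Base)

/-- The minimal length of the elements of a coset. -/
def cosetLength {J : Set (ι × ℤ)} (c : FacetCoset P J) : ℕ :=
  sInf (length b '' {w | (w : FacetCoset P J) = c})

variable {b}

lemma cosetLength_le {J : Set (ι × ℤ)} (w : ExtWeyl P) :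
    cosetLength b (w : FacetCoset P J) ≤ length b w :=
  Nat.sInf_le ⟨w, rfl, rfl⟩

lemma exists_length_eq_cosetLength {J : Set (ι × ℤ)} (c : FacetCoset P J) :
    ∃ w : ExtWeyl P, (w : FacetCoset P J) = c ∧ length b w = cosetLength b c := by
  obtain ⟨w, hw⟩ := QuotientGroup.mk_surjective c
  exact Nat.sInf_mem (s := length b '' {w | (w : FacetCoset P J) = c}) ⟨_, w, hw, rfl⟩

lemma mk_mul_affRefl {J : Set (ι × ℤ)} {a : ι × ℤ} (ha : a ∈ J) (w : ExtWeyl P) :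
    ((w * affRefl P a : ExtWeyl P) : FacetCoset P J) = w :=
  QuotientGroup.mk_mul_of_mem _ (stabJ_le_facetGroup P J (affRefl_mem_stabJ ha))

/-- A descent in J would give a shorter element of the same coset. With `cosetLength_of_disjoint`,
an element is minimal in its coset exactly when none of its descents lies in J. -/
lemma disjoint_descents {J : Set (ι × ℤ)} {w : ExtWeyl P}
    (h : length b w = cosetLength b (w : FacetCoset P J)) : Disjoint J (descents b w) := by
  rw [Set.disjoint_left]
  rintro a haJ ⟨ha, hwa⟩
  have h1 := length_mul_affRefl_of_notMem ha hwa
  have h2 := cosetLength_le (b := b) (J := J) (w * affRefl P a)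
  rw [mk_mul_affRefl haJ] at h2
  omega

lemma affAct_mem_posAff_of_disjoint {J : Set (ι × ℤ)} (hJ : J ⊆ simpleAff b) {w : ExtWeyl P}
    (h : Disjoint J (descents b w)) : ∀ a ∈ J, affAct w a ∈ posAff b := by
  intro a ha
  by_contra hwa
  exact Set.disjoint_left.mp h ha ⟨hJ ha, hwa⟩

lemma length_mul_of_mem_facetGroup {J : Set (ι × ℤ)} (hJ : J ⊆ simpleAff b)
    (hne : (alcoveFace b J).Nonempty) {w : ExtWeyl P} (h : Disjoint J (descents b w))
    {v z : ExtWeyl P} (hv : v ∈ stabJ P J) (hz : z ∈ Subgroup.center (ExtWeyl P)) :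
    length b (w * (v * z)) = length b w + length b v := by
  rw [← mul_assoc, length_mul_Omega (mem_Omega_of_mem_center hz),
    length_mul_of_mem_stabJ hne (affAct_mem_posAff_of_disjoint hJ h) hv]

lemma cosetLength_of_disjoint {J : Set (ι × ℤ)} (hJ : J ⊆ simpleAff b)
    (hne : (alcoveFace b J).Nonempty) {w : ExtWeyl P} (h : Disjoint J (descents b w)) :
    cosetLength b (w : FacetCoset P J) = length b w := by
  refine (cosetLength_le w).antisymm ?_
  obtain ⟨u, hu, hlen⟩ := exists_length_eq_cosetLength (b := b) (w : FacetCoset P J)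
  obtain ⟨v, hv, z, hz, hvz⟩ := mem_facetGroup.mp (QuotientGroup.eq.mp hu.symm)
  have h1 := length_mul_of_mem_facetGroup hJ hne h hv hz
  rw [hvz, mul_inv_cancel_left] at h1
  omega

/-- Minimal coset representatives are unique modulo the centre. -/
lemma inv_mul_mem_center {J : Set (ι × ℤ)} (hJ : J ⊆ simpleAff b)
    (hne : (alcoveFace b J).Nonempty) {w u : ExtWeyl P} (h : Disjoint J (descents b w))
    (hwu : (w : FacetCoset P J) = u) (hlen : length b w = length b u) :
    w⁻¹ * u ∈ Subgroup.center (ExtWeyl P) := by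
  obtain ⟨v, hv, z, hz, hvz⟩ := mem_facetGroup.mp (QuotientGroup.eq.mp hwu)
  have h1 := length_mul_of_mem_facetGroup hJ hne h hv hz
  rw [hvz, mul_inv_cancel_left] at h1
  have h2 := eq_one_of_mem_stabJ hJ hv (by omega)
  rw [← hvz, h2, one_mul]
  exact hz

/-- A choice of walls, one in every component, that are no descents of `w`. -/
lemma exists_walls (w : ExtWeyl P) : ∃ τ : ι → ι × ℤ, ∀ θ, IsMaxCoroot b θ →
    τ θ ∈ simpleAff b ∧ comp b (τ θ) = θ ∧ τ θ ∉ descents b w := by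
  classical
  have h (θ : ι) : ∃ a, IsMaxCoroot b θ → a ∈ simpleAff b ∧ comp b a = θ ∧ a ∉ descents b w := by
    by_cases hθ : IsMaxCoroot b θ
    · obtain ⟨a, ha⟩ := exists_notMem_descents w hθ
      exact ⟨a, fun _ => ha⟩
    · exact ⟨(θ, 0), fun h => absurd h hθ⟩
  choose τ hτ using h
  exact ⟨τ, hτ⟩

end Level

section Exact

variable {ι X Y : Type*} [Finite ι] [AddCommGroup X] [AddCommGroup Y] {P : RootDatum ι X Y}
  [P.IsReduced] {b : P.Base} {q : ExtWeyl P → ℝ} (hq : IsParameter b q) (o : Orientations b)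

lemma zsmul_tmul_one_smul {M : Type*} [AddCommGroup M] [Module (Env b q) M] (k : ℤ) (h : Hecke b q)
    (m : M) : ((k • h) ⊗ₜ[ℂ] op 1 : Env b q) • m = k • (h ⊗ₜ[ℂ] op 1 : Env b q) • m :=
  (AddMonoidHom.mk' (fun h : Hecke b q => (h ⊗ₜ[ℂ] op 1 : Env b q) • m) fun h h' => by
    rw [TensorProduct.add_tmul, add_smul]).map_zsmul k h

lemma zero_tmul_one_smul {M : Type*} [AddCommGroup M] [Module (Env b q) M] (m : M) :
    ((0 : Hecke b q) ⊗ₜ[ℂ] op 1 : Env b q) • m = 0 := by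
  have h := zsmul_tmul_one_smul 0 (0 : Hecke b q) m
  rwa [zero_smul, zero_smul] at h

lemma sum_tmul_one_smul {M κ : Type*} [AddCommGroup M] [Module (Env b q) M] (s : Finset κ)
    (h : κ → Hecke b q) (m : M) :
    ((∑ k ∈ s, h k) ⊗ₜ[ℂ] op 1 : Env b q) • m = ∑ k ∈ s, (h k ⊗ₜ[ℂ] op 1 : Env b q) • m := by
  rw [TensorProduct.sum_tmul, Finset.sum_smul]

/-- The chain of `P_n(H)` with the coefficient `g f` at the coset of `x` over the facet `f`. -/
def chainAt (x : ExtWeyl P) {n : ℕ} : (Facet b n → Hecke b q) →+ PMod b q n where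
  toFun g f := (g f ⊗ₜ[ℂ] op 1 : Env b q) • epsL hq f.J x
  map_zero' := by
    funext f
    exact zero_tmul_one_smul _
  map_add' g g' := by
    funext f
    rw [Pi.add_apply, TensorProduct.add_tmul, add_smul, Pi.add_apply]

lemma chainAt_apply (x : ExtWeyl P) {n : ℕ} (g : Facet b n → Hecke b q) (f : Facet b n) :
    chainAt hq x g f = (g f ⊗ₜ[ℂ] op 1 : Env b q) • epsL hq f.J x := rfl

lemma factor_epsL {J J' : Set (ι × ℤ)} (h : J ⊆ J') (x : ExtWeyl P) :
    BalTensor.factor b q h (epsL hq J x) = epsL hq J' x := by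
  rw [epsL, BalTensor.factor_tmul, epsL]

/-- All facets of one alcove x carry compatible basis elements, so cellular chains of the alcove
with coefficients in H map to the complex. Local corrections can thus be lifted. -/
lemma diff_chainAt (x : ExtWeyl P) {n : ℕ} (g : Facet b (n + 1) → Hecke b q) :
    diff q o n (chainAt hq x g) = chainAt hq x (cellDiff o g) := by
  classical
  funext f'
  rw [diff_apply, chainAt_apply, cellDiff_apply, sum_tmul_one_smul]
  refine Finset.sum_congr rfl fun f _ => ?_
  by_cases h : f.J ⊆ f'.J
  · rw [dif_pos h, chainAt_apply, map_smul, factor_epsL, zsmul_tmul_one_smul]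
  · rw [dif_neg h, incidence_of_not_subset o h, zero_smul, zero_tmul_one_smul]

/-- The coordinates of a chain over a facet. -/
def coord {n : ℕ} (p : PMod b q n) (f : Facet b n) : FacetCoset P f.J →₀ Hecke b q :=
  coordL hq f.subset f.nonempty (p f)

lemma coord_sub {n : ℕ} (p p' : PMod b q n) (f : Facet b n) :
    coord hq (p - p') f = coord hq p f - coord hq p' f := map_sub _ _ _

lemma coord_sum {n : ℕ} {κ : Type*} (s : Finset κ) (p : κ → PMod b q n) (f : Facet b n) :
    coord hq (∑ k ∈ s, p k) f = ∑ k ∈ s, coord hq (p k) f := by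
  rw [coord, Finset.sum_apply, map_sum]
  rfl

lemma coord_chainAt (x : ExtWeyl P) {n : ℕ} (g : Facet b n → Hecke b q) (f : Facet b n) :
    coord hq (chainAt hq x g) f = Finsupp.single (x : FacetCoset P f.J) (g f) := by
  rw [coord, chainAt_apply, coordL_smul, coordL_epsL, Finsupp.smul_single, smul_eq_mul, mul_one]

lemma eq_zero_of_coord {n : ℕ} {p : PMod b q n} (h : ∀ f, coord hq p f = 0) : p = 0 := by
  funext f
  exact (equivL hq f.subset f.nonempty).injective ((h f).trans (map_zero _).symm)

open Classical in
lemma coord_diff {n : ℕ} (p : PMod b q (n + 1)) (f' : Facet b n) :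
    coord hq (diff q o n p) f' = ∑ f : Facet b (n + 1), if h : f.J ⊆ f'.J then
      incidence o f f' • Finsupp.mapDomain (FacetCoset.map h) (coord hq p f) else 0 := by
  rw [coord, diff_apply, map_sum]
  refine Finset.sum_congr rfl fun f _ => ?_
  by_cases h : f.J ⊆ f'.J
  · rw [dif_pos h, dif_pos h, map_zsmul, coordL_factor hq f.subset f.nonempty]
    rfl
  · rw [dif_neg h, dif_neg h, map_zero]

/-- For a chain in level at most `ℓ(w)`, the boundary at a minimal coset representative `w` is the
cellular boundary of the coefficients at the cosets of `w`. -/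
lemma coord_diff_apply {n : ℕ} {p : PMod b q (n + 1)} {w : ExtWeyl P}
    (hp : ∀ f c, coord hq p f c ≠ 0 → cosetLength b c ≤ length b w) {f' : Facet b n}
    (hf' : Disjoint f'.J (descents b w)) :
    coord hq (diff q o n p) f' w = cellDiff o (fun f => coord hq p f w) f' := by
  classical
  rw [coord_diff, Finsupp.finsetSum_apply, cellDiff_apply]
  refine Finset.sum_congr rfl fun f _ => ?_
  by_cases h : f.J ⊆ f'.J
  · rw [dif_pos h, Finsupp.smul_apply]
    congr 1
    rw [Finsupp.mapDomain, Finsupp.sum_apply, Finsupp.sum,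
      Finset.sum_eq_single (w : FacetCoset P f.J)]
    · rw [FacetCoset.map_mk, Finsupp.single_eq_same]
    · intro c hc hcw
      rw [Finsupp.single_apply, if_neg]
      -- A second coset over f with the same image would contain some u of length at most ℓ(w). In
      -- the coset over f' the minimal length is ℓ(w), attained only on w Z(W). So u and w already
      -- agree over f.
      intro hcw'
      obtain ⟨u, rfl, hu⟩ := exists_length_eq_cosetLength (b := b) c
      rw [FacetCoset.map_mk] at hcw'
      have h1 := hp f u (Finsupp.mem_support_iff.mp hc)
      have h2 := cosetLength_le (b := b) (J := f'.J) u
      rw [hcw', cosetLength_of_disjoint f'.subset f'.nonempty hf'] at h2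
      have h3 := inv_mul_mem_center f'.subset f'.nonempty hf' hcw'.symm (by omega)
      exact hcw (QuotientGroup.eq.mpr (center_le_facetGroup P f.J h3)).symm
    · intro hw
      rw [Finsupp.notMem_support_iff.mp hw, Finsupp.single_zero, Finsupp.zero_apply]
  · rw [dif_neg h, incidence_of_not_subset o h, zero_smul, Finsupp.zero_apply]

/-- Induction on a strict bound for the level of the cycle. At each element of the top length the
coefficients form a relative cycle of the alcove modulo the descent walls. This bounds, and lifting
the bounding chain and subtracting its boundary removes the top level. -/
lemma exists_diff_eq_of_level {n : ℕ} (N : ℕ) : ∀ p : PMod b q (n + 1), diff q o n p = 0 →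
    (∀ f c, coord hq p f c ≠ 0 → cosetLength b c < N) → ∃ y, diff q o (n + 1) y = p := by
  classical
  induction N with
  | zero =>
    intro p _ hp
    refine ⟨0, ?_⟩
    rw [map_zero, eq_zero_of_coord hq (p := p)]
    intro f
    ext c
    by_contra hc
    exact Nat.not_lt_zero _ (hp f c hc)
  | succ N ih =>
    intro p hdp hp
    -- the classes modulo the centre of the elements of length `N` at which `p` does not vanish
    let U : Set (ExtWeyl P ⧸ Subgroup.center (ExtWeyl P)) := {u | length b u.out = N ∧
      ∃ f : Facet b (n + 1), Disjoint f.J (descents b u.out) ∧ coord hq p f u.out ≠ 0}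
    -- Over a fixed facet, distinct classes modulo the centre with minimal representatives give
    -- distinct cosets in the finite support of p.
    have hU : U.Finite := by
      have h1 : (⋃ f : Facet b (n + 1), {u | (length b u.out = N ∧
          Disjoint f.J (descents b u.out)) ∧ coord hq p f u.out ≠ 0} :
          Set (ExtWeyl P ⧸ Subgroup.center (ExtWeyl P))).Finite := by
        refine Set.finite_iUnion fun f => ?_
        refine Set.Finite.of_finite_image (f := fun u => (u.out : FacetCoset P f.J))
          ((coord hq p f).support.finite_toSet.subset ?_) ?_
        · rintro _ ⟨u, hu, rfl⟩
          exact Finsupp.mem_support_iff.mpr hu.2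
        · intro u hu v hv huv
          have h2 := inv_mul_mem_center f.subset f.nonempty hu.1.2 huv
            (hu.1.1.trans hv.1.1.symm)
          rw [← QuotientGroup.out_eq' u, ← QuotientGroup.out_eq' v, QuotientGroup.eq]
          exact h2
      refine h1.subset fun u hu => ?_
      obtain ⟨h2, f, h3, h4⟩ := hu
      exact Set.mem_iUnion.mpr ⟨f, ⟨h2, h3⟩, h4⟩
    have hy (u : ExtWeyl P ⧸ Subgroup.center (ExtWeyl P)) : ∃ y : Facet b (n + 2) → Hecke b q,
        u ∈ U → ∀ f, Disjoint f.J (descents b u.out) →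
          cellDiff o y f = coord hq p f u.out := by
      by_cases hu : u ∈ U
      · obtain ⟨τ, hτ⟩ := exists_walls (b := b) u.out
        obtain ⟨y, hy⟩ := exists_cellDiff_eq o hτ (fun f => coord hq p f u.out) fun f' hf' => by
          rw [← coord_diff_apply hq o (fun f c hc => by
            rw [hu.1]
            exact Nat.lt_succ_iff.mp (hp f c hc)) hf', hdp, coord, Pi.zero_apply, map_zero,
            Finsupp.zero_apply]
        exact ⟨y, fun _ => hy⟩
      · exact ⟨0, fun h => absurd h hu⟩
    choose y hy using hy
    -- One local solution is lifted for every relevant alcove. Its boundary has no level above N,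
    -- and at level N it reproduces p.
    let z : PMod b q (n + 2) := ∑ u ∈ hU.toFinset, chainAt hq u.out (y u)
    have hz (f : Facet b (n + 1)) (c : FacetCoset P f.J) :
        coord hq (p - diff q o (n + 1) z) f c = coord hq p f c -
          ∑ u ∈ hU.toFinset, if (u.out : FacetCoset P f.J) = c then cellDiff o (y u) f else 0 := by
      rw [map_sum, coord_sub, coord_sum, Finsupp.sub_apply, Finsupp.finsetSum_apply]
      simp only [diff_chainAt, coord_chainAt, Finsupp.single_apply]
    obtain ⟨y', hy'⟩ := ih (p - diff q o (n + 1) z) (by rw [map_sub, hdp, diff_diff, sub_zero]) (by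
      intro f c hc
      by_contra hlt
      refine hc ?_
      have hle : ∀ u ∈ hU.toFinset, (u.out : FacetCoset P f.J) = c →
          cosetLength b c = N ∧ Disjoint f.J (descents b u.out) := by
        rintro u hu rfl
        have h1 : length b u.out = N := (hU.mem_toFinset.mp hu).1
        have h2 := cosetLength_le (b := b) (J := f.J) u.out
        have h3 : cosetLength b (u.out : FacetCoset P f.J) = N := by omega
        exact ⟨h3, disjoint_descents (h1.trans h3.symm)⟩
      rw [hz]
      by_cases h0 : coord hq p f c = 0
      · rw [h0, zero_sub, neg_eq_zero]
        refine Finset.sum_eq_zero fun u hu => ?_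
        by_cases huc : (u.out : FacetCoset P f.J) = c
        · rw [if_pos huc, hy u (hU.mem_toFinset.mp hu) f (hle u hu huc).2, huc, h0]
        · rw [if_neg huc]
      · have hN : cosetLength b c = N := by
          have := hp f c h0
          omega
        obtain ⟨w, hw, hwlen⟩ := exists_length_eq_cosetLength (b := b) c
        let u₀ : ExtWeyl P ⧸ Subgroup.center (ExtWeyl P) := w
        have hu₀ : w⁻¹ * u₀.out ∈ Subgroup.center (ExtWeyl P) :=
          QuotientGroup.eq.mp (QuotientGroup.out_eq' u₀).symm
        have h1 : u₀.out = w * (w⁻¹ * u₀.out) := (mul_inv_cancel_left _ _).symm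
        have hlen : length b u₀.out = N := by
          rw [h1, length_mul_Omega (mem_Omega_of_mem_center hu₀), hwlen, hN]
        have hmk : (u₀.out : FacetCoset P f.J) = c := by
          rw [← hw]
          exact (QuotientGroup.eq.mpr (center_le_facetGroup P f.J hu₀)).symm
        have hdis : Disjoint f.J (descents b u₀.out) :=
          disjoint_descents (by rw [hlen, hmk, hN])
        have hmem : u₀ ∈ U := ⟨hlen, f, hdis, by rw [hmk]; exact h0⟩
        rw [Finset.sum_eq_single_of_mem u₀ (hU.mem_toFinset.mpr hmem), if_pos hmk,
          hy u₀ hmem f hdis, hmk, sub_self]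
        -- A coset of minimal length N has only one class of minimal representatives modulo the
        -- centre, so exactly one summand contributes.
        intro v hv hne
        rw [if_neg]
        intro hvc
        refine hne ?_
        have h2 := inv_mul_mem_center f.subset f.nonempty (hle v hv hvc).2 (hvc.trans hmk.symm)
          ((hU.mem_toFinset.mp hv).1.trans hlen.symm)
        rw [← QuotientGroup.out_eq' u₀, ← QuotientGroup.out_eq' v, QuotientGroup.eq]
        exact h2)
    exact ⟨y' + z, by rw [map_add, hy', sub_add_cancel]⟩

lemma exists_diff_eq (hq : IsParameter b q) {n : ℕ} {p : PMod b q (n + 1)} (hp : diff q o n p = 0) :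
    ∃ y, diff q o (n + 1) y = p := by
  have h : ∃ N, ∀ f : Facet b (n + 1), ∀ c ∈ (coord hq p f).support, cosetLength b c < N := by
    refine ⟨(Finset.univ.sup fun f => (coord hq p f).support.sup (cosetLength b)) + 1,
      fun f c hc => Nat.lt_succ_iff.mpr ?_⟩
    exact (Finset.le_sup (f := cosetLength b) hc).trans
      (Finset.le_sup (f := fun f => (coord hq p f).support.sup (cosetLength b))
        (Finset.mem_univ f))
  obtain ⟨N, hN⟩ := h
  exact exists_diff_eq_of_level hq o N p hp fun f c hc => hN f c (Finsupp.mem_support_iff.mpr hc)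

/-! #### Degree zero -/

/-- The vertex off the given walls, one in every component. -/
def Facet.vertex {τ : ι → ι × ℤ}
    (hτ : ∀ θ, IsMaxCoroot b θ → τ θ ∈ simpleAff b ∧ comp b (τ θ) = θ) : Facet b 0 where
  J := {a ∈ simpleAff b | a ≠ τ (comp b a)}
  subset _ h := h.1
  nonempty := (alcoveFace_nonempty_iff fun _ h => h.1).mpr fun θ hθ =>
    ⟨τ θ, (hτ θ hθ).1, (hτ θ hθ).2, fun h => h.2 (by rw [(hτ θ hθ).2])⟩
  dim := by
    have h1 : {a ∈ simpleAff b | a ≠ τ (comp b a)} ⊆ simpleAff b := fun _ h => h.1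
    rw [finrank_faceDir_eq_zero_iff (b := b) h1]
    · intro a ha haJ a' ha' haJ' hc
      have h2 (c : ι × ℤ) (hc : c ∈ simpleAff b) (hcJ : c ∉ {a ∈ simpleAff b | a ≠ τ (comp b a)}) :
          c = τ (comp b c) := by
        by_contra h
        exact hcJ ⟨hc, h⟩
      rw [h2 a ha haJ, h2 a' ha' haJ', hc]
    · exact (alcoveFace_nonempty_iff h1).mpr fun θ hθ =>
        ⟨τ θ, (hτ θ hθ).1, (hτ θ hθ).2, fun h => h.2 (by rw [(hτ θ hθ).2])⟩

open Classical in
lemma exists_chainAt_eq_single {τ : ι → ι × ℤ}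
    (hτ : ∀ θ, IsMaxCoroot b θ → τ θ ∈ simpleAff b ∧ comp b (τ θ) = θ) (x : ExtWeyl P)
    (g : Facet b 0 → Hecke b q) :
    ∃ h y, chainAt hq x g = chainAt hq x (Pi.single (Facet.vertex hτ) h) + diff q o 0 y := by
  obtain ⟨y, hy⟩ := exists_cellDiff_eq_single o hτ g
  refine ⟨(g - cellDiff o y) (Facet.vertex hτ), chainAt hq x y, ?_⟩
  have h1 : g - cellDiff o y =
      Pi.single (Facet.vertex hτ) ((g - cellDiff o y) (Facet.vertex hτ)) := by
    funext f
    by_cases hf : f = Facet.vertex hτ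
    · rw [hf, Pi.single_eq_same]
    · rw [Pi.single_eq_of_ne hf]
      by_contra hne
      exact hf (Facet.eq_of_J_eq (hy f hne))
  rw [← h1, diff_chainAt, ← map_add, sub_add_cancel]

lemma twist_epsL {w : ExtWeyl P} (hw : w ∈ Omega b) {J J' : Set (ι × ℤ)} (h : affAct w '' J = J')
    (x : ExtWeyl P) :
    BalTensor.twist b q hw h (epsL hq J x) = epsL hq J' (x * w⁻¹) := by
  have h1 : (↑(unitT hq x⁻¹)⁻¹ : Hecke b q) * T b q w⁻¹ = ↑(unitT hq (w * x⁻¹))⁻¹ := by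
    rw [← one_mul (↑(unitT hq (w * x⁻¹))⁻¹ : Hecke b q), Units.eq_mul_inv_iff_mul_eq, mul_assoc,
      coe_unitT, T_Omega_mul (inv_mem_Omega hw), inv_mul_cancel_left, ← coe_unitT hq x⁻¹,
      Units.inv_mul]
  rw [epsL, epsL, BalTensor.twist_tmul, h1, T_Omega_mul hw, mul_inv_rev, inv_inv]

/-- The alcove of x in Ω is carried to the base alcove by permuting its vertices, with no signs
because vertices are positively oriented. -/
lemma omegaAct_chainAt {x : ExtWeyl P} (hx : x ∈ Omega b) (g : Facet b 0 → Hecke b q) :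
    omegaAct q o ⟨x, hx⟩ 0 (chainAt hq x g) =
      chainAt hq 1 fun f => g ((Facet.perm hx 0).symm f) := by
  funext F
  obtain ⟨f, rfl⟩ := (Facet.perm hx 0).surjective F
  rw [omegaAct_apply o ⟨x, hx⟩ _ (Facet.image_J hx f), orientSign_zero o (Facet.image_J hx f),
    one_smul, chainAt_apply, chainAt_apply, map_smul, twist_epsL, mul_inv_cancel,
    Equiv.symm_apply_apply]

open Classical in
/-- Up to boundaries and the action of `Ω`, every chain of degree zero is a multiple of the standard
generator at a given vertex. -/
lemma exists_average_chainAt {τ : ι → ι × ℤ}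
    (hτ : ∀ θ, IsMaxCoroot b θ → τ θ ∈ simpleAff b ∧ comp b (τ θ) = θ) (x : ExtWeyl P)
    (g : Facet b 0 → Hecke b q) : ∃ h y, average q o 0 (chainAt hq x g) =
      average q o 0 (chainAt hq 1 (Pi.single (Facet.vertex hτ) h) + diff q o 0 y) := by
  induction hN : length b x using Nat.strong_induction_on generalizing x g with
  | _ N ih =>
  by_cases hx : x ∈ Omega b
  · obtain ⟨h, y, hy⟩ := exists_chainAt_eq_single hq o hτ 1 fun f => g ((Facet.perm hx 0).symm f)
    exact ⟨h, y, by rw [← average_omegaAct q o ⟨x, hx⟩, omegaAct_chainAt, hy]⟩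
  -- The vertex is taken off walls that are no descents of x, so every descent of x is a wall
  -- through it. At this vertex x and x s_a define the same coset, and for a descent `a` the second
  -- representative is shorter.
  · obtain ⟨σ, hσ⟩ := exists_walls (b := b) x
    obtain ⟨h, y, hy⟩ := exists_chainAt_eq_single hq o
      (fun θ hθ => ⟨(hσ θ hθ).1, (hσ θ hθ).2.1⟩) x g
    set f₁ := Facet.vertex fun θ hθ => ⟨(hσ θ hθ).1, (hσ θ hθ).2.1⟩
    obtain ⟨a, ha, hxa⟩ := exists_descent hx
    have haJ : a ∈ f₁.J := by
      refine ⟨ha, fun h0 => (hσ _ (isMaxCoroot_comp ha)).2.2 ?_⟩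
      rw [← h0]
      exact ⟨ha, hxa⟩
    have h1 : chainAt hq x (Pi.single f₁ h) =
        chainAt hq (x * affRefl P a) (Pi.single f₁ h) := by
      funext f
      rw [chainAt_apply, chainAt_apply]
      by_cases hf : f = f₁
      · subst hf
        rw [epsL_eq hq f₁.subset (mk_mul_affRefl haJ x)]
      · rw [Pi.single_eq_of_ne hf, zero_tmul_one_smul, zero_tmul_one_smul]
    have hlen := length_mul_affRefl_of_notMem ha hxa
    obtain ⟨h', y', hy'⟩ := ih _ (by omega) (x * affRefl P a) (Pi.single f₁ h) rfl
    exact ⟨h', y' + y, by rw [hy, map_add, h1, hy', ← map_add, map_add (diff q o 0), add_assoc]⟩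

open Classical in
lemma exists_average_eq {τ : ι → ι × ℤ}
    (hτ : ∀ θ, IsMaxCoroot b θ → τ θ ∈ simpleAff b ∧ comp b (τ θ) = θ) (p : PMod b q 0) :
    ∃ h y, average q o 0 p =
      average q o 0 (chainAt hq 1 (Pi.single (Facet.vertex hτ) h) + diff q o 0 y) := by
  have hadd (p p' : PMod b q 0) (hp : ∃ h y, average q o 0 p =
      average q o 0 (chainAt hq 1 (Pi.single (Facet.vertex hτ) h) + diff q o 0 y))
      (hp' : ∃ h y, average q o 0 p' =
      average q o 0 (chainAt hq 1 (Pi.single (Facet.vertex hτ) h) + diff q o 0 y)) :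
      ∃ h y, average q o 0 (p + p') =
      average q o 0 (chainAt hq 1 (Pi.single (Facet.vertex hτ) h) + diff q o 0 y) := by
    obtain ⟨h, y, hy⟩ := hp
    obtain ⟨h', y', hy'⟩ := hp'
    refine ⟨h + h', y + y', ?_⟩
    rw [map_add, hy, hy', ← map_add, Pi.single_add, map_add (chainAt hq 1), map_add (diff q o 0),
      add_add_add_comm]
  have hzero : ∃ h y, average q o 0 (0 : PMod b q 0) =
      average q o 0 (chainAt hq 1 (Pi.single (Facet.vertex hτ) h) + diff q o 0 y) :=
    ⟨0, 0, by rw [Pi.single_zero, map_zero, map_zero, map_zero, add_zero, map_zero]⟩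
  rw [← Finset.univ_sum_single p]
  refine Finset.sum_induction _ (fun p => ∃ h y, average q o 0 p =
      average q o 0 (chainAt hq 1 (Pi.single (Facet.vertex hτ) h) + diff q o 0 y)) hadd hzero ?_
  intro f _
  induction p f using BalTensor.induction_T with
  | zero => rw [Pi.single_zero]; exact hzero
  | add m m' hm hm' => rw [Pi.single_add]; exact hadd _ _ hm hm'
  | tmul h w =>
    have h1 : (Pi.single f (BalTensor.tmul b q f.J h (T b q w)) : PMod b q 0) =
        chainAt hq w⁻¹ (Pi.single f (h * T b q w)) := by
      funext f'
      rw [chainAt_apply]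
      by_cases hf : f' = f
      · subst hf
        rw [Pi.single_eq_same, Pi.single_eq_same, tmul_T_eq_smul_epsL hq]
      · rw [Pi.single_eq_of_ne hf, Pi.single_eq_of_ne hf, zero_tmul_one_smul]
    rw [h1]
    exact exists_average_chainAt hq o hτ _ _

open Classical in
lemma augmentation_chainAt_single (f : Facet b 0) (h : Hecke b q) :
    augmentation b q (chainAt hq 1 (Pi.single f h)) = h := by
  rw [augmentation_apply, Finset.sum_eq_single_of_mem f (Finset.mem_univ f)]
  · rw [chainAt_apply, Pi.single_eq_same, epsL, BalTensor.smul_tmul, mulMap_tmul, mul_one, mul_assoc,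
      ← coe_unitT hq, Units.inv_mul, mul_one]
  · intro f' _ hf
    rw [chainAt_apply, Pi.single_eq_of_ne hf, zero_tmul_one_smul, map_zero]

/-- The chain with coefficient h at a single vertex of the base alcove is mapped to h, and averaging
does not change the augmentation. -/
theorem map_augmentation (hq : IsParameter b q) :
    Submodule.map (augmentation b q) (PInv q o 0) = ⊤ := by
  classical
  rw [eq_top_iff]
  rintro h -
  obtain ⟨τ, hτ⟩ := exists_walls (b := b) 1
  exact ⟨_, average_mem q o (chainAt hq 1 (Pi.single
    (Facet.vertex fun θ hθ => ⟨(hτ θ hθ).1, (hτ θ hθ).2.1⟩) h)), by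
    rw [augmentation_average, augmentation_chainAt_single]⟩

lemma diff_mem_PInv {n : ℕ} {p : PMod b q (n + 1)} (hp : p ∈ PInv q o (n + 1)) :
    diff q o n p ∈ PInv q o n := by
  rw [mem_PInv] at hp ⊢
  intro w
  rw [← diff_omegaAct, hp]

theorem map_diff_zero (hq : IsParameter b q) : Submodule.map (diff q o 0) (PInv q o 1) =
    PInv q o 0 ⊓ LinearMap.ker (augmentation b q) := by
  classical
  refine le_antisymm ?_ ?_
  · rintro _ ⟨p, hp, rfl⟩
    exact ⟨diff_mem_PInv o hp, augmentation_diff q o p⟩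
  · rintro p ⟨hp, hp0⟩
    obtain ⟨τ, hτ⟩ := exists_walls (b := b) 1
    obtain ⟨h, y, hy⟩ := exists_average_eq hq o
      (fun θ hθ => ⟨(hτ θ hθ).1, (hτ θ hθ).2.1⟩) p
    -- The augmentation reads off the coefficient h, since it kills boundaries and ignores
    -- averaging. For a chain in the kernel h is therefore zero, and only the average of a boundary
    -- remains.
    have h1 := congrArg (augmentation b q) hy
    rw [augmentation_average, augmentation_average, map_add, augmentation_chainAt_single,
      augmentation_diff, add_zero] at h1
    rw [average_of_mem q o hp, ← h1, LinearMap.mem_ker.mp hp0, Pi.single_zero, map_zero, zero_add,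
      ← diff_average] at hy
    exact ⟨_, average_mem q o y, hy.symm⟩

/-- Here the complex is exact before taking invariants. Averaging a primitive of an invariant cycle
gives an invariant primitive. -/
theorem map_diff_succ (hq : IsParameter b q) (n : ℕ) :
    Submodule.map (diff q o (n + 1)) (PInv q o (n + 2)) =
      PInv q o (n + 1) ⊓ LinearMap.ker (diff q o n) := by
  refine le_antisymm ?_ ?_
  · rintro _ ⟨p, hp, rfl⟩
    exact ⟨diff_mem_PInv o hp, diff_diff q o p⟩
  · rintro p ⟨hp, hp0⟩
    obtain ⟨y, hy⟩ := exists_diff_eq o hq (LinearMap.mem_ker.mp hp0)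
    exact ⟨_, average_mem q o y, by rw [diff_average, hy, average_of_mem q o hp]⟩

end Exact

end

end AffineHecke

namespace AffineHecke

noncomputable section

set_option linter.unusedSectionVars false

/-! ### Projectivity on one side -/

section Side

variable {R A M N : Type*} [Ring R] [Ring A] (φ : R →+* A) [AddCommGroup M] [Module A M]
  [AddCommGroup N] [Module A N]

/-- Projectivity of the restriction of a module along a ring homomorphism. -/
def ProjectiveVia (φ : R →+* A) (M : Type*) [AddCommGroup M] [Module A M] : Prop :=
  letI : Module R M := Module.compHom M φ
  Module.Projective R M

lemma ProjectiveVia.of_split {φ : R →+* A} (hN : ProjectiveVia φ N) (i : M →ₗ[A] N) (s : N →ₗ[A] M)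
    (h : ∀ m, s (i m) = m) : ProjectiveVia φ M := by
  let : Module R M := Module.compHom M φ
  let : Module R N := Module.compHom N φ
  have hN : Module.Projective R N := hN
  let i' : M →ₗ[R] N := { i with map_smul' := fun r m => i.map_smul (φ r) m }
  let s' : N →ₗ[R] M := { s with map_smul' := fun r m => s.map_smul (φ r) m }
  exact Module.Projective.of_split i' s' (LinearMap.ext h)

lemma ProjectiveVia.of_addEquiv {φ : R →+* A} {C : Type*} (e : M ≃+ (C →₀ R))
    (he : ∀ r m, e (φ r • m) = r • e m) : ProjectiveVia φ M := by
  let : Module R M := Module.compHom M φ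
  let e' : M ≃ₗ[R] (C →₀ R) := { e with map_smul' := he }
  exact Module.Projective.of_equiv' e'.symm

lemma ProjectiveVia.pi {φ : R →+* A} {κ : Type*} [Finite κ] {M : κ → Type*}
    [∀ k, AddCommGroup (M k)] [∀ k, Module A (M k)] (h : ∀ k, ProjectiveVia φ (M k)) :
    ProjectiveVia φ (∀ k, M k) := by
  classical
  have := Fintype.ofFinite κ
  let (k : κ) : Module R (M k) := Module.compHom (M k) φ
  have h' (k : κ) : Module.Projective R (M k) := h k
  exact Module.Projective.of_equiv' (DFinsupp.linearEquivFunOnFintype (R := R) (M := M))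

end Side

section ProjectiveSide

variable {ι X Y : Type*} [Finite ι] [AddCommGroup X] [AddCommGroup Y] {P : RootDatum ι X Y}
  [P.IsReduced] {b : P.Base} {q : ExtWeyl P → ℝ} (o : Orientations b)

/-- The projection to the invariants. -/
def toPInv (q : ExtWeyl P → ℝ) (o : Orientations b) (n : ℕ) : PMod b q n →ₗ[Env b q] PInv q o n :=
  (average q o n).codRestrict (PInv q o n) (average_mem q o)

lemma toPInv_coe {n : ℕ} (p : PInv q o n) : toPInv q o n p = p :=
  Subtype.ext (average_of_mem q o p.2)

theorem projectiveLeft_PInv (hq : IsParameter b q) (n : ℕ) : ProjectiveLeft b q (PInv q o n) := by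
  have h : ProjectiveVia (Algebra.TensorProduct.includeLeft : Hecke b q →ₐ[ℂ] Env b q).toRingHom
      (PMod b q n) :=
    ProjectiveVia.pi fun f => ProjectiveVia.of_addEquiv (equivL hq f.subset f.nonempty)
      (coordL_smul hq f.subset f.nonempty)
  exact h.of_split (PInv q o n).subtype (toPInv q o n) (toPInv_coe o)

theorem projectiveRight_PInv (hq : IsParameter b q) (n : ℕ) :
    ProjectiveRight b q (PInv q o n) := by
  have h : ProjectiveVia
      (Algebra.TensorProduct.includeRight : (Hecke b q)ᵐᵒᵖ →ₐ[ℂ] Env b q).toRingHom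
      (PMod b q n) :=
    ProjectiveVia.pi fun f => ProjectiveVia.of_addEquiv (equivR hq f.subset f.nonempty)
      fun r m => coordR_smul hq f.subset f.nonempty (unop r) m
  exact h.of_split (PInv q o n).subtype (toPInv q o n) (toPInv_coe o)

end ProjectiveSide

/-! ### The centre in the semisimple case -/

section Semisimple

variable {ι X Y : Type*} [Finite ι] [AddCommGroup X] [AddCommGroup Y] {P : RootDatum ι X Y}

lemma pairing_root_eq_zero (b : P.Base) {y : Y}
    (h : ∀ i ∈ b.support, P.toLinearMap (P.root i) y = 0) (i : ι) :
    P.toLinearMap (P.root i) y = 0 := by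
  have key : ∀ x ∈ AddSubmonoid.closure (P.root '' b.support), P.toLinearMap x y = 0 := by
    intro x hx
    induction hx using AddSubmonoid.closure_induction with
    | mem x hx =>
      obtain ⟨j, hj, rfl⟩ := hx
      exact h j hj
    | zero => simp
    | add x x' _ _ hx hx' => rw [map_add, LinearMap.add_apply, hx, hx', add_zero]
  rcases b.root_mem_or_neg_mem i with h1 | h1
  · exact key _ h1
  · have := key _ h1
    rwa [map_neg, LinearMap.neg_apply, neg_eq_zero] at this

/-- The determinant of the Cartan matrix serves as d, and the adjugate gives the coefficients. The
difference of both sides is orthogonal to all roots, hence zero by semisimplicity. -/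
lemma exists_smul_eq_sum_coroot (b : P.Base) (hP : IsSemisimpleDatum P) :
    ∃ d : ℤ, d ≠ 0 ∧ ∀ y : Y, ∃ c : b.support → ℤ, d • y = ∑ j, c j • P.coroot j := by
  classical
  refine ⟨_, cartan_det_ne_zero b, fun y => ?_⟩
  set C := Matrix.of fun i j : b.support => P.pairing i j with hC
  let v : b.support → ℤ := fun i => P.toLinearMap (P.root i) y
  refine ⟨C.adjugate.mulVec v, sub_eq_zero.mp (hP _ (pairing_root_eq_zero b fun i hi => ?_))⟩
  have h1 : C.mulVec (C.adjugate.mulVec v) = C.det • v := by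
    rw [Matrix.mulVec_mulVec, Matrix.mul_adjugate, Matrix.smul_mulVec, Matrix.one_mulVec]
  have h2 := congrFun h1 ⟨i, hi⟩
  rw [map_sub, map_smul, map_sum, sub_eq_zero]
  simp only [map_smul, Matrix.mulVec, dotProduct, Pi.smul_apply] at h2 ⊢
  rw [← h2]
  refine Finset.sum_congr rfl fun j _ => ?_
  rw [smul_eq_mul, mul_comm]
  rfl

/-- A central element is a translation orthogonal to all coroots. These span Y up to finite index in
the semisimple case, so perfectness of the pairing leaves only zero. -/
lemma eq_one_of_mem_center (b : P.Base) (hP : IsSemisimpleDatum P) {z : ExtWeyl P}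
    (hz : z ∈ Subgroup.center (ExtWeyl P)) : z = 1 := by
  have h1 := affAct_of_mem_center hz
  have h2 := right_eq_one_of_affAct h1
  have h3 (i : ι) : P.toLinearMap z.left.toAdd (P.coroot i) = 0 := by
    have h4 := congrArg Prod.snd (h1 (i, 0))
    simpa only [affAct, h2, one_smul, zero_sub, neg_eq_zero] using h4
  refine SemidirectProduct.ext ?_ h2
  apply Multiplicative.toAdd.injective
  apply toLinearMap_injective P
  ext y
  obtain ⟨d, hd, h⟩ := exists_smul_eq_sum_coroot b hP
  obtain ⟨c, hc⟩ := h y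
  have h5 := congrArg (P.toLinearMap z.left.toAdd) hc
  rw [map_smul, map_sum, Finset.sum_eq_zero fun j _ => by rw [map_smul, h3, smul_zero],
    smul_eq_mul] at h5
  rw [(mul_eq_zero.mp h5).resolve_left hd]
  simp

end Semisimple

/-! ### The finite Hecke algebras -/

section FiniteHecke

variable {ι X Y : Type*} [Finite ι] [AddCommGroup X] [AddCommGroup Y] {P : RootDatum ι X Y}
  [P.IsReduced] {b : P.Base} {q : ExtWeyl P → ℝ} (hq : IsParameter b q)

/-- The bilinear form for which the `T_w` are orthogonal of norm `q(w)`. -/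
def form (hq : IsParameter b q) : Hecke b q →ₗ[ℂ] Hecke b q →ₗ[ℂ] ℂ :=
  (basisT hq).constr ℂ fun w => (q w : ℂ) • (basisT hq).coord w

lemma form_T_apply (w : ExtWeyl P) (h : Hecke b q) :
    form hq (T b q w) h = q w * (basisT hq).coord w h := by
  rw [← basisT_apply hq, form, Module.Basis.constr_basis, LinearMap.smul_apply, smul_eq_mul]

open Classical in
lemma form_T_T (w v : ExtWeyl P) :
    form hq (T b q w) (T b q v) = if w = v then (q w : ℂ) else 0 := by
  rw [form_T_apply, ← basisT_apply hq v, Module.Basis.coord_apply, Module.Basis.repr_self,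
    Finsupp.single_apply]
  by_cases h : w = v
  · rw [if_pos h.symm, if_pos h, mul_one]
  · rw [if_neg (Ne.symm h), if_neg h, mul_zero]

/-- Left multiplication by T_s is self-adjoint. It preserves the plane of T_w and T_{sw}, where the
norms q(w) and q(s) q(w) are just those for which its matrix is symmetric. -/
lemma form_affRefl_mul {a : ι × ℤ} (ha : a ∈ simpleAff b) (g h : Hecke b q) :
    form hq (T b q (affRefl P a) * g) h = form hq g (T b q (affRefl P a) * h) := by
  classical
  set s := affRefl P a
  have key : (form hq).comp (LinearMap.mulLeft ℂ (T b q s)) =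
      (form hq).compl₂ (LinearMap.mulLeft ℂ (T b q s)) := by
    refine (basisT hq).ext fun w => (basisT hq).ext fun v => ?_
    simp only [basisT_apply, LinearMap.comp_apply, LinearMap.compl₂_apply, LinearMap.mulLeft_apply]
    have hs (u : ExtWeyl P) : s * (s * u) = u := affRefl_mul_cancel_left a u
    have hneg (u : ExtWeyl P) := affAct_affRefl_mul_inv (b := b) u a
    by_cases hw : affAct w⁻¹ a ∈ posAff b
    · by_cases hv : affAct v⁻¹ a ∈ posAff b
      · rw [T_affRefl_mul ha hw, T_affRefl_mul ha hv, form_T_T, form_T_T, if_neg, if_neg]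
        · rintro rfl
          exact (hneg v).mp hw hv
        · rintro rfl
          exact (hneg w).mp hv hw
      · rw [T_affRefl_mul ha hw, T_affRefl_mul_of_notMem ha hv, map_add, map_smul, map_smul,
          form_T_T, form_T_T, form_T_T, if_neg (c := w = v) (by rintro rfl; exact hv hw), smul_zero,
          add_zero]
        by_cases h : s * w = v
        · rw [if_pos h, if_pos (by rw [← h]; exact (hs w).symm), hq.affRefl_mul ha hw,
            Complex.ofReal_mul, smul_eq_mul]
        · rw [if_neg h, if_neg (by rintro rfl; exact h (hs v)), smul_zero]
    · by_cases hv : affAct v⁻¹ a ∈ posAff b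
      · rw [T_affRefl_mul_of_notMem ha hw, T_affRefl_mul ha hv, map_add, map_smul, map_smul,
          LinearMap.add_apply, LinearMap.smul_apply, LinearMap.smul_apply, form_T_T, form_T_T,
          form_T_T, if_neg (c := w = v) (by rintro rfl; exact hw hv), smul_zero, add_zero]
        by_cases h : w = s * v
        · rw [if_pos h, if_pos (by rw [h]; exact hs v), h, hq.affRefl_mul ha hv, smul_eq_mul,
            hs, Complex.ofReal_mul]
        · rw [if_neg h, if_neg (by rintro rfl; exact h (hs w).symm), smul_zero]
      · have h1 : form hq (T b q (s * w)) (T b q v) = 0 := by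
          rw [form_T_T, if_neg]
          rintro rfl
          exact hv ((hneg w).mpr hw)
        have h2 : form hq (T b q w) (T b q (s * v)) = 0 := by
          rw [form_T_T, if_neg]
          rintro rfl
          exact hw ((hneg v).mpr hv)
        rw [T_affRefl_mul_of_notMem ha hw, T_affRefl_mul_of_notMem ha hv, map_add, map_smul,
          map_smul, LinearMap.add_apply, LinearMap.smul_apply, LinearMap.smul_apply, map_add,
          map_smul, map_smul, h1, h2]
  exact LinearMap.congr_fun (LinearMap.congr_fun key g) h

/-- Induction on the elements of `W_J` by multiplication with simple reflections on the left. -/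
lemma stabJ_induction {J : Set (ι × ℤ)} (hJ : J ⊆ simpleAff b) (hne : (alcoveFace b J).Nonempty)
    {p : ExtWeyl P → Prop} (one : p 1) (mul : ∀ a ∈ J, ∀ w ∈ stabJ P J, affAct w⁻¹ a ∈ posAff b →
      p w → p (affRefl P a * w)) {w : ExtWeyl P} (hw : w ∈ stabJ P J) : p w := by
  induction hn : length b w generalizing w with
  | zero => rwa [eq_one_of_mem_stabJ hJ hw hn]
  | succ n ih =>
    obtain ⟨a, ha, hwa⟩ := exists_descent_of_mem_stabJ hJ hne (inv_mem hw) (by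
      intro h1
      rw [inv_eq_one] at h1
      rw [h1, length_one] at hn
      omega)
    have h1 := length_affRefl_mul_of_notMem (hJ ha) hwa
    have h2 : affRefl P a * w ∈ stabJ P J := mul_mem (affRefl_mem_stabJ ha) hw
    have h3 := mul a ha _ h2 ((affAct_affRefl_mul_inv w a).mpr hwa) (ih h2 (by omega))
    rwa [affRefl_mul_cancel_left] at h3

lemma form_T_mul {J : Set (ι × ℤ)} (hJ : J ⊆ simpleAff b) (hne : (alcoveFace b J).Nonempty)
    {u : ExtWeyl P} (hu : u ∈ stabJ P J) (g h : Hecke b q) :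
    form hq (T b q u * g) h = form hq g (T b q u⁻¹ * h) := by
  refine stabJ_induction hJ hne (p := fun u => ∀ g h,
    form hq (T b q u * g) h = form hq g (T b q u⁻¹ * h)) ?_ ?_ hu g h
  · intro g h
    rw [inv_one, T_one, one_mul, one_mul]
  · intro a ha w _ hwa ih g h
    rw [← T_affRefl_mul (hJ ha) hwa, mul_inv_rev, affRefl_inv, ← T_mul_affRefl (hJ ha) hwa,
      mul_assoc, mul_assoc, form_affRefl_mul hq (hJ ha), ih]

/-- The real span of the `T_w`, `w ∈ W_J`. -/
def realSpan (b : P.Base) (q : ExtWeyl P → ℝ) (J : Set (ι × ℤ)) : Submodule ℝ (Hecke b q) :=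
  Submodule.span ℝ (Set.range fun w : stabJ P J => T b q w)

lemma T_mem_realSpan {J : Set (ι × ℤ)} {w : ExtWeyl P} (hw : w ∈ stabJ P J) :
    T b q w ∈ realSpan b q J := Submodule.subset_span ⟨⟨w, hw⟩, rfl⟩

lemma T_mul_mem_realSpan {J : Set (ι × ℤ)} (hJ : J ⊆ simpleAff b)
    (hne : (alcoveFace b J).Nonempty) {u : ExtWeyl P} (hu : u ∈ stabJ P J) {h : Hecke b q}
    (hh : h ∈ realSpan b q J) : T b q u * h ∈ realSpan b q J := by
  refine stabJ_induction hJ hne (p := fun u => ∀ h ∈ realSpan b q J,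
    T b q u * h ∈ realSpan b q J) ?_ ?_ hu h hh
  · intro h hh
    rwa [T_one, one_mul]
  · intro a ha w _ hwa ih h hh
    rw [← T_affRefl_mul (hJ ha) hwa, mul_assoc]
    have h1 := ih h hh
    generalize T b q w * h = g at h1
    rw [realSpan] at h1
    induction h1 using Submodule.span_induction with
    | mem x hx =>
      obtain ⟨v, rfl⟩ := hx
      have hv : affRefl P a * v.1 ∈ stabJ P J := mul_mem (affRefl_mem_stabJ ha) v.2
      by_cases hva : affAct v.1⁻¹ a ∈ posAff b
      · rw [T_affRefl_mul (hJ ha) hva]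
        exact T_mem_realSpan hv
      · rw [T_affRefl_mul_of_notMem (hJ ha) hva]
        have h2 : ((q (affRefl P a) : ℂ) - 1) = ((q (affRefl P a) - 1 : ℝ) : ℂ) := by push_cast; rfl
        rw [h2, Complex.coe_smul, Complex.coe_smul]
        exact add_mem (Submodule.smul_mem _ _ (T_mem_realSpan hv))
          (Submodule.smul_mem _ _ (T_mem_realSpan v.2))
    | zero => rw [mul_zero]; exact zero_mem _
    | add x y _ _ hx hy => rw [mul_add]; exact add_mem hx hy
    | smul r x _ hx => rw [mul_smul_comm]; exact Submodule.smul_mem _ _ hx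

/-- For real coefficients the form is Σ c(w)² q(w), with q > 0. The form is bilinear and not
hermitian, so definiteness is restricted to the real span. -/
lemma form_self_nonneg {J : Set (ι × ℤ)} (hne : (alcoveFace b J).Nonempty) {h : Hecke b q}
    (hh : h ∈ realSpan b q J) :
    0 ≤ (form hq h h).re ∧ ((form hq h h).re = 0 → h = 0) := by
  classical
  have := finite_stabJ hne
  have := Fintype.ofFinite (stabJ P J)
  obtain ⟨c, rfl⟩ := (Submodule.mem_span_range_iff_exists_fun ℝ).mp hh
  have h1 : form hq (∑ w, c w • T b q w.1) (∑ w, c w • T b q w.1) =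
      ((∑ w : stabJ P J, c w ^ 2 * q w : ℝ) : ℂ) := by
    simp only [map_sum, LinearMap.sum_apply, ← Complex.coe_smul, map_smul, LinearMap.smul_apply,
      form_T_T, Subtype.val_inj]
    push_cast
    refine Finset.sum_congr rfl fun w _ => ?_
    rw [Finset.sum_eq_single_of_mem w (Finset.mem_univ w)]
    · rw [if_pos rfl, smul_eq_mul, smul_eq_mul]
      ring
    · intro v _ hv
      rw [if_neg hv, smul_zero]
  rw [h1, Complex.ofReal_re]
  have h2 (w : stabJ P J) : 0 ≤ c w ^ 2 * q w := mul_nonneg (sq_nonneg _) (hq.pos _).le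
  refine ⟨Finset.sum_nonneg fun w _ => h2 w, fun h0 => Finset.sum_eq_zero fun w hw => ?_⟩
  have h3 := (Finset.sum_eq_zero_iff_of_nonneg fun w _ => h2 w).mp h0 w hw
  rw [pow_eq_zero_iff two_ne_zero |>.mp ((mul_eq_zero.mp h3).resolve_right (hq.pos _).ne'),
    zero_smul]

end FiniteHecke

end

end AffineHecke

namespace AffineHecke

noncomputable section

set_option linter.unusedSectionVars false

/-! ### Projectivity as bimodules -/

section Casimir

variable {ι X Y : Type*} [Finite ι] [AddCommGroup X] [AddCommGroup Y] {P : RootDatum ι X Y}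
  [P.IsReduced] {b : P.Base} {q : ExtWeyl P → ℝ}

/-- The summand `q(w)⁻¹ T_w ⊗ T_{w⁻¹}` of the Casimir element. -/
def casimirTerm (b : P.Base) (q : ExtWeyl P → ℝ) (w : ExtWeyl P) : Env b q :=
  ((q w : ℂ)⁻¹ • T b q w) ⊗ₜ[ℂ] op (T b q w⁻¹)

/-- The terms of w and s w cancel against each other: the weights q(w)⁻¹ and (q(s) q(w))⁻¹ balance
the factor q(s) in the quadratic relation. -/
lemma casimirTerm_add (hq : IsParameter b q) {a : ι × ℤ} (ha : a ∈ simpleAff b) {w : ExtWeyl P}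
    (hw : affAct w⁻¹ a ∈ posAff b) :
    (T b q (affRefl P a) ⊗ₜ[ℂ] (1 : (Hecke b q)ᵐᵒᵖ) - (1 : Hecke b q) ⊗ₜ[ℂ] op (T b q (affRefl P a)))
        * casimirTerm b q w +
      (T b q (affRefl P a) ⊗ₜ[ℂ] (1 : (Hecke b q)ᵐᵒᵖ) -
          (1 : Hecke b q) ⊗ₜ[ℂ] op (T b q (affRefl P a))) *
        casimirTerm b q (affRefl P a * w) = 0 := by
  have hqa : (q (affRefl P a) : ℂ) ≠ 0 := by exact_mod_cast (hq.pos _).ne'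
  have hqw : (q w : ℂ) ≠ 0 := by exact_mod_cast (hq.pos _).ne'
  have h1 := T_affRefl_mul (q := q) ha hw
  have h2 := T_mul_affRefl (q := q) ha hw
  have h3 := T_affRefl_mul_of_notMem (q := q) ha
    (w := affRefl P a * w) (fun h => (affAct_affRefl_mul_inv w a).mp h hw)
  have h4 := T_mul_affRefl_of_notMem (q := q) ha (w := w⁻¹ * affRefl P a) (by
    rw [affAct_mul_affRefl]
    exact not_not.mpr hw)
  rw [affRefl_mul_cancel_left] at h3
  rw [affRefl_mul_cancel_right] at h4
  simp only [casimirTerm, sub_mul, Algebra.TensorProduct.tmul_mul_tmul, one_mul, mul_smul_comm,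
    mul_inv_rev, affRefl_inv, ← op_mul, h1, h2, h3, h4, hq.affRefl_mul ha hw, op_add, op_smul,
    TensorProduct.tmul_add, TensorProduct.add_tmul, TensorProduct.tmul_smul,
    ← TensorProduct.smul_tmul', Complex.ofReal_mul]
  match_scalars <;> field_simp <;> ring

variable {J : Set (ι × ℤ)} [Fintype (stabJ P J)]

/-- The Casimir element of `H(W_J, q)`. -/
def casimir (b : P.Base) (q : ExtWeyl P → ℝ) (J : Set (ι × ℤ)) [Fintype (stabJ P J)] : Env b q :=
  ∑ w : stabJ P J, casimirTerm b q w

/-- The sum over W_J splits into pairs under the involution w ↦ s w, which has no fixed points, and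
each pair cancels. -/
lemma affRefl_casimir (hq : IsParameter b q) (hJ : J ⊆ simpleAff b) {a : ι × ℤ} (ha : a ∈ J) :
    (T b q (affRefl P a) ⊗ₜ[ℂ] (1 : (Hecke b q)ᵐᵒᵖ) -
      (1 : Hecke b q) ⊗ₜ[ℂ] op (T b q (affRefl P a))) * casimir b q J = 0 := by
  rw [casimir, Finset.mul_sum]
  let s : stabJ P J := ⟨affRefl P a, affRefl_mem_stabJ ha⟩
  have hs (w : stabJ P J) : s * (s * w) = w := Subtype.ext (affRefl_mul_cancel_left a w.1)
  refine Finset.sum_involution (fun w _ => s * w) (fun w _ => ?_) (fun w _ _ h => ?_)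
    (fun w _ => Finset.mem_univ _) fun w _ => hs w
  · by_cases hw : affAct w.1⁻¹ a ∈ posAff b
    · exact casimirTerm_add hq (hJ ha) hw
    · have h1 := casimirTerm_add (q := q) hq (hJ ha) ((affAct_affRefl_mul_inv w.1 a).mpr hw)
      rw [affRefl_mul_cancel_left, add_comm] at h1
      exact h1
  · have h1 : affRefl P a = 1 := congrArg Subtype.val (mul_eq_right.mp h)
    have h2 := length_affRefl (b := b) (hJ ha)
    rw [h1, length_one] at h2
    omega

/-- The elements c for which both actions agree are closed under products because the left and right
factors commute in the enveloping algebra. Semisimplicity makes Z(W) trivial, so the T_w with w in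
W_J suffice as generators. -/
lemma casimir_comm (hq : IsParameter b q) (hP : IsSemisimpleDatum P) (hJ : J ⊆ simpleAff b)
    (hne : (alcoveFace b J).Nonempty) {c : Hecke b q} (hc : c ∈ subJ b q J) :
    c ⊗ₜ[ℂ] (1 : (Hecke b q)ᵐᵒᵖ) * casimir b q J = (1 : Hecke b q) ⊗ₜ[ℂ] op c * casimir b q J := by
  have hmul (c d : Hecke b q)
      (hc : c ⊗ₜ[ℂ] (1 : (Hecke b q)ᵐᵒᵖ) * casimir b q J =
        (1 : Hecke b q) ⊗ₜ[ℂ] op c * casimir b q J)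
      (hd : d ⊗ₜ[ℂ] (1 : (Hecke b q)ᵐᵒᵖ) * casimir b q J =
        (1 : Hecke b q) ⊗ₜ[ℂ] op d * casimir b q J) :
      (c * d) ⊗ₜ[ℂ] (1 : (Hecke b q)ᵐᵒᵖ) * casimir b q J =
        (1 : Hecke b q) ⊗ₜ[ℂ] op (c * d) * casimir b q J := by
    have h1 : (c * d) ⊗ₜ[ℂ] (1 : (Hecke b q)ᵐᵒᵖ) = c ⊗ₜ[ℂ] (1 : (Hecke b q)ᵐᵒᵖ) * d ⊗ₜ[ℂ] 1 := by
      rw [Algebra.TensorProduct.tmul_mul_tmul, one_mul]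
    have h2 : (1 : Hecke b q) ⊗ₜ[ℂ] op (c * d) =
        (1 : Hecke b q) ⊗ₜ[ℂ] op d * (1 : Hecke b q) ⊗ₜ[ℂ] op c := by
      rw [Algebra.TensorProduct.tmul_mul_tmul, one_mul, op_mul]
    have h3 : c ⊗ₜ[ℂ] (1 : (Hecke b q)ᵐᵒᵖ) * (1 : Hecke b q) ⊗ₜ[ℂ] op d =
        (1 : Hecke b q) ⊗ₜ[ℂ] op d * c ⊗ₜ[ℂ] (1 : (Hecke b q)ᵐᵒᵖ) := by
      rw [Algebra.TensorProduct.tmul_mul_tmul, Algebra.TensorProduct.tmul_mul_tmul, one_mul, mul_one,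
        one_mul, mul_one]
    rw [h1, mul_assoc, hd, ← mul_assoc, h3, mul_assoc, hc, ← mul_assoc, h2]
  have hT : ∀ w ∈ stabJ P J, T b q w ⊗ₜ[ℂ] (1 : (Hecke b q)ᵐᵒᵖ) * casimir b q J =
      (1 : Hecke b q) ⊗ₜ[ℂ] op (T b q w) * casimir b q J := fun w hw => by
    refine stabJ_induction hJ hne (p := fun w => T b q w ⊗ₜ[ℂ] (1 : (Hecke b q)ᵐᵒᵖ) *
      casimir b q J = (1 : Hecke b q) ⊗ₜ[ℂ] op (T b q w) * casimir b q J) ?_ ?_ hw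
    · rw [T_one, op_one]
    · intro a ha w _ hwa ih
      rw [← T_affRefl_mul (hJ ha) hwa]
      refine hmul _ _ ?_ ih
      have h1 := affRefl_casimir (q := q) hq hJ ha
      rwa [sub_mul, sub_eq_zero] at h1
  rw [subJ, ← Algebra.adjoin_union] at hc
  induction hc using Algebra.adjoin_induction with
  | mem x hx =>
    rcases hx with ⟨v, hv, rfl⟩ | ⟨z, hz, rfl⟩
    · exact hT v hv
    · rw [eq_one_of_mem_center b hP hz]
      exact hT 1 (one_mem _)
  | algebraMap r =>
    congr 1
    rw [Algebra.algebraMap_eq_smul_one, op_smul, op_one, TensorProduct.smul_tmul]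
  | add x y _ _ hx hy =>
    rw [TensorProduct.add_tmul, op_add, TensorProduct.tmul_add, add_mul, add_mul, hx, hy]
  | mul x y _ _ hx hy => exact hmul x y hx hy

/-- The image of the Casimir element under multiplication. -/
def casimirMul (b : P.Base) (q : ExtWeyl P → ℝ) (J : Set (ι × ℤ)) [Fintype (stabJ P J)] :
    Hecke b q := ∑ w : stabJ P J, ((q w : ℂ)⁻¹ • T b q w) * T b q w.1⁻¹

lemma casimir_smul_one : casimir b q J • (1 : Hecke b q) = casimirMul b q J := by
  rw [casimir, Finset.sum_smul, casimirMul]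
  refine Finset.sum_congr rfl fun w _ => ?_
  rw [casimirTerm, TensorProduct.Algebra.smul_def, op_smul_eq_mul, one_mul, smul_eq_mul]

lemma casimirMul_comm (hq : IsParameter b q) (hP : IsSemisimpleDatum P) (hJ : J ⊆ simpleAff b)
    (hne : (alcoveFace b J).Nonempty) {c : Hecke b q} (hc : c ∈ subJ b q J) :
    c * casimirMul b q J = casimirMul b q J * c := by
  have h := congrArg (fun x : Env b q => x • (1 : Hecke b q)) (casimir_comm hq hP hJ hne hc)
  simp only [mul_smul, casimir_smul_one] at h
  simpa only [TensorProduct.Algebra.smul_def, one_smul, op_smul_eq_mul, smul_eq_mul, one_mul] using h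

lemma casimirMul_mul_mem (hJ : J ⊆ simpleAff b) (hne : (alcoveFace b J).Nonempty) {h : Hecke b q}
    (hh : h ∈ realSpan b q J) : casimirMul b q J * h ∈ realSpan b q J := by
  rw [casimirMul, Finset.sum_mul]
  refine sum_mem fun w _ => ?_
  rw [smul_mul_assoc, smul_mul_assoc, mul_assoc, ← Complex.ofReal_inv, Complex.coe_smul]
  exact Submodule.smul_mem _ _ (T_mul_mem_realSpan hJ hne w.2
    (T_mul_mem_realSpan hJ hne (inv_mem w.2) hh))

/-- Since T_w and T_{w⁻¹} are adjoint, pairing the product with h gives the sum of q(w)⁻¹ times the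
norms of T_{w⁻¹} h. If it vanishes, so does the term of w = 1, which is the norm of h. -/
lemma eq_zero_of_casimirMul_mul (hq : IsParameter b q) (hJ : J ⊆ simpleAff b)
    (hne : (alcoveFace b J).Nonempty) {h : Hecke b q} (hh : h ∈ realSpan b q J)
    (h0 : casimirMul b q J * h = 0) : h = 0 := by
  have h1 : form hq (casimirMul b q J * h) h = ∑ w : stabJ P J,
      (((q w)⁻¹ : ℝ) : ℂ) * form hq (T b q w.1⁻¹ * h) (T b q w.1⁻¹ * h) := by
    simp only [casimirMul, Finset.sum_mul, map_sum, LinearMap.sum_apply, smul_mul_assoc, map_smul,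
      LinearMap.smul_apply, mul_assoc, smul_eq_mul, Complex.ofReal_inv]
    exact Finset.sum_congr rfl fun w _ => by rw [form_T_mul hq hJ hne w.2]
  have h2 := congrArg Complex.re h1
  rw [h0, map_zero, LinearMap.zero_apply, Complex.zero_re, Complex.re_sum] at h2
  simp only [Complex.re_ofReal_mul] at h2
  have h3 (w : stabJ P J) := form_self_nonneg hq hne (T_mul_mem_realSpan hJ hne (inv_mem w.2) hh)
  have h4 := (Finset.sum_eq_zero_iff_of_nonneg fun w _ =>
    mul_nonneg (inv_nonneg.mpr (hq.pos w.1).le) (h3 w).1).mp h2.symm 1 (Finset.mem_univ _)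
  have h5 := (h3 1).2 ((mul_eq_zero.mp h4).resolve_left (inv_ne_zero (hq.pos _).ne'))
  rwa [OneMemClass.coe_one, inv_one, T_one, one_mul] at h5

lemma T_mem_subJ {w : ExtWeyl P} (hw : w ∈ stabJ P J) : T b q w ∈ subJ b q J :=
  le_sup_left (a := Algebra.adjoin ℂ (T b q '' stabJ P J)) (Algebra.subset_adjoin ⟨w, hw, rfl⟩)

/-- W_J is finite, so multiplication by the Casimir image is an injective endomorphism of a
finite-dimensional real space, hence surjective, and 1 has a preimage. -/
lemma exists_casimirMul_mul_eq_one (hq : IsParameter b q) (hJ : J ⊆ simpleAff b)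
    (hne : (alcoveFace b J).Nonempty) : ∃ k ∈ realSpan b q J, casimirMul b q J * k = 1 := by
  have : Module.Finite ℝ (realSpan b q J) :=
    Module.Finite.iff_fg.mpr (Submodule.fg_span (Set.finite_range _))
  let m : realSpan b q J →ₗ[ℝ] realSpan b q J :=
    (LinearMap.mulLeft ℝ (casimirMul b q J)).restrict fun h hh => casimirMul_mul_mem hJ hne hh
  have hm : Function.Injective m := (injective_iff_map_eq_zero m).mpr fun h h0 =>
    Subtype.ext (eq_zero_of_casimirMul_mul hq hJ hne h.2 (congrArg Subtype.val h0))
  obtain ⟨k, hk⟩ := LinearMap.injective_iff_surjective.mp hm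
    ⟨1, by rw [← T_one b q]; exact T_mem_realSpan (one_mem _)⟩
  exact ⟨k, k.2, congrArg Subtype.val hk⟩

/-- The inverse of the image of the Casimir element is central in `H(W_J, q)`. -/
lemma exists_inverse_casimirMul (hq : IsParameter b q) (hP : IsSemisimpleDatum P)
    (hJ : J ⊆ simpleAff b) (hne : (alcoveFace b J).Nonempty) :
    ∃ k : Hecke b q, k * casimirMul b q J = 1 ∧ ∀ c ∈ subJ b q J, c * k = k * c := by
  obtain ⟨k, hkm, hk⟩ := exists_casimirMul_mul_eq_one (q := q) hq hJ hne
  have hcomm : k * casimirMul b q J = casimirMul b q J * k := by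
    rw [realSpan] at hkm
    clear hk
    induction hkm using Submodule.span_induction with
    | mem x hx =>
      obtain ⟨w, rfl⟩ := hx
      exact casimirMul_comm hq hP hJ hne (T_mem_subJ w.2)
    | zero => rw [zero_mul, mul_zero]
    | add x y _ _ hx hy => rw [add_mul, mul_add, hx, hy]
    | smul r x _ hx => rw [smul_mul_assoc, mul_smul_comm, hx]
  refine ⟨k, hcomm.trans hk, fun c hc => ?_⟩
  calc c * k = k * casimirMul b q J * (c * k) := by rw [hcomm, hk, one_mul]
    _ = k * (casimirMul b q J * c) * k := by simp only [mul_assoc]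
    _ = k * c * (casimirMul b q J * k) := by
      rw [← casimirMul_comm hq hP hJ hne hc]; simp only [mul_assoc]
    _ = k * c := by rw [hk, mul_one]

/-- The separability idempotent built from the Casimir element lifts the generator of
`H ⊗_{H(W_J, q)} H`. -/
lemma mkQ_casimir {k : Hecke b q} (hk : k * casimirMul b q J = 1)
    (hc : ∀ c ∈ subJ b q J, c * k = k * c) :
    (balanced b q J).mkQ (casimir b q J * k ⊗ₜ[ℂ] (1 : (Hecke b q)ᵐᵒᵖ)) =
      (balanced b q J).mkQ 1 := by
  have hT (w : stabJ P J) : (balanced b q J).mkQ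
      (casimirTerm b q w * k ⊗ₜ[ℂ] (1 : (Hecke b q)ᵐᵒᵖ)) =
      BalTensor.tmul b q J (k * (((q w : ℂ)⁻¹ • T b q w) * T b q w.1⁻¹)) 1 := by
    rw [casimirTerm, Algebra.TensorProduct.tmul_mul_tmul, mul_one, ← mul_assoc,
      BalTensor.mul_tmul (T_mem_subJ (inv_mem w.2)), mul_one,
      hc _ (Subalgebra.smul_mem _ (T_mem_subJ w.2) _)]
    rfl
  have h1 (h : Hecke b q) : BalTensor.tmul b q J h 1 =
      (balanced b q J).mkQ.toAddMonoidHom ((TensorProduct.mk ℂ (Hecke b q) (Hecke b q)ᵐᵒᵖ).flip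
        1 h) := rfl
  rw [casimir, Finset.sum_mul, map_sum, Finset.sum_congr rfl fun w _ => hT w]
  simp only [h1]
  refine (map_sum (balanced b q J).mkQ.toAddMonoidHom _ _).symm.trans ?_
  rw [← map_sum, ← Finset.mul_sum]
  exact congrArg (fun h : Hecke b q => BalTensor.tmul b q J h 1) hk

end Casimir

section ProjectiveEnv

variable {ι X Y : Type*} [Finite ι] [AddCommGroup X] [AddCommGroup Y] {P : RootDatum ι X Y}
  [P.IsReduced] {b : P.Base} {q : ExtWeyl P → ℝ}

/-- The Casimir element times the central inverse of its image is a separability element.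
Multiplying it by x defines a map on the quotient because c ⊗ 1 and 1 ⊗ c act on it equally, and
this map splits the projection from the free module of rank one. -/
theorem projective_balTensor (hq : IsParameter b q) (hP : IsSemisimpleDatum P)
    {J : Set (ι × ℤ)} (hJ : J ⊆ simpleAff b) (hne : (alcoveFace b J).Nonempty) :
    Module.Projective (Env b q) (BalTensor b q J) := by
  have := finite_stabJ hne
  have := Fintype.ofFinite (stabJ P J)
  obtain ⟨k, hk, hc⟩ := exists_inverse_casimirMul (q := q) hq hP hJ hne
  let e : Env b q := casimir b q J * k ⊗ₜ[ℂ] (1 : (Hecke b q)ᵐᵒᵖ)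
  let σ : (Env b q ⧸ balanced b q J) →ₗ[Env b q] Env b q :=
    (balanced b q J).liftQ (LinearMap.toSpanSingleton (Env b q) (Env b q) e) (by
      refine Submodule.span_le.mpr ?_
      rintro x ⟨c, hc, rfl⟩
      change (c ⊗ₜ[ℂ] (1 : (Hecke b q)ᵐᵒᵖ) - (1 : Hecke b q) ⊗ₜ[ℂ] op c) *
        (casimir b q J * k ⊗ₜ[ℂ] (1 : (Hecke b q)ᵐᵒᵖ)) = 0
      rw [← mul_assoc, sub_mul, casimir_comm hq hP hJ hne hc, sub_self, zero_mul])
  have hσ : (balanced b q J).mkQ ∘ₗ σ = LinearMap.id := by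
    refine LinearMap.ext fun m => ?_
    obtain ⟨x, rfl⟩ := (balanced b q J).mkQ_surjective m
    change (balanced b q J).mkQ (x • e) = (balanced b q J).mkQ x
    rw [map_smul, mkQ_casimir hk hc, ← map_smul, smul_eq_mul, mul_one]
  exact Module.Projective.of_split (P := Env b q ⧸ balanced b q J) σ (balanced b q J).mkQ hσ

theorem projective_PInv (o : Orientations b) (hq : IsParameter b q) (hP : IsSemisimpleDatum P)
    (n : ℕ) : Module.Projective (Env b q) (PInv q o n) := by
  classical
  have h (f : Facet b n) : Module.Projective (Env b q) (BalTensor b q f.J) :=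
    projective_balTensor hq hP f.subset f.nonempty
  have : Module.Projective (Env b q) (PMod b q n) := Module.Projective.of_equiv'
    (DFinsupp.linearEquivFunOnFintype (R := Env b q) (M := fun f : Facet b n => BalTensor b q f.J))
  exact Module.Projective.of_split (PInv q o n).subtype (toPInv q o n) (LinearMap.ext (toPInv_coe o))

end ProjectiveEnv

end

end AffineHecke

/-! ### Exactness and projectivity assembled -/

theorem mainTheorem8 {ι X Y : Type*} [Finite ι] [AddCommGroup X] [AddCommGroup Y]
    [Module.Finite ℤ X] [Module.Finite ℤ Y] (P : RootDatum ι X Y) [P.IsReduced] (b : P.Base)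
    (q : AffineHecke.ExtWeyl P → ℝ) (hq : AffineHecke.IsParameter b q)
    (o : AffineHecke.Orientations b) :
    -- exactness of `0 ← H ← P_0(H)^Ω ← P_1(H)^Ω ← ⋯`
    Submodule.map (AffineHecke.augmentation b q) (AffineHecke.PInv q o 0) = ⊤ ∧
    Submodule.map (AffineHecke.diff q o 0) (AffineHecke.PInv q o 1) =
      AffineHecke.PInv q o 0 ⊓ LinearMap.ker (AffineHecke.augmentation b q) ∧
    (∀ n, Submodule.map (AffineHecke.diff q o (n + 1)) (AffineHecke.PInv q o (n + 2)) =
      AffineHecke.PInv q o (n + 1) ⊓ LinearMap.ker (AffineHecke.diff q o n)) ∧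
    -- the complex stops in degree `r`, the rank of the root system
    (∀ n, b.support.card < n → Subsingleton (AffineHecke.PMod b q n)) ∧
    (∀ n, AffineHecke.ProjectiveLeft b q (AffineHecke.PInv q o n)) ∧
    (∀ n, AffineHecke.ProjectiveRight b q (AffineHecke.PInv q o n)) ∧
    (AffineHecke.IsSemisimpleDatum P →
      ∀ n, Module.Projective (AffineHecke.Env b q) (AffineHecke.PInv q o n)) := by
  refine ⟨AffineHecke.map_augmentation o hq, AffineHecke.map_diff_zero o hq,
    AffineHecke.map_diff_succ o hq, fun n hn => ?_, AffineHecke.projectiveLeft_PInv o hq,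
    AffineHecke.projectiveRight_PInv o hq, AffineHecke.projective_PInv o hq⟩
  have := AffineHecke.isEmpty_facet hn
  infer_instance
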